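/- **Notation.** $\|\cdot\|$ is the Euclidean norm of vectors and the induced norm of matrices, $\lambda_{\min},\lambda_{\max}$ are the extreme eigenvalues of a symmetric matrix, $v^\times$ is the cross-product matrix of $v\in\mathbb R^3$, and $\mathbb S^3$ is the set of unit quaternions $Q=[q_0,q^T]^T$ ($q_0$ scalar part, $q$ vector part) with quaternion product $\otimes$. Put $G(Q)=q_0I+q^\times$, $R(Q)=I-2q_0q^\times+2q^\times q^\times$, $\Xi(J,w,v)=(J(w+v))^\times-v^\times J-Jv^\times$, $$\Psi(J,Q,w,v)=-\tfrac12k^2q^\times Jq+\tfrac12kG(Q)Jw-k\,\Xi(J,0,v)q,\qquad \Psi_d(J,Q)=(R(Q)\omega_d)^\times JR(Q)\omega_d+JR(Q)\dot\omega_d .$$ **Plant.** The desired motion is $Q_d(t)\in\mathbb S^3$, $\dot Q_d=\tfrac12[-q_d^T;G(Q_d)]\omega_d$, with $\omega_d,\dot\omega_d$ continuous, $\|\omega_d\|\le\rho_v$, $\|\dot\omega_d\|\le\rho_a$. The attitude tracking system has state $(Q_e,s)\in\mathbb S^3\times\mathbb R^3$, where $s=\omega_e+kq_e$, $\bar\omega_d=R(Q_e)\omega_d$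 and $$\dot Q_e=\tfrac12\begin{bmatrix}-q_e^T\\ G(Q_e)\end{bmatrix}\omega_e,\qquad J\dot s=\Xi(J,\omega_e,\bar\omega_d)s+\tfrac12k(q_e^\times J+Jq_e^\times)s+\Psi(J,Q_e,\omega_e,\bar\omega_d)-\Psi_d(J,Q_e)+DE(t)\tau_u+\tau_d(t).$$ Here $J=J^T$ with $0<\lambda_l\le\lambda_{\min}(J)\le\lambda_{\max}(J)\le\lambda_r$; $D\in\mathbb R^{3\times m}$, $m\ge3$, has unit columns; $E=\mathrm{diag}(e_1,\dots,e_m)$ with $0\le e_i(t)\le1$. Known estimates are $\hat J=\hat J^T$, $\hat\tau_d(t)$ and $\hat E=\mathrm{diag}(\hat e_1,\dots,\hat e_m)$ with $0\le\hat e_i(t)\le1$, and for all $t\ge0$: $\|\hat J-J\|\le\rho_J$, $\|\hat\tau_d-\tau_d\|\le\rho_d$, $\|\hat\tau_d\|\le\hat\rho_d$, $\operatorname{rank}(DE)=\operatorname{rank}(D\hat E)=3$, and $\|D(E-\hat E)\hat E^2D^T(D\hat E^3D^T)^{-1}\|\le\rho_E$ with $0\le\rho_E<1$. The signals $E,\hat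 E,\tau_d,\hat\tau_d$ are measurable in time, and solutions are understood in the Carathéodory sense (locally absolutely continuous, equations valid for almost every $t$). **Observer.** The estimates of the attitude $Q=Q_d\otimes Q_e$ and angular velocity $\omega=\omega_e+\bar\omega_d$ are $\hat Q=Q\otimes\tilde Q^{-1}$, $\hat\omega=\omega+\tilde\omega$, with $\tilde Q(t)=[\tilde q_0,\tilde q^T]^T\in\mathbb S^3$ and $\tilde\omega(t)$ continuous and bounded on $[0,\infty)$, $\limsup_{t\to\infty}\|\tilde q\|\le\rho_q$, $\limsup_{t\to\infty}\|\tilde\omega\|\le\rho_\omega$, $0\le\rho_q<1$, $\rho_\omega\ge0$, and $\tilde q_0(t)\ge0$ for all large $t$. **Controller.** Put $\hat Q_e=Q_d^{-1}\otimes\hat Q$, $\hat\omega_e=\hat\omega-R(\hat Q_e)\omega_d$, $\hat s=\hat\omega_e+k\hat q_e$. The command torque is $\tau_u=\hat E^2D^T(D\hat E^3D^T)^{-1}u$ with $$u=-K\hat s+u_s+\Psi_d(\hat J,\hat Q_e)-\Psi(\hat J,\hat Q_e,\hat\omega_e,R(\hat Q_e)\omega_d)-\hat\tau_d,\qquad u_s=-\frac{a_1(\|\hat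 q_e\|+\gamma)+a_0}{\max(\|\hat s\|,\varepsilon)}\,\hat s,$$ $K=K^T$ positive definite. **Constants.** $\rho_0=\sqrt{2(1-\sqrt{1-\rho_q^2})}$, $\rho_s=\rho_\omega+2\rho_q\rho_v+k\rho_0$, $a_3=\tfrac12k(\rho_0\|\hat J\|+\rho_J)$, $a_2=\tfrac12k^2\rho_J$, $a_1=k^2\rho_0\|\hat J\|+ka_3+3k\rho_v(\rho_J+2\rho_q\|\hat J\|)$, $$a_0=\|\hat J\|\big(\tfrac12k^2\rho_0^2+\tfrac12k(\rho_\omega+2\rho_q\rho_v)+3k\rho_v\rho_0+4\rho_q\rho_v^2+2\rho_q\rho_a\big)+\rho_J\rho_v^2+\rho_J\rho_a+\rho_d,$$ $b_3=\tfrac12k\|\hat J\|+\lambda_{\max}(K)$, $b_2=\tfrac12k^2\|\hat J\|$, $b_1=2b_2\rho_0+\tfrac12k^2\|\hat J\|+3k\rho_v\|\hat J\|+a_1$, $$b_0=b_2\rho_0^2+\tfrac12k(\rho_\omega+2\rho_q\rho_v)\|\hat J\|+3k\rho_v\rho_0\|\hat J\|+\lambda_{\max}(K)\rho_s+a_1(\rho_0+\gamma)+a_0+(\rho_v^2+\rho_a)\|\hat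 J\|+\hat\rho_d,$$ $\kappa=\lambda_{\min}(K)-a_3-\rho_Eb_3$, and $\bar\phi(x,y)=\max\{\phi_1(x,y),\phi_2(x,y)\}$ with $$\phi_1(x,y)=(a_2+\rho_Eb_2)x^2+[2\varepsilon^{-1}a_1(\rho_s+y)+\rho_Eb_1]x+2\varepsilon^{-1}(\rho_s+y)[a_1(\gamma+\rho_0+y)+a_0]+\rho_Eb_0+(2+\lambda_{\max}(K)+a_1)y-(a_1\gamma-a_1\rho_0-\lambda_{\max}(K)\rho_s),$$ $$\phi_2(x,y)=(a_2+\rho_Eb_2)x^2+[\varepsilon^{-1}a_1(\rho_s+y)+a_1+\rho_Eb_1]x+\varepsilon^{-1}(\rho_s+y)[a_1(\gamma+\rho_0+y)+a_0]+a_0+\rho_Eb_0+\lambda_{\max}(K)(\rho_s+y)+2y.$$ **Theorem.** Suppose $k>0$, $\lambda_{\min}(K)>a_3+\rho_E(k\|\hat J\|/2+\lambda_{\max}(K))$, $\gamma>0$ and $\varepsilon>\rho_s$. Then the closed loop has no finite escape time: every initial state in $\mathbb S^3\times\mathbb R^3$ admits a solution on $[0,\infty)$, and every solution on a bounded interval $[0,T)$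 continues to a solution on $[0,\infty)$. Moreover $\kappa>0$, and with $\bar q_0=1$, $$\bar s_i=\sqrt{\frac{\lambda_r}{\lambda_l}}\,\frac{\bar\phi(\bar q_{i-1},0)}{\kappa},\qquad \bar q_i=k^{-1}\bar s_i\qquad(i\ge1),$$ every solution on $[0,\infty)$ satisfies, for every $i\ge1$, $$\limsup_{t\to\infty}\|s(t)\|\le\bar s_i,\qquad \limsup_{t\to\infty}\|q_e(t)\|\le\bar q_i,\qquad \limsup_{t\to\infty}\|\omega_e(t)\|\le2\bar s_i .$$ If moreover $\bar q_1<1$, then both sequences $\{\bar s_i\}_{i\ge1}$ and $\{\bar q_i\}_{i\ge0}$ converge, and they are strictly decreasing provided that $\rho_q,\rho_J,\rho_E$ are not all zero. -/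

import Mathlib

open scoped Quaternion

noncomputable section

namespace AttitudeTracking

/-! ### Vectors, matrices, quaternions -/

/-- Column vectors of `ℝ³` with the Euclidean norm. -/
abbrev V3 := EuclideanSpace ℝ (Fin 3)

/-- Real `3 × 3` matrices. -/
abbrev M3 := Matrix (Fin 3) (Fin 3) ℝ

/-- The matrix-vector product `A x` for Euclidean vectors. -/
def act {a b : ℕ} (A : Matrix (Fin a) (Fin b) ℝ) (x : EuclideanSpace ℝ (Fin b)) :
    EuclideanSpace ℝ (Fin a) :=
  Matrix.toEuclideanLin A x

local infixr:73 " ⬝ₐ " => act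

/-- The matrix norm induced by the Euclidean norm. -/
def matNorm (A : M3) : ℝ := ‖Matrix.toEuclideanCLM (n := Fin 3) (𝕜 := ℝ) A‖

/-- Smallest eigenvalue (used for symmetric matrices only). -/
def lamMin (A : M3) : ℝ := sInf (spectrum ℝ A)

/-- Largest eigenvalue (used for symmetric matrices only). -/
def lamMax (A : M3) : ℝ := sSup (spectrum ℝ A)

/-- The skew-symmetric matrix `v^×` of the cross product. -/
def skew (v : V3) : M3 :=
  !![0, -v 2, v 1;
     v 2, 0, -v 0;
     -v 1, v 0, 0]

/-- Vector part of a quaternion. The scalar part is `q.re`, and the product `q ⊗ p` is the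
product of Mathlib's (Hamilton) quaternions. -/
def vec (q : ℍ[ℝ]) : V3 := !₂[q.imI, q.imJ, q.imK]

/-- The quaternion with scalar part `r` and vector part `v`. -/
def ofParts (r : ℝ) (v : V3) : ℍ[ℝ] := ⟨r, v 0, v 1, v 2⟩

/-- `G(q) = q₀ I + q^×`. -/
def G (q : ℍ[ℝ]) : M3 := q.re • (1 : M3) + skew (vec q)

/-- The rotation matrix `R(q) = I - 2 q₀ q^× + 2 q^× q^×`. -/
def R (q : ℍ[ℝ]) : M3 :=
  1 - (2 * q.re) • skew (vec q) + (2 : ℝ) • (skew (vec q) * skew (vec q))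

/-- Attitude kinematics: the right-hand side `½ [-qᵀ; G(q)] ω`. -/
def kinematics (q : ℍ[ℝ]) (w : V3) : ℍ[ℝ] :=
  (1 / 2 : ℝ) • ofParts (-(inner ℝ (vec q) w)) (G q ⬝ₐ w)

/-- `Ξ(J, w, v) = (J (w + v))^× - v^× J - J v^×`. -/
def Xi (J : M3) (w v : V3) : M3 := skew (J ⬝ₐ (w + v)) - skew v * J - J * skew v

/-- `ψ = -½ k² q^× J q + ½ k G(q) J w - k Ξ(J, 0, v) q`. -/
def psi (k : ℝ) (J : M3) (q : ℍ[ℝ]) (w v : V3) : V3 :=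
  -(((1 / 2 : ℝ) * k ^ 2) • (skew (vec q) ⬝ₐ J ⬝ₐ vec q))
    + ((1 / 2 : ℝ) * k) • (G q ⬝ₐ J ⬝ₐ w)
    - k • (Xi J 0 v ⬝ₐ vec q)

/-- `ψ_d = v^× J v + J R(q) a` with `v = R(q) ω_d` and `a` the derivative of `ω_d`. -/
def psiD (J : M3) (q : ℍ[ℝ]) (wd a : V3) : V3 :=
  skew (R q ⬝ₐ wd) ⬝ₐ J ⬝ₐ (R q ⬝ₐ wd) + J ⬝ₐ R q ⬝ₐ a

/-! ### The data of the control problem -/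

/-- All data of the tracking problem with `m` pairs of thrusters: plant, actuators and faults,
reference motion, estimation errors, controller gains and uncertainty bounds.
Nothing is assumed here. -/
structure Data (m : ℕ) where
  /-- true inertia -/
  J : M3
  /-- estimated inertia -/
  Jhat : M3
  /-- actuator distribution matrix, with columns `d_i` -/
  D : Matrix (Fin 3) (Fin m) ℝ
  /-- health indicators `e_i(t)` -/
  e : ℝ → Fin m → ℝ
  /-- estimated health indicators -/
  ehat : ℝ → Fin m → ℝ
  /-- disturbance torque -/
  taud : ℝ → V3
  /-- estimated disturbance torque -/
  taudhat : ℝ → V3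
  /-- desired attitude -/
  qd : ℝ → ℍ[ℝ]
  /-- desired angular velocity -/
  wd : ℝ → V3
  /-- derivative of the desired angular velocity -/
  wd' : ℝ → V3
  /-- attitude estimation error of the observer -/
  qtil : ℝ → ℍ[ℝ]
  /-- angular velocity estimation error of the observer -/
  wtil : ℝ → V3
  /-- gain in the sliding variable -/
  k : ℝ
  /-- feedback gain matrix -/
  K : M3
  /-- robustness gain -/
  gam : ℝ
  /-- boundary layer width -/
  eps : ℝ
  /-- bound on the vector part of the attitude estimation error -/
  rhoq : ℝ
  /-- bound on the angular velocity estimation error -/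
  rhow : ℝ
  /-- bound on the effect of the fault estimation error -/
  rhoE : ℝ
  /-- bound on the inertia estimation error -/
  rhoJ : ℝ
  /-- bound on the disturbance estimation error -/
  rhod : ℝ
  /-- bound on the disturbance estimate -/
  rhodhat : ℝ
  /-- bound on the desired angular velocity -/
  rhov : ℝ
  /-- bound on the derivative of the desired angular velocity -/
  rhoa : ℝ
  /-- lower bound on the spectrum of the inertia -/
  lamL : ℝ
  /-- upper bound on the spectrum of the inertia -/
  lamR : ℝ

namespace Data

variable {m : ℕ} (P : Data m)

/-- `E(t) = diag(e_1(t), …, e_m(t))`. -/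
def E (t : ℝ) : Matrix (Fin m) (Fin m) ℝ := Matrix.diagonal (P.e t)

/-- `Ê(t) = diag(ê_1(t), …, ê_m(t))`. -/
def Ehat (t : ℝ) : Matrix (Fin m) (Fin m) ℝ := Matrix.diagonal (P.ehat t)

/-- `H = D Ẽ Ê² Dᵀ (D Ê³ Dᵀ)⁻¹` with `Ẽ = E - Ê`. -/
def H (t : ℝ) : M3 :=
  P.D * (P.E t - P.Ehat t) * P.Ehat t ^ 2 * P.D.transpose
    * (P.D * P.Ehat t ^ 3 * P.D.transpose)⁻¹

/-! ### Constants -/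

def rho0 : ℝ := Real.sqrt (2 * (1 - Real.sqrt (1 - P.rhoq ^ 2)))

def rhos : ℝ := P.rhow + 2 * P.rhoq * P.rhov + P.k * P.rho0

def a3 : ℝ := 1 / 2 * P.k * (P.rho0 * matNorm P.Jhat + P.rhoJ)

def a2 : ℝ := 1 / 2 * P.k ^ 2 * P.rhoJ

def a1 : ℝ :=
  P.k ^ 2 * P.rho0 * matNorm P.Jhat + P.k * P.a3
    + 3 * P.k * P.rhov * (P.rhoJ + 2 * P.rhoq * matNorm P.Jhat)

def a0 : ℝ :=
  1 / 2 * P.k ^ 2 * P.rho0 ^ 2 * matNorm P.Jhat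
    + 1 / 2 * P.k * (P.rhow + 2 * P.rhoq * P.rhov) * matNorm P.Jhat
    + 3 * P.k * P.rhov * P.rho0 * matNorm P.Jhat
    + 4 * P.rhoq * P.rhov ^ 2 * matNorm P.Jhat
    + 2 * P.rhoq * P.rhoa * matNorm P.Jhat
    + P.rhoJ * P.rhov ^ 2 + P.rhoJ * P.rhoa + P.rhod

def b3 : ℝ := 1 / 2 * P.k * matNorm P.Jhat + lamMax P.K

def b2 : ℝ := 1 / 2 * P.k ^ 2 * matNorm P.Jhat

def b1 : ℝ :=
  2 * P.b2 * P.rho0 + 1 / 2 * P.k ^ 2 * matNorm P.Jhat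
    + 3 * P.k * P.rhov * matNorm P.Jhat + P.a1

def b0 : ℝ :=
  P.b2 * P.rho0 ^ 2 + 1 / 2 * P.k * (P.rhow + 2 * P.rhoq * P.rhov) * matNorm P.Jhat
    + 3 * P.k * P.rhov * P.rho0 * matNorm P.Jhat
    + lamMax P.K * P.rhos + P.a1 * (P.rho0 + P.gam) + P.a0
    + (P.rhov ^ 2 + P.rhoa) * matNorm P.Jhat + P.rhodhat

def kappa : ℝ := lamMin P.K - P.a3 - P.rhoE * P.b3

def phi1 (x y : ℝ) : ℝ :=
  (P.a2 + P.rhoE * P.b2) * x ^ 2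
    + (2 * P.eps⁻¹ * P.a1 * (P.rhos + y) + P.rhoE * P.b1) * x
    + 2 * P.eps⁻¹ * (P.rhos + y) * (P.a1 * (P.gam + P.rho0 + y) + P.a0)
    + P.rhoE * P.b0
    + (2 + lamMax P.K + P.a1) * y
    - (P.a1 * P.gam - P.a1 * P.rho0 - lamMax P.K * P.rhos)

def phi2 (x y : ℝ) : ℝ :=
  (P.a2 + P.rhoE * P.b2) * x ^ 2
    + (P.eps⁻¹ * P.a1 * (P.rhos + y) + P.a1 + P.rhoE * P.b1) * x
    + P.eps⁻¹ * (P.rhos + y) * (P.a1 * (P.gam + P.rho0 + y) + P.a0)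
    + P.a0 + P.rhoE * P.b0 + lamMax P.K * (P.rhos + y) + 2 * y

def phiBar (x y : ℝ) : ℝ := max (P.phi1 x y) (P.phi2 x y)

/-- The bounds `q̄_i`: `q̄_0 = 1` and `q̄_{i+1} = k⁻¹ √(λ_r/λ_l) φ̄(q̄_i, 0) / κ`. -/
def qbar : ℕ → ℝ
  | 0 => 1
  | i + 1 => P.k⁻¹ * (Real.sqrt (P.lamR / P.lamL) * (P.phiBar (qbar i) 0 / P.kappa))

/-- The bounds `s̄_i = √(λ_r/λ_l) φ̄(q̄_{i-1}, 0) / κ`, meaningful for `i ≥ 1`. -/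
def sbar (i : ℕ) : ℝ :=
  Real.sqrt (P.lamR / P.lamL) * (P.phiBar (P.qbar (i - 1)) 0 / P.kappa)

/-! ### Standing assumptions -/

/-- The assumptions on plant, actuators, reference motion and observer, for times `t ≥ 0`. -/
structure Standing : Prop where
  -- the observer: continuous, bounded, ultimately bounded estimation errors
  qtil_unit : ∀ t, 0 ≤ t → ‖P.qtil t‖ = 1
  qtil_cont : ContinuousOn P.qtil (Set.Ici 0)
  wtil_cont : ContinuousOn P.wtil (Set.Ici 0)
  wtil_bdd : ∃ B : ℝ, ∀ t, 0 ≤ t → ‖P.wtil t‖ ≤ B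
  rhoq_nonneg : 0 ≤ P.rhoq
  rhoq_lt_one : P.rhoq < 1
  rhow_nonneg : 0 ≤ P.rhow
  qtil_limsup :
    Filter.limsup (fun t => ((‖vec (P.qtil t)‖ : ℝ) : EReal)) Filter.atTop ≤ (P.rhoq : EReal)
  wtil_limsup :
    Filter.limsup (fun t => ((‖P.wtil t‖ : ℝ) : EReal)) Filter.atTop ≤ (P.rhow : EReal)
  -- choice of the sign of the error quaternion
  qtil_re : ∀ᶠ t in Filter.atTop, 0 ≤ (P.qtil t).re
  -- the actuators
  three_le : 3 ≤ m
  D_unit : ∀ i, ‖(WithLp.toLp 2 (fun j => P.D j i) : V3)‖ = 1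
  e_meas : Measurable P.e
  ehat_meas : Measurable P.ehat
  e_mem : ∀ t, 0 ≤ t → ∀ i, 0 ≤ P.e t i ∧ P.e t i ≤ 1
  ehat_mem : ∀ t, 0 ≤ t → ∀ i, 0 ≤ P.ehat t i ∧ P.ehat t i ≤ 1
  rank_E : ∀ t, 0 ≤ t → (P.D * P.E t).rank = 3
  rank_Ehat : ∀ t, 0 ≤ t → (P.D * P.Ehat t).rank = 3
  rhoE_nonneg : 0 ≤ P.rhoE
  rhoE_lt_one : P.rhoE < 1
  H_le : ∀ t, 0 ≤ t → matNorm (P.H t) ≤ P.rhoE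
  -- inertia and disturbance estimates
  Jhat_symm : P.Jhat.IsSymm
  J_err : matNorm (P.Jhat - P.J) ≤ P.rhoJ
  taud_meas : Measurable P.taud
  taudhat_meas : Measurable P.taudhat
  taud_err : ∀ t, 0 ≤ t → ‖P.taudhat t - P.taud t‖ ≤ P.rhod
  taudhat_le : ∀ t, 0 ≤ t → ‖P.taudhat t‖ ≤ P.rhodhat
  -- the inertia
  J_symm : P.J.IsSymm
  lamL_pos : 0 < P.lamL
  lamL_le : P.lamL ≤ lamMin P.J
  le_lamR : lamMax P.J ≤ P.lamR
  -- the reference motion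
  qd_unit : ∀ t, 0 ≤ t → ‖P.qd t‖ = 1
  qd_deriv : ∀ t, 0 ≤ t →
    HasDerivWithinAt P.qd (kinematics (P.qd t) (P.wd t)) (Set.Ici 0) t
  wd_deriv : ∀ t, 0 ≤ t → HasDerivWithinAt P.wd (P.wd' t) (Set.Ici 0) t
  wd'_cont : ContinuousOn P.wd' (Set.Ici 0)
  wd_le : ∀ t, 0 ≤ t → ‖P.wd t‖ ≤ P.rhov
  wd'_le : ∀ t, 0 ≤ t → ‖P.wd' t‖ ≤ P.rhoa

/-! ### The closed loop, with state `(q_e, s)` -/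

/-- `ω_e = s - k q_e`, that is, `s = ω_e + k q_e`. -/
def omegaE (qe : ℍ[ℝ]) (s : V3) : V3 := s - P.k • vec qe

/-- Estimated attitude `q̂ = q ⊗ q̃⁻¹`, where `q = q_d ⊗ q_e` is the attitude. -/
def qHat (t : ℝ) (qe : ℍ[ℝ]) : ℍ[ℝ] := P.qd t * qe * (P.qtil t)⁻¹

/-- Estimated angular velocity `ω̂ = ω + ω̃`, where `ω = ω_e + R(q_e) ω_d`. -/
def omegaHat (t : ℝ) (qe : ℍ[ℝ]) (s : V3) : V3 :=
  P.omegaE qe s + R qe ⬝ₐ P.wd t + P.wtil t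

/-- Estimated attitude tracking error `q̂_e = q_d⁻¹ ⊗ q̂`. -/
def qeHat (t : ℝ) (qe : ℍ[ℝ]) : ℍ[ℝ] := (P.qd t)⁻¹ * P.qHat t qe

/-- Estimated angular velocity tracking error `ω̂_e = ω̂ - R(q̂_e) ω_d`. -/
def omegaEHat (t : ℝ) (qe : ℍ[ℝ]) (s : V3) : V3 :=
  P.omegaHat t qe s - R (P.qeHat t qe) ⬝ₐ P.wd t

/-- Estimated sliding variable `ŝ = ω̂_e + k q̂_e`. -/
def sHat (t : ℝ) (qe : ℍ[ℝ]) (s : V3) : V3 :=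
  P.omegaEHat t qe s + P.k • vec (P.qeHat t qe)

/-- The continuous sliding-mode term `u_s`. -/
def uS (t : ℝ) (qe : ℍ[ℝ]) (s : V3) : V3 :=
  if P.eps ≤ ‖P.sHat t qe s‖ then
    -(((P.a1 * (‖vec (P.qeHat t qe)‖ + P.gam) + P.a0) / ‖P.sHat t qe s‖) • P.sHat t qe s)
  else
    -(((P.a1 * (‖vec (P.qeHat t qe)‖ + P.gam) + P.a0) / P.eps) • P.sHat t qe s)

/-- The virtual control torque `u = -K ŝ + u_s + ψ̂_d - ψ̂ - τ̂_d`. -/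
def u (t : ℝ) (qe : ℍ[ℝ]) (s : V3) : V3 :=
  -(P.K ⬝ₐ P.sHat t qe s) + P.uS t qe s
    + psiD P.Jhat (P.qeHat t qe) (P.wd t) (P.wd' t)
    - psi P.k P.Jhat (P.qeHat t qe) (P.omegaEHat t qe s) (R (P.qeHat t qe) ⬝ₐ P.wd t)
    - P.taudhat t

/-- The command torque `τ_u = Ê² Dᵀ (D Ê³ Dᵀ)⁻¹ u`. -/
def tauU (t : ℝ) (qe : ℍ[ℝ]) (s : V3) : EuclideanSpace ℝ (Fin m) :=
  (P.Ehat t ^ 2 * P.D.transpose * (P.D * P.Ehat t ^ 3 * P.D.transpose)⁻¹) ⬝ₐ P.u t qe s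

/-- The right-hand side of the closed-loop equation `J s' = …`, with `τ_c = D E(t) τ_u`. -/
def slidingRhs (t : ℝ) (qe : ℍ[ℝ]) (s : V3) : V3 :=
  Xi P.J (P.omegaE qe s) (R qe ⬝ₐ P.wd t) ⬝ₐ s
    + ((1 / 2 : ℝ) * P.k) • ((skew (vec qe) * P.J + P.J * skew (vec qe)) ⬝ₐ s)
    + psi P.k P.J qe (P.omegaE qe s) (R qe ⬝ₐ P.wd t)
    - psiD P.J qe (P.wd t) (P.wd' t)
    + (P.D * P.E t) ⬝ₐ P.tauU t qe s
    + P.taud t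

/-- `(q_e, s)` is a (Carathéodory) solution of the closed loop on `[0, T)`, `T ≤ ∞`: it takes
values in `S³ × ℝ³`, is absolutely continuous on compact subintervals of `[0, T)`, and satisfies
the differential equations at almost every time. -/
structure IsSolutionOn (T : EReal) (qe : ℝ → ℍ[ℝ]) (s : ℝ → V3) : Prop where
  unit : ∀ t : ℝ, 0 ≤ t → (t : EReal) < T → ‖qe t‖ = 1
  qe_ac : ∀ b : ℝ, 0 ≤ b → (b : EReal) < T → AbsolutelyContinuousOnInterval qe 0 b
  s_ac : ∀ b : ℝ, 0 ≤ b → (b : EReal) < T → AbsolutelyContinuousOnInterval s 0 b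
  ode : ∀ᵐ t : ℝ, 0 < t → (t : EReal) < T →
    HasDerivAt qe (kinematics (qe t) (P.omegaE (qe t) (s t))) t ∧
      ∃ s' : V3, HasDerivAt s s' t ∧ P.J ⬝ₐ s' = P.slidingRhs t (qe t) (s t)

end Data

end AttitudeTracking

end

/-!
The proof has three layers.

*Power balance.* For the energy `W = sᵀ J s`, the gyroscopic terms of the `s`-equation do no work
(`Data.inner_slidingRhs`), so `W' / 2 = ⟨s, forcing⟩`. The control allocation turns the command `u`
into the torque `(I + H) u` with `‖H‖ ≤ ρ_E` (`Data.act_E_tauU`). Hence the forcing is the mismatch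
between the model terms and their estimates, plus `-K ŝ + u_s`, plus `H u`. The constants `a_i`
bound the mismatch and the constants `b_i` bound `u` (`Data.norm_mismatch_le`, `Data.norm_u_le`);
both are proved for arbitrary bounds on the observer errors at one time, because the bounds in the
constants hold only asymptotically. With the estimate of the robust term inside and outside the
boundary layer, and continuity in the error bounds, this gives for all large `t`
`⟨s, J s'⟩ ≤ -(κ - η) ‖s‖² + ‖s‖ (φ̄(‖q_e‖, 0) + η)` (`Data.eventually_inner_slidingRhs_le`).

*Well-posedness.* The closed loop is a locally Lipschitz function of the state and of finitely many
bounded measurable signals. Retracting the state to a ball makes it bounded and globally Lipschitz,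
and a contraction argument in an exponentially weighted norm solves the retracted equation on
`[0, ∞)` (`exists_caratheodory_solution`). The retraction is radial, so it keeps the unit norm of
the quaternion and the vanishing work of the gyroscopic terms; as the forcing grows at most linearly
in `s`, Grönwall's inequality bounds `s` on `[0, T]` independently of the radius of the ball, and for
a large radius the retraction is not felt (`Data.exists_solution_bounded`). Uniqueness is Grönwall's
inequality again, and allows gluing and continuation.

*Ultimate bounds.* If `limsup ‖q_e‖ ≤ X`, then the power balance makes `W` decrease at a positive
rate above each level exceeding `λ_r (φ̄(X, 0) / κ)²`, which bounds `limsup ‖s‖`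
(`Data.limsup_s_le`). Conversely `limsup ‖s‖ ≤ σ` gives `limsup ‖q_e‖ ≤ σ / k`
(`Data.limsup_vec_le`): the scalar part `q₀` of the quaternion satisfies
`q₀' ≥ ‖q_e‖ (k ‖q_e‖ - ‖s‖) / 2`, so that it is driven upwards through every value with
`‖q_e‖ > σ / k`, and ends near `-1` or near `1`. Starting from `‖q_e‖ ≤ 1` and alternating the two
gives the bounds for every `i`. Since `φ̄(·, 0)` is nondecreasing, and strictly increasing as soon as
one of `ρ_q`, `ρ_J`, `ρ_E` is positive, `q̄₁ < q̄₀` propagates along the recursion.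
-/

noncomputable section

open Set Filter Topology MeasureTheory

/-! ### Absolutely continuous functions -/

theorem AbsolutelyContinuousOnInterval.lipschitzOnWith_comp {X Y : Type*} [PseudoMetricSpace X]
    [PseudoMetricSpace Y] {f : ℝ → X} {g : X → Y} {a b : ℝ} {K : NNReal}
    (hg : LipschitzOnWith K g (f '' uIcc a b)) (hf : AbsolutelyContinuousOnInterval f a b) :
    AbsolutelyContinuousOnInterval (fun t => g (f t)) a b := by
  unfold AbsolutelyContinuousOnInterval at hf ⊢
  have h0 := hf.const_mul (K : ℝ)
  rw [mul_zero] at h0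
  refine squeeze_zero' (Eventually.of_forall fun E => Finset.sum_nonneg fun i _ => dist_nonneg)
    ?_ h0
  refine eventually_inf_principal.mpr (Eventually.of_forall fun E hE => ?_)
  rw [Finset.mul_sum]
  refine Finset.sum_le_sum fun i hi => ?_
  exact hg.dist_le_mul _ (mem_image_of_mem f (hE.1 i hi).1) _ (mem_image_of_mem f (hE.1 i hi).2)

theorem AbsolutelyContinuousOnInterval.locallyLipschitz_comp {X Y : Type*} [PseudoMetricSpace Y]
    [NormedAddCommGroup X] {f : ℝ → X} {g : X → Y} {a b : ℝ}
    (hg : LocallyLipschitz g) (hf : AbsolutelyContinuousOnInterval f a b) :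
    AbsolutelyContinuousOnInterval (fun t => g (f t)) a b := by
  obtain ⟨K, hK⟩ := (hg.locallyLipschitzOn (s := f '' uIcc a b)).exists_lipschitzOnWith_of_compact
    (isCompact_uIcc.image_of_continuousOn hf.continuousOn)
  exact hf.lipschitzOnWith_comp hK

theorem AbsolutelyContinuousOnInterval.norm_sq {X : Type*} [NormedAddCommGroup X]
    [InnerProductSpace ℝ X] {f : ℝ → X} {a b : ℝ} (hf : AbsolutelyContinuousOnInterval f a b) :
    AbsolutelyContinuousOnInterval (fun t => ‖f t‖ ^ 2) a b :=
  AbsolutelyContinuousOnInterval.locallyLipschitz_comp (g := fun x : X => ‖x‖ ^ 2)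
    (contDiff_norm_sq ℝ (n := 1)).locallyLipschitz hf

theorem AbsolutelyContinuousOnInterval.congr_of_eqOn {X : Type*} [PseudoMetricSpace X]
    {f g : ℝ → X} {a b : ℝ} (hf : AbsolutelyContinuousOnInterval f a b)
    (h : EqOn f g (uIcc a b)) : AbsolutelyContinuousOnInterval g a b := by
  rw [absolutelyContinuousOnInterval_iff] at hf ⊢
  intro ε hε
  obtain ⟨δ, hδ, H⟩ := hf ε hε
  refine ⟨δ, hδ, fun E hE hlt => ?_⟩
  have := H E hE hlt
  rwa [Finset.sum_congr rfl (fun i hi => by rw [h (hE.1 i hi).1, h (hE.1 i hi).2])] at this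

/-- An absolutely continuous function whose derivative is almost everywhere bounded below grows at
least linearly. -/
theorem AbsolutelyContinuousOnInterval.mul_le_sub_of_ae_hasDerivAt {f : ℝ → ℝ} {a b μ : ℝ}
    (hab : a ≤ b) (hf : AbsolutelyContinuousOnInterval f a b)
    (h : ∀ᵐ t, a < t → t < b → ∃ d, HasDerivAt f d t ∧ μ ≤ d) : μ * (b - a) ≤ f b - f a := by
  rw [← hf.integral_deriv_eq_sub]
  have hc : ∫ _ in a..b, μ = μ * (b - a) := by simp [mul_comm]
  rw [← hc]
  refine intervalIntegral.integral_mono_ae_restrict hab (by simp) hf.intervalIntegrable_deriv ?_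
  have hb : ∀ᵐ t : ℝ, t ≠ b := by simp [ae_iff, measure_singleton]
  have ha : ∀ᵐ t : ℝ, t ≠ a := by simp [ae_iff, measure_singleton]
  rw [EventuallyLE, ae_restrict_iff' measurableSet_Icc]
  filter_upwards [h, ha, hb] with t ht hta htb hmem
  obtain ⟨d, hd, hμ⟩ := ht (lt_of_le_of_ne hmem.1 (Ne.symm hta)) (lt_of_le_of_ne hmem.2 htb)
  rwa [hd.deriv]

/-- Grönwall's inequality for absolutely continuous functions. -/
theorem AbsolutelyContinuousOnInterval.le_mul_exp_of_ae_hasDerivAt {f : ℝ → ℝ} {a b C : ℝ}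
    (hab : a ≤ b) (hf : AbsolutelyContinuousOnInterval f a b)
    (h : ∀ᵐ t, a < t → t < b → ∃ d, HasDerivAt f d t ∧ d ≤ C * f t) :
    f b ≤ f a * Real.exp (C * (b - a)) := by
  have hexp : ContDiff ℝ 1 (fun t : ℝ => -Real.exp (-(C * (t - a)))) := by fun_prop
  have hg := hexp.contDiffOn (s := uIcc a b) |>.absolutelyContinuousOnInterval
  have hfg := hg.fun_mul hf
  have key := hfg.mul_le_sub_of_ae_hasDerivAt (μ := 0) hab (by
    filter_upwards [h] with t ht hat htb
    obtain ⟨d, hd, hle⟩ := ht hat htb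
    have he : HasDerivAt (fun t : ℝ => -Real.exp (-(C * (t - a))))
        (-(Real.exp (-(C * (t - a))) * (-(C * 1)))) t :=
      ((((hasDerivAt_id t).sub_const a).const_mul C).neg).exp.neg
    refine ⟨_, he.mul hd, ?_⟩
    have := mul_nonneg (Real.exp_pos (-(C * (t - a)))).le (sub_nonneg.mpr hle)
    linarith)
  have hp := Real.exp_pos (C * (b - a))
  simp only [sub_self, mul_zero, neg_zero, Real.exp_zero, zero_mul] at key
  have h1 : Real.exp (-(C * (b - a))) * f b ≤ f a := by linarith
  rw [Real.exp_neg] at h1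
  rw [inv_mul_le_iff₀ hp] at h1
  linarith

/-- A level `c` is never recrossed downwards, if `f` is nondecreasing while in a band `(c', c)`
below that level. -/
theorem le_of_ae_deriv_nonneg_of_band {f : ℝ → ℝ} {a b c c' : ℝ} (hab : a ≤ b) (hc : c' < c)
    (hf : AbsolutelyContinuousOnInterval f a b) (hfa : c ≤ f a)
    (h : ∀ᵐ t, a < t → t < b → c' < f t → f t < c → ∃ d, HasDerivAt f d t ∧ 0 ≤ d) :
    c ≤ f b := by
  by_contra! hfb
  have hcont : ContinuousOn f (Icc a b) := by
    have := hf.continuousOn; rwa [uIcc_of_le hab] at this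
  -- the last time at which the level is attained
  set S := {t ∈ Icc a b | c ≤ f t} with hS
  have hSc : IsCompact S := by
    refine isCompact_Icc.of_isClosed_subset ?_ (sep_subset _ _)
    exact hcont.preimage_isClosed_of_isClosed isClosed_Icc isClosed_Ici
  have hSn : S.Nonempty := ⟨a, ⟨le_refl _, hab⟩, hfa⟩
  obtain ⟨τ, hτ, hmax⟩ := hSc.exists_isGreatest hSn
  have hτb : τ < b := lt_of_le_of_ne hτ.1.2 (by rintro rfl; exact absurd hτ.2 (not_le.mpr hfb))
  have hlt : ∀ t, τ < t → t ≤ b → f t < c := fun t h1 h2 => by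
    by_contra! h3
    exact absurd (hmax ⟨⟨hτ.1.1.trans h1.le, h2⟩, h3⟩) (not_le.mpr h1)
  have hev : ∀ᶠ t in 𝓝[Icc a b] τ, c' < f t :=
    (hcont τ hτ.1).eventually_const_lt (lt_of_lt_of_le hc hτ.2)
  obtain ⟨δ, hδ, hball⟩ := Metric.mem_nhdsWithin_iff.mp hev
  set r := min b (τ + δ / 2) with hr
  have hτr : τ < r := lt_min hτb (by linarith)
  have hrb : r ≤ b := min_le_left _ _
  have hrδ : r ≤ τ + δ / 2 := min_le_right _ _
  have hsub : uIcc τ r ⊆ uIcc a b := by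
    rw [uIcc_of_le hτr.le, uIcc_of_le hab]; exact Icc_subset_Icc hτ.1.1 hrb
  have := (hf.mono hsub).mul_le_sub_of_ae_hasDerivAt (μ := 0) hτr.le (by
    filter_upwards [h] with t ht h1 h2
    refine ht (lt_of_le_of_lt hτ.1.1 h1) (lt_of_lt_of_le h2 hrb) ?_ (hlt t h1 (h2.le.trans hrb))
    refine hball ⟨?_, hτ.1.1.trans h1.le, h2.le.trans hrb⟩
    rw [Metric.mem_ball, Real.dist_eq, abs_lt]
    constructor <;> linarith)
  have h2 := hlt r hτr hrb
  have h3 := hτ.2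
  linarith

/-- If `f` grows at least at a fixed rate while it is below the level `c`, then it is eventually
above that level. -/
theorem eventually_le_of_ae_deriv_ge {f : ℝ → ℝ} {a c μ : ℝ} (hμ : 0 < μ)
    (hf : ∀ b, a ≤ b → AbsolutelyContinuousOnInterval f a b)
    (h : ∀ᵐ t, a < t → f t < c → ∃ d, HasDerivAt f d t ∧ μ ≤ d) :
    ∀ᶠ t in atTop, c ≤ f t := by
  obtain ⟨t₁, ht₁, hft₁⟩ : ∃ t₁, a ≤ t₁ ∧ c ≤ f t₁ := by
    by_contra! hlt
    have hb : a ≤ a + (|c - f a| + 1) / μ := by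
      have := div_nonneg (add_nonneg (abs_nonneg (c - f a)) zero_le_one) hμ.le
      linarith
    have := (hf _ hb).mul_le_sub_of_ae_hasDerivAt (μ := μ) hb (by
      filter_upwards [h] with t ht h1 _
      exact ht h1 (hlt t h1.le))
    have h2 := hlt _ hb
    rw [add_sub_cancel_left, mul_div_cancel₀ _ hμ.ne'] at this
    have := le_abs_self (c - f a)
    linarith
  filter_upwards [eventually_ge_atTop t₁] with t ht
  refine le_of_ae_deriv_nonneg_of_band (c' := c - 1) ht (by linarith)
    ((hf t (ht₁.trans ht)).mono ?_) hft₁ ?_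
  · rw [uIcc_of_le ht, uIcc_of_le (ht₁.trans ht)]; exact Icc_subset_Icc_left ht₁
  · filter_upwards [h] with s hs h1 _ _ h4
    obtain ⟨d, hd, hd'⟩ := hs (lt_of_le_of_lt ht₁ h1) h4
    exact ⟨d, hd, hμ.le.trans hd'⟩

/-! ### Carathéodory solutions of globally Lipschitz equations -/

section Caratheodory

variable {E : Type*} [NormedAddCommGroup E]

theorem intervalIntegrable_of_norm_le {g : ℝ → E} {M : ℝ}
    (hg : AEStronglyMeasurable g volume) (hM : ∀ t, ‖g t‖ ≤ M) (a b : ℝ) :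
    IntervalIntegrable g volume a b :=
  (intervalIntegrable_const (c := M)).mono_fun hg.restrict
    (Eventually.of_forall fun t => (hM t).trans (le_abs_self M))

variable [NormedSpace ℝ E]

theorem lipschitzWith_intervalIntegral_of_norm_le {g : ℝ → E} {M : NNReal}
    (hg : AEStronglyMeasurable g volume) (hM : ∀ t, ‖g t‖ ≤ M) :
    LipschitzWith M (fun t => ∫ s in (0 : ℝ)..t, g s) := by
  refine LipschitzWith.of_dist_le_mul fun t r => ?_
  rw [dist_eq_norm, intervalIntegral.integral_interval_sub_left
    (intervalIntegrable_of_norm_le hg hM _ _) (intervalIntegrable_of_norm_le hg hM _ _),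
    Real.dist_eq]
  exact intervalIntegral.norm_integral_le_of_norm_le_const fun s _ => hM s

/-- The Picard operator of `x' = F t x`, `x 0 = x₀` for `t ≥ 0`, in the rescaled unknown
`y t = exp (-lam t) x t`; times before `0` are mapped to `0`. -/
def picardScaled (F : ℝ → E → E) (x₀ : E) (lam : ℝ) (y : ℝ → E) (t : ℝ) : E :=
  Real.exp (-(lam * max t 0)) •
    (x₀ + ∫ s in (0 : ℝ)..max t 0, F s (Real.exp (lam * s) • y s))

/-- A bounded vector field that is Lipschitz in the state, uniformly in time, and measurable along
continuous curves has a Carathéodory solution on `[0, ∞)`. The proof is a contraction argument in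
the norm `sup exp (-lam t) ‖x t‖`, which gives the whole half-line at once. -/
theorem exists_caratheodory_solution [CompleteSpace E] {F : ℝ → E → E} {L M : NNReal}
    (hL : ∀ t, LipschitzWith L (F t)) (hM : ∀ t x, ‖F t x‖ ≤ M)
    (hmeas : ∀ x : ℝ → E, Continuous x → AEStronglyMeasurable (fun t => F t (x t)) volume)
    (x₀ : E) :
    ∃ x : ℝ → E, x 0 = x₀ ∧ LipschitzWith M x ∧
      ∀ᵐ t, 0 < t → HasDerivAt x (F t (x t)) t := by
  set lam : ℝ := 2 * L + 1 with hlam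
  have hlam0 : 0 < lam := by positivity
  have hm : ∀ y : ℝ → E, Continuous y →
      AEStronglyMeasurable (fun s => F s (Real.exp (lam * s) • y s)) volume :=
    fun y hy => hmeas _ (by fun_prop)
  have hcont : ∀ y : ℝ → E, Continuous y → Continuous (picardScaled F x₀ lam y) := fun y hy => by
    have h1 := (lipschitzWith_intervalIntegral_of_norm_le (hm y hy) (fun t => hM t _)).continuous
    have h2 : Continuous fun t : ℝ => ∫ s in (0 : ℝ)..max t 0, F s (Real.exp (lam * s) • y s) :=
      h1.comp (continuous_id.max continuous_const)
    unfold picardScaled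
    fun_prop
  have hbd : ∀ (y : ℝ → E) (t : ℝ), ‖picardScaled F x₀ lam y t‖ ≤ ‖x₀‖ + M / lam := fun y t => by
    unfold picardScaled
    set τ := max t 0 with hτ
    have hτ0 : 0 ≤ τ := le_max_right _ _
    have h1 : ‖∫ s in (0 : ℝ)..τ, F s (Real.exp (lam * s) • y s)‖ ≤ M * |τ - 0| :=
      intervalIntegral.norm_integral_le_of_norm_le_const fun s _ => hM s _
    rw [sub_zero, abs_of_nonneg hτ0] at h1
    have h2 : lam * τ + 1 ≤ Real.exp (lam * τ) := Real.add_one_le_exp _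
    have h3 := mul_nonneg hlam0.le hτ0
    rw [norm_smul, Real.norm_of_nonneg (Real.exp_pos _).le, Real.exp_neg,
      inv_mul_le_iff₀ (Real.exp_pos _)]
    calc ‖x₀ + ∫ s in (0 : ℝ)..τ, F s (Real.exp (lam * s) • y s)‖
        ≤ ‖x₀‖ + M * τ := (norm_add_le _ _).trans (by linarith)
      _ = 1 * ‖x₀‖ + (lam * τ) * (M / lam) := by field_simp
      _ ≤ Real.exp (lam * τ) * ‖x₀‖ + Real.exp (lam * τ) * (M / lam) := by
          gcongr <;> linarith
      _ = _ := by ring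
  let Φ : BoundedContinuousFunction ℝ E → BoundedContinuousFunction ℝ E := fun y =>
    BoundedContinuousFunction.ofNormedAddCommGroup (picardScaled F x₀ lam y) (hcont y y.continuous)
      _ (hbd y)
  have hΦ : ContractingWith (1 / 2) Φ := by
    refine ⟨by norm_num, LipschitzWith.of_dist_le_mul fun y z => ?_⟩
    refine (BoundedContinuousFunction.dist_le (by positivity)).mpr fun t => ?_
    change dist (picardScaled F x₀ lam y t) (picardScaled F x₀ lam z t) ≤ _
    unfold picardScaled
    set τ := max t 0 with hτ
    have hτ0 : 0 ≤ τ := le_max_right _ _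
    have hi : ∀ y : BoundedContinuousFunction ℝ E,
        IntervalIntegrable (fun s => F s (Real.exp (lam * s) • y s)) volume 0 τ :=
      fun y => intervalIntegrable_of_norm_le (hm y y.continuous) (fun s => hM s _) _ _
    rw [dist_eq_norm, ← smul_sub, add_sub_add_left_eq_sub,
      ← intervalIntegral.integral_sub (hi y) (hi z), norm_smul,
      Real.norm_of_nonneg (Real.exp_pos _).le, Real.exp_neg, inv_mul_le_iff₀ (Real.exp_pos _)]
    have hint : ∫ s in (0 : ℝ)..τ, (L * dist y z) * Real.exp (lam * s)
        = (L * dist y z) * ((Real.exp (lam * τ) - 1) / lam) := by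
      rw [intervalIntegral.integral_const_mul, intervalIntegral.integral_comp_mul_left
        (fun u => Real.exp u) hlam0.ne']
      simp [div_eq_inv_mul]
    have hle : ‖∫ s in (0 : ℝ)..τ, (F s (Real.exp (lam * s) • y s)
        - F s (Real.exp (lam * s) • z s))‖ ≤ ∫ s in (0 : ℝ)..τ,
          (L * dist y z) * Real.exp (lam * s) := by
      refine intervalIntegral.norm_integral_le_of_norm_le hτ0
        (Eventually.of_forall fun s _ => ?_)
        (by apply Continuous.intervalIntegrable; fun_prop)
      rw [← dist_eq_norm]
      calc dist (F s (Real.exp (lam * s) • y s)) (F s (Real.exp (lam * s) • z s))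
          ≤ L * dist (Real.exp (lam * s) • y s) (Real.exp (lam * s) • z s) :=
            (hL s).dist_le_mul _ _
        _ = L * (Real.exp (lam * s) * dist (y s) (z s)) := by
            rw [dist_smul₀, Real.norm_of_nonneg (Real.exp_pos _).le]
        _ ≤ L * (Real.exp (lam * s) * dist y z) := by
            gcongr; exact BoundedContinuousFunction.dist_coe_le_dist s
        _ = _ := by ring
    refine hle.trans ?_
    rw [hint]
    have hd : 0 ≤ dist y z := dist_nonneg
    have h4 : (L : ℝ) / lam ≤ 1 / 2 := by
      rw [div_le_iff₀ hlam0, hlam]; linarith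
    have h5 : 0 ≤ Real.exp (lam * τ) := (Real.exp_pos _).le
    calc (L * dist y z) * ((Real.exp (lam * τ) - 1) / lam)
        = (L / lam) * (dist y z * (Real.exp (lam * τ) - 1)) := by ring
      _ ≤ (L / lam) * (dist y z * Real.exp (lam * τ)) := by gcongr; linarith
      _ ≤ (1 / 2) * (dist y z * Real.exp (lam * τ)) := by gcongr
      _ = _ := by push_cast; ring
  obtain ⟨y, hy⟩ : ∃ y, Φ y = y := ⟨_, hΦ.fixedPoint_isFixedPt⟩
  have hyt : ∀ t, 0 ≤ t → Real.exp (lam * t) • y t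
      = x₀ + ∫ s in (0 : ℝ)..t, F s (Real.exp (lam * s) • y s) := fun t ht => by
    have h : picardScaled F x₀ lam y t = y t := DFunLike.congr_fun hy t
    rw [← h]
    unfold picardScaled
    rw [max_eq_left ht, smul_smul, ← Real.exp_add, add_neg_cancel, Real.exp_zero, one_smul]
  have hmy := hm y y.continuous
  refine ⟨fun t => x₀ + ∫ s in (0 : ℝ)..t, F s (Real.exp (lam * s) • y s), by simp, ?_, ?_⟩
  · have h1 := lipschitzWith_intervalIntegral_of_norm_le hmy (fun t => hM t _)
    refine LipschitzWith.of_dist_le_mul fun t r => ?_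
    rw [dist_add_left]
    exact h1.dist_le_mul t r
  · have hli : LocallyIntegrable (fun s => F s (Real.exp (lam * s) • y s)) volume :=
      (locallyIntegrable_const (M : ℝ)).mono hmy
        (Eventually.of_forall fun t => (hM t _).trans (le_abs_self _))
    filter_upwards [_root_.LocallyIntegrable.ae_hasDerivAt_integral hli] with t ht ht0
    rw [← hyt t ht0.le]
    exact (ht 0).const_add x₀

end Caratheodory

/-! ### Radial truncation -/

section Truncation

variable {E : Type*} [NormedAddCommGroup E] [NormedSpace ℝ E]

/-- The radial retraction onto the closed ball of radius `r`. -/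
def radial (r : ℝ) (x : E) : E := (r / max r ‖x‖) • x

theorem radial_eq_self {r : ℝ} (hr : 0 < r) {x : E} (hx : ‖x‖ ≤ r) : radial r x = x := by
  rw [radial, max_eq_left hx, div_self hr.ne', one_smul]

theorem norm_radial_le {r : ℝ} (hr : 0 < r) (x : E) : ‖radial r x‖ ≤ r := by
  have hm : 0 < max r ‖x‖ := lt_max_of_lt_left hr
  rw [radial, norm_smul, Real.norm_of_nonneg (by positivity), div_mul_eq_mul_div, div_le_iff₀ hm]
  exact mul_le_mul_of_nonneg_left (le_max_right _ _) hr.le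

theorem norm_inv_max_smul_sub_le {r : ℝ} (hr : 0 < r) (x y : E) :
    ‖(max r ‖x‖)⁻¹ • x - (max r ‖y‖)⁻¹ • y‖ ≤ 2 * (max r ‖x‖)⁻¹ * ‖x - y‖ := by
  set m := max r ‖x‖ with hm
  set n := max r ‖y‖ with hn
  have hm0 : 0 < m := lt_max_of_lt_left hr
  have hn0 : 0 < n := lt_max_of_lt_left hr
  have hyn : ‖y‖ ≤ n := le_max_right _ _
  have hmn : |n - m| ≤ ‖x - y‖ := by
    have h1 := abs_max_sub_max_le_abs ‖y‖ ‖x‖ r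
    rw [max_comm ‖y‖, max_comm ‖x‖] at h1
    rw [norm_sub_rev]
    exact h1.trans (abs_norm_sub_norm_le y x)
  have h0 : m⁻¹ • x - n⁻¹ • y = m⁻¹ • (x - y) + (m⁻¹ * n⁻¹ * (n - m)) • y := by
    have : m⁻¹ * n⁻¹ * (n - m) = m⁻¹ - n⁻¹ := by field_simp
    rw [this, sub_smul, smul_sub]; abel
  rw [h0]
  calc ‖m⁻¹ • (x - y) + (m⁻¹ * n⁻¹ * (n - m)) • y‖
      ≤ m⁻¹ * ‖x - y‖ + m⁻¹ * n⁻¹ * |n - m| * ‖y‖ := by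
        refine (norm_add_le _ _).trans (le_of_eq ?_)
        rw [norm_smul, norm_smul, norm_mul, norm_mul, Real.norm_of_nonneg (by positivity),
          Real.norm_of_nonneg (by positivity), Real.norm_eq_abs]
    _ ≤ m⁻¹ * ‖x - y‖ + m⁻¹ * n⁻¹ * ‖x - y‖ * n := by gcongr
    _ = 2 * m⁻¹ * ‖x - y‖ := by field_simp; ring

theorem lipschitzWith_radial {r : ℝ} (hr : 0 < r) : LipschitzWith 2 (radial r : E → E) := by
  refine LipschitzWith.of_dist_le_mul fun x y => ?_
  have hm0 : 0 < max r ‖x‖ := lt_max_of_lt_left hr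
  have h := norm_inv_max_smul_sub_le hr x y
  have h1 : r * (max r ‖x‖)⁻¹ ≤ 1 := by
    rw [← div_eq_mul_inv, div_le_one hm0]; exact le_max_left _ _
  rw [dist_eq_norm, dist_eq_norm, radial, radial, div_eq_mul_inv, div_eq_mul_inv, mul_smul,
    mul_smul, ← smul_sub, norm_smul, Real.norm_of_nonneg hr.le]
  calc r * ‖(max r ‖x‖)⁻¹ • x - (max r ‖y‖)⁻¹ • y‖
      ≤ r * (2 * (max r ‖x‖)⁻¹ * ‖x - y‖) := by gcongr
    _ = (r * (max r ‖x‖)⁻¹) * (2 * ‖x - y‖) := by ring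
    _ ≤ 1 * (2 * ‖x - y‖) := by gcongr
    _ = _ := by simp

end Truncation

namespace AttitudeTracking

/-! ### Vectors and matrices -/

/-- The matrix `A` as a continuous linear map of Euclidean space. -/
abbrev toCLM (A : M3) : V3 →L[ℝ] V3 := Matrix.toEuclideanCLM (n := Fin 3) (𝕜 := ℝ) A

theorem act_apply {a b : ℕ} (A : Matrix (Fin a) (Fin b) ℝ) (x : EuclideanSpace ℝ (Fin b))
    (i : Fin a) : act A x i = ∑ j, A i j * x j := rfl

theorem act_mul {a b c : ℕ} (A : Matrix (Fin a) (Fin b) ℝ) (B : Matrix (Fin b) (Fin c) ℝ)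
    (x : EuclideanSpace ℝ (Fin c)) : act (A * B) x = act A (act B x) := by
  ext i
  change ((A * B).mulVec x) i = (A.mulVec (B.mulVec x)) i
  rw [Matrix.mulVec_mulVec]

theorem act_add {a b : ℕ} (A B : Matrix (Fin a) (Fin b) ℝ) (x : EuclideanSpace ℝ (Fin b)) :
    act (A + B) x = act A x + act B x := by simp [act]

theorem act_sub {a b : ℕ} (A B : Matrix (Fin a) (Fin b) ℝ) (x : EuclideanSpace ℝ (Fin b)) :
    act (A - B) x = act A x - act B x := by simp [act]

theorem act_smul {a b : ℕ} (r : ℝ) (A : Matrix (Fin a) (Fin b) ℝ) (x : EuclideanSpace ℝ (Fin b)) :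
    act (r • A) x = r • act A x := by simp [act]

theorem act_one {a : ℕ} (x : EuclideanSpace ℝ (Fin a)) :
    act (1 : Matrix (Fin a) (Fin a) ℝ) x = x := by simp [act]

theorem act_vec_add {a b : ℕ} (A : Matrix (Fin a) (Fin b) ℝ) (x y : EuclideanSpace ℝ (Fin b)) :
    act A (x + y) = act A x + act A y := by simp [act]

theorem act_vec_sub {a b : ℕ} (A : Matrix (Fin a) (Fin b) ℝ) (x y : EuclideanSpace ℝ (Fin b)) :
    act A (x - y) = act A x - act A y := by simp [act]

theorem act_vec_smul {a b : ℕ} (A : Matrix (Fin a) (Fin b) ℝ) (r : ℝ)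
    (x : EuclideanSpace ℝ (Fin b)) : act A (r • x) = r • act A x := by simp [act]

theorem norm_act_le (A : M3) (x : V3) : ‖act A x‖ ≤ matNorm A * ‖x‖ :=
  (toCLM A).le_opNorm x

theorem matNorm_nonneg (A : M3) : 0 ≤ matNorm A := norm_nonneg _

theorem inner_V3 (x y : V3) : inner ℝ x y = x 0 * y 0 + x 1 * y 1 + x 2 * y 2 := by
  simp [PiLp.inner_apply, Fin.sum_univ_three]; ring

theorem norm_sq_V3 (x : V3) : ‖x‖ ^ 2 = x 0 ^ 2 + x 1 ^ 2 + x 2 ^ 2 := by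
  rw [← real_inner_self_eq_norm_sq, inner_V3]; ring

theorem inner_act_comm {A : M3} (hA : A.IsSymm) (x y : V3) :
    inner ℝ (act A x) y = inner ℝ x (act A y) := by
  have h01 := hA.apply 0 1
  have h02 := hA.apply 0 2
  have h12 := hA.apply 1 2
  simp only [inner_V3, act_apply, Fin.sum_univ_three, h01, h02, h12]
  ring

/-! ### The cross product -/

theorem act_skew (a b : V3) : act (skew a) b
    = !₂[a 1 * b 2 - a 2 * b 1, a 2 * b 0 - a 0 * b 2, a 0 * b 1 - a 1 * b 0] := by
  ext i
  fin_cases i <;> simp [act_apply, skew, Fin.sum_univ_three] <;> ring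

theorem norm_act_skew_sq (a b : V3) :
    ‖act (skew a) b‖ ^ 2 + inner ℝ a b ^ 2 = ‖a‖ ^ 2 * ‖b‖ ^ 2 := by
  rw [act_skew]
  simp [norm_sq_V3, inner_V3]
  ring

theorem norm_act_skew_le (a b : V3) : ‖act (skew a) b‖ ≤ ‖a‖ * ‖b‖ := by
  refine le_of_sq_le_sq ?_ (by positivity)
  have := norm_act_skew_sq a b
  nlinarith [sq_nonneg (inner ℝ a b)]

/-- The cross product `(a, b) ↦ a^× b` as a continuous bilinear map. -/
def cr : V3 →L[ℝ] V3 →L[ℝ] V3 :=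
  LinearMap.mkContinuous₂
    (LinearMap.mk₂ ℝ (fun a b => act (skew a) b)
      (fun a b c => by ext i; fin_cases i <;> simp [act_skew] <;> ring)
      (fun r a b => by ext i; fin_cases i <;> simp [act_skew] <;> ring)
      (fun a b c => act_vec_add _ _ _)
      (fun r a b => act_vec_smul _ _ _)) 1
    (fun a b => by simpa using norm_act_skew_le a b)

theorem act_skew_eq_cr (a b : V3) : act (skew a) b = cr a b := rfl

theorem norm_cr_le (a b : V3) : ‖cr a b‖ ≤ ‖a‖ * ‖b‖ := norm_act_skew_le a b

theorem cr_eq (a b : V3) : cr a b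
    = !₂[a 1 * b 2 - a 2 * b 1, a 2 * b 0 - a 0 * b 2, a 0 * b 1 - a 1 * b 0] := act_skew a b

theorem inner_cr_right (x a : V3) : inner ℝ x (cr a x) = 0 := by
  simp [cr_eq, inner_V3]; ring

theorem inner_cr_left (a x : V3) : inner ℝ a (cr a x) = 0 := by
  simp [cr_eq, inner_V3]; ring

theorem inner_cr_swap (a x y : V3) : inner ℝ x (cr a y) = -inner ℝ y (cr a x) := by
  simp [cr_eq, inner_V3]; ring

theorem act_Xi (J : M3) (w v x : V3) :
    act (Xi J w v) x = cr (act J (w + v)) x - cr v (act J x) - act J (cr v x) := by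
  simp [Xi, act_sub, act_mul, act_skew_eq_cr]

/-- The gyroscopic terms do no work on `s`. -/
theorem inner_act_Xi_self {J : M3} (hJ : J.IsSymm) (w v s : V3) :
    inner ℝ s (act (Xi J w v) s) = 0 := by
  rw [act_Xi, inner_sub_right, inner_sub_right, inner_cr_right, inner_cr_swap v s,
    ← inner_act_comm hJ]
  simp

theorem inner_act_skew_anticomm {J : M3} (hJ : J.IsSymm) (v s : V3) :
    inner ℝ s (act (skew v * J + J * skew v) s) = 0 := by
  rw [act_add, act_mul, act_mul, act_skew_eq_cr, act_skew_eq_cr, inner_add_right,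
    inner_cr_swap v s, ← inner_act_comm hJ]
  simp

/-! ### Quaternions -/

/-- The vector part as a continuous linear map. -/
def vecL : ℍ[ℝ] →L[ℝ] V3 :=
  LinearMap.toContinuousLinearMap
    { toFun := vec
      map_add' := fun p q => by ext i; fin_cases i <;> simp [vec]
      map_smul' := fun r q => by ext i; fin_cases i <;> simp [vec] }

/-- The scalar part as a continuous linear map. -/
def reL : ℍ[ℝ] →L[ℝ] ℝ :=
  LinearMap.toContinuousLinearMap
    { toFun := fun q => q.re
      map_add' := fun _ _ => rfl
      map_smul' := fun _ _ => rfl }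

theorem reL_apply (q : ℍ[ℝ]) : reL q = q.re := rfl

@[simp] theorem ofParts_re (r : ℝ) (v : V3) : (ofParts r v).re = r := rfl

@[simp] theorem ofParts_imI (r : ℝ) (v : V3) : (ofParts r v).imI = v 0 := rfl

@[simp] theorem ofParts_imJ (r : ℝ) (v : V3) : (ofParts r v).imJ = v 1 := rfl

@[simp] theorem ofParts_imK (r : ℝ) (v : V3) : (ofParts r v).imK = v 2 := rfl

/-- `ofParts` as a continuous linear map. -/
def ofPartsL : ℝ × V3 →L[ℝ] ℍ[ℝ] :=
  LinearMap.toContinuousLinearMap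
    { toFun := fun p => ofParts p.1 p.2
      map_add' := fun p q => by ext <;> simp
      map_smul' := fun r q => by ext <;> simp }

theorem vec_sub (p q : ℍ[ℝ]) : vec (p - q) = vec p - vec q := vecL.map_sub p q

theorem norm_sq_quaternion (q : ℍ[ℝ]) : ‖q‖ ^ 2 = q.re ^ 2 + ‖vec q‖ ^ 2 := by
  rw [sq ‖q‖, ← Quaternion.normSq_eq_norm_mul_self, Quaternion.normSq_def', norm_sq_V3]
  simp [vec]; ring

theorem norm_vec_le (q : ℍ[ℝ]) : ‖vec q‖ ≤ ‖q‖ := by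
  refine le_of_sq_le_sq ?_ (norm_nonneg _)
  have := norm_sq_quaternion q
  nlinarith [sq_nonneg q.re]

theorem norm_sub_vec_le (p q : ℍ[ℝ]) : ‖vec p - vec q‖ ≤ ‖p - q‖ := by
  rw [← vec_sub]; exact norm_vec_le _

theorem inner_quaternion (p q : ℍ[ℝ]) :
    inner ℝ p q = p.re * q.re + inner ℝ (vec p) (vec q) := by
  rw [Quaternion.inner_def, inner_V3]
  simp [vec]; ring

theorem act_G (q : ℍ[ℝ]) (v : V3) : act (G q) v = q.re • v + cr (vec q) v := by
  simp [G, act_add, act_smul, act_one, act_skew_eq_cr]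

theorem norm_act_G_le (q : ℍ[ℝ]) (v : V3) : ‖act (G q) v‖ ≤ ‖q‖ * ‖v‖ := by
  refine le_of_sq_le_sq ?_ (by positivity)
  have h : ‖act (G q) v‖ ^ 2 = q.re ^ 2 * ‖v‖ ^ 2 + ‖cr (vec q) v‖ ^ 2 := by
    rw [act_G, cr_eq]; simp [norm_sq_V3]; ring
  have h1 : ‖cr (vec q) v‖ ^ 2 ≤ (‖vec q‖ * ‖v‖) ^ 2 :=
    pow_le_pow_left₀ (norm_nonneg _) (norm_cr_le _ _) 2
  rw [h, mul_pow, norm_sq_quaternion]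
  linarith

theorem act_G_sub (p q : ℍ[ℝ]) (v : V3) : act (G p) v - act (G q) v = act (G (p - q)) v := by
  simp only [act_G, vec_sub, map_sub, Quaternion.re_sub, sub_smul,
    sub_apply]
  abel

theorem kinematics_re (q : ℍ[ℝ]) (w : V3) :
    (kinematics q w).re = -(1 / 2 * inner ℝ (vec q) w) := by
  simp [kinematics]

theorem vec_kinematics (q : ℍ[ℝ]) (w : V3) : vec (kinematics q w) = (1 / 2 : ℝ) • act (G q) w := by
  ext i; fin_cases i <;> simp [kinematics, vec]

theorem inner_kinematics (q : ℍ[ℝ]) (w : V3) : inner ℝ q (kinematics q w) = 0 := by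
  rw [inner_quaternion, kinematics_re, vec_kinematics, act_G, inner_smul_right, inner_add_right,
    inner_cr_left, inner_smul_right]
  ring

theorem act_R (q : ℍ[ℝ]) (v : V3) : act (R q) v
    = v - (2 * q.re) • cr (vec q) v + (2 : ℝ) • cr (vec q) (cr (vec q) v) := by
  simp [R, act_add, act_sub, act_smul, act_one, act_skew_eq_cr, act_mul]

theorem unit_sq {q : ℍ[ℝ]} (hq : ‖q‖ = 1) :
    q.re ^ 2 + q.imI ^ 2 + q.imJ ^ 2 + q.imK ^ 2 = 1 := by
  rw [← Quaternion.normSq_def', Quaternion.normSq_eq_norm_mul_self, hq, mul_one]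

theorem norm_act_R {q : ℍ[ℝ]} (hq : ‖q‖ = 1) (v : V3) : ‖act (R q) v‖ = ‖v‖ := by
  have h := unit_sq hq
  have h2 : ‖act (R q) v‖ ^ 2 = ‖v‖ ^ 2 := by
    rw [act_R]
    simp [norm_sq_V3, cr_eq, vec]
    generalize v 0 = v0, v 1 = v1, v 2 = v2, q.re = a, q.imI = b, q.imJ = c, q.imK = d at *
    linear_combination (4 * ((c * v2 - d * v1) ^ 2 + (d * v0 - b * v2) ^ 2
      + (b * v1 - c * v0) ^ 2)) * h
  rwa [sq_eq_sq₀ (norm_nonneg _) (norm_nonneg _)] at h2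

theorem inv_eq_star {p : ℍ[ℝ]} (hp : ‖p‖ = 1) : p⁻¹ = star p := by
  rw [Quaternion.inv_def, Quaternion.normSq_eq_norm_mul_self, hp]; simp

/-- For a unit quaternion, `R(q)` is conjugation of pure quaternions by `q`. -/
theorem ofParts_act_R {q : ℍ[ℝ]} (hq : ‖q‖ = 1) (v : V3) :
    ofParts 0 (act (R q) v) = star q * ofParts 0 v * q := by
  have h := unit_sq hq
  ext <;> simp [act_R, cr_eq, vec]
  · ring
  · linear_combination (-v 0) * h
  · linear_combination (-v 1) * h
  · linear_combination (-v 2) * h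

theorem ofParts_injective {v w : V3} (h : ofParts 0 v = ofParts 0 w) : v = w := by
  ext i
  fin_cases i
  exacts [congrArg (fun q => q.imI) h, congrArg (fun q => q.imJ) h, congrArg (fun q => q.imK) h]

/-- Rotation matrices compose contravariantly to unit quaternions. -/
theorem act_R_mul {p q : ℍ[ℝ]} (hp : ‖p‖ = 1) (hq : ‖q‖ = 1) (v : V3) :
    act (R (q * p)) v = act (R p) (act (R q) v) := by
  refine ofParts_injective ?_
  rw [ofParts_act_R (by rw [norm_mul, hp, hq, one_mul]), ofParts_act_R hp, ofParts_act_R hq,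
    star_mul]
  simp only [mul_assoc]

/-- The attitude estimation error changes a rotated vector `w = R(q) v` by `2 ‖p × w‖`, with `p` the
vector part of the error. -/
theorem norm_act_R_sub_le {p q : ℍ[ℝ]} (hp : ‖p‖ = 1) (hq : ‖q‖ = 1) (v : V3) :
    ‖act (R (q * p⁻¹)) v - act (R q) v‖ ≤ 2 * ‖vec p‖ * ‖v‖ := by
  have hp' : ‖p⁻¹‖ = 1 := by rw [norm_inv, hp, inv_one]
  rw [act_R_mul hp' hq, ← norm_act_R hq v]
  generalize act (R q) v = w
  have hv : vec p⁻¹ = -vec p := by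
    rw [inv_eq_star hp]; ext i; fin_cases i <;> simp [vec]
  have h := unit_sq hp
  have h2 : ‖act (R p⁻¹) w - w‖ ^ 2 = 4 * ‖cr (vec p) w‖ ^ 2 := by
    rw [act_R, hv, inv_eq_star hp]
    simp [norm_sq_V3, cr_eq, vec]
    generalize w 0 = v0, w 1 = v1, w 2 = v2, p.re = a, p.imI = b, p.imJ = c, p.imK = d at *
    linear_combination (4 * ((c * v2 - d * v1) ^ 2 + (d * v0 - b * v2) ^ 2
      + (b * v1 - c * v0) ^ 2)) * h
  have h3 := norm_cr_le (vec p) w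
  have h4 : ‖act (R p⁻¹) w - w‖ = 2 * ‖cr (vec p) w‖ := by
    rw [← sq_eq_sq₀ (norm_nonneg _) (by positivity), h2]; ring
  rw [h4]; linarith

theorem norm_mul_inv_sub_self {p q : ℍ[ℝ]} (hp : ‖p‖ = 1) (hq : ‖q‖ = 1) :
    ‖q * p⁻¹ - q‖ = Real.sqrt (2 * (1 - p.re)) := by
  have h1 : q * p⁻¹ - q = q * (star p - 1) := by rw [inv_eq_star hp]; noncomm_ring
  have h := unit_sq hp
  rw [h1, norm_mul, hq, one_mul, ← Real.sqrt_sq (norm_nonneg (star p - 1)), norm_sq_quaternion,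
    norm_sq_V3]
  congr 1
  simp [vec]
  linear_combination h

/-! ### Extreme eigenvalues -/

section Spectrum

variable {A : M3}

theorem isHermitian_of_isSymm (hA : A.IsSymm) : A.IsHermitian := by
  rw [Matrix.IsHermitian, Matrix.conjTranspose_eq_transpose_of_trivial]; exact hA

theorem lamMin_le_eigenvalue (hA : A.IsHermitian) (i : Fin 3) : lamMin A ≤ hA.eigenvalues i := by
  refine csInf_le ?_ (hA.eigenvalues_mem_spectrum_real i)
  rw [hA.spectrum_real_eq_range_eigenvalues]
  exact (Set.finite_range _).bddBelow

theorem eigenvalue_le_lamMax (hA : A.IsHermitian) (i : Fin 3) : hA.eigenvalues i ≤ lamMax A := by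
  refine le_csSup ?_ (hA.eigenvalues_mem_spectrum_real i)
  rw [hA.spectrum_real_eq_range_eigenvalues]
  exact (Set.finite_range _).bddAbove

theorem lamMin_le_lamMax (hA : A.IsSymm) : lamMin A ≤ lamMax A :=
  (lamMin_le_eigenvalue (isHermitian_of_isSymm hA) 0).trans (eigenvalue_le_lamMax _ 0)

theorem inner_eigenvectorBasis_act (hA : A.IsSymm) (hA' : A.IsHermitian) (i : Fin 3) (x : V3) :
    inner ℝ (hA'.eigenvectorBasis i) (act A x)
      = hA'.eigenvalues i * inner ℝ (hA'.eigenvectorBasis i) x := by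
  have h : act A (hA'.eigenvectorBasis i) = hA'.eigenvalues i • hA'.eigenvectorBasis i := by
    ext j
    exact congrFun (hA'.mulVec_eigenvectorBasis i) j
  rw [← inner_act_comm hA, h, inner_smul_left]
  simp

theorem inner_act_eq_sum (hA : A.IsSymm) (hA' : A.IsHermitian) (x : V3) :
    inner ℝ x (act A x)
      = ∑ i, hA'.eigenvalues i * inner ℝ (hA'.eigenvectorBasis i) x ^ 2 := by
  rw [← hA'.eigenvectorBasis.sum_inner_mul_inner x (act A x)]
  refine Finset.sum_congr rfl fun i _ => ?_
  rw [inner_eigenvectorBasis_act hA, real_inner_comm]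
  ring

theorem lamMin_mul_norm_sq_le (hA : A.IsSymm) (x : V3) :
    lamMin A * ‖x‖ ^ 2 ≤ inner ℝ x (act A x) := by
  have hA' := isHermitian_of_isSymm hA
  rw [inner_act_eq_sum hA hA', ← hA'.eigenvectorBasis.sum_sq_inner_right x, Finset.mul_sum]
  gcongr with i
  exact lamMin_le_eigenvalue hA' i

theorem inner_act_le_lamMax (hA : A.IsSymm) (x : V3) :
    inner ℝ x (act A x) ≤ lamMax A * ‖x‖ ^ 2 := by
  have hA' := isHermitian_of_isSymm hA
  rw [inner_act_eq_sum hA hA', ← hA'.eigenvectorBasis.sum_sq_inner_right x, Finset.mul_sum]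
  gcongr with i
  exact eigenvalue_le_lamMax hA' i

theorem posDef_isSymm (hA : A.PosDef) : A.IsSymm := by
  have := hA.1
  rwa [Matrix.IsHermitian, Matrix.conjTranspose_eq_transpose_of_trivial] at this

theorem lamMax_pos (hA : A.PosDef) : 0 < lamMax A :=
  (hA.eigenvalues_pos 0).trans_le (eigenvalue_le_lamMax hA.1 0)

theorem norm_act_le_lamMax (hA : A.PosDef) (x : V3) : ‖act A x‖ ≤ lamMax A * ‖x‖ := by
  refine le_of_sq_le_sq ?_ (mul_nonneg (lamMax_pos hA).le (norm_nonneg _))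
  rw [mul_pow, ← hA.1.eigenvectorBasis.sum_sq_inner_right x,
    ← hA.1.eigenvectorBasis.sum_sq_inner_right (act A x), Finset.mul_sum]
  gcongr with i
  rw [inner_eigenvectorBasis_act (posDef_isSymm hA), mul_pow]
  gcongr
  · exact (hA.eigenvalues_pos i).le
  · exact eigenvalue_le_lamMax _ i

theorem isUnit_det_of_lamMin_pos (hA : A.IsSymm) (h : 0 < lamMin A) : IsUnit A.det := by
  have hA' := isHermitian_of_isSymm hA
  have : A.PosDef := hA'.posDef_iff_eigenvalues_pos.mpr
    fun i => h.trans_le (lamMin_le_eigenvalue hA' i)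
  exact this.det_pos.ne'.isUnit

end Spectrum

/-! ### The faulty actuators -/

/-- If the healthy thrusters span `ℝ³`, then the matrix inverted by the control allocation is
invertible. -/
theorem isUnit_det_of_rank {m : ℕ} {D : Matrix (Fin 3) (Fin m) ℝ} {e : Fin m → ℝ}
    (he : ∀ i, 0 ≤ e i) (h : (D * Matrix.diagonal e).rank = 3) :
    IsUnit (D * Matrix.diagonal e ^ 3 * D.transpose).det := by
  set S := D * Matrix.diagonal (fun i => Real.sqrt (e i ^ 3)) with hS
  have h1 : D * Matrix.diagonal e ^ 3 * D.transpose = S * S.transpose := by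
    rw [hS, Matrix.transpose_mul, Matrix.diagonal_transpose, Matrix.mul_assoc, Matrix.mul_assoc,
      ← Matrix.mul_assoc (Matrix.diagonal _) (Matrix.diagonal _), Matrix.diagonal_mul_diagonal,
      Matrix.diagonal_pow]
    congr! 4 with i
    rw [Real.mul_self_sqrt (pow_nonneg (he i) 3)]
    rfl
  have h2 : D * Matrix.diagonal e = S * Matrix.diagonal (fun i => e i / Real.sqrt (e i ^ 3)) := by
    rw [hS, Matrix.mul_assoc, Matrix.diagonal_mul_diagonal]
    congr! 2
    ext i
    rcases (he i).eq_or_lt with h0 | h0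
    · simp [← h0]
    · have : Real.sqrt (e i ^ 3) ≠ 0 := (Real.sqrt_pos.mpr (by positivity)).ne'
      field_simp
  have h3 : 3 ≤ (S * S.transpose).rank := by
    rw [Matrix.rank_self_mul_transpose]
    refine h.ge.trans ?_
    rw [h2]
    exact Matrix.rank_mul_le_left _ _
  rw [h1]
  have h4 : LinearMap.range (S * S.transpose).mulVecLin = ⊤ := by
    refine Submodule.eq_top_of_finrank_eq (le_antisymm (Submodule.finrank_le _) ?_)
    rw [Module.finrank_fin_fun]
    exact h3
  have h5 : Function.Surjective (S * S.transpose).mulVec := LinearMap.range_eq_top.mp h4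
  rw [← Matrix.isUnit_iff_isUnit_det]
  exact Matrix.mulVec_surjective_iff_isUnit.mp h5

/-- The faulty actuators turn the commanded virtual torque `u` into `(I + H) u`. -/
theorem Data.act_E_tauU {m : ℕ} {P : Data m} (hP : P.Standing) {t : ℝ} (ht : 0 ≤ t) (q : ℍ[ℝ])
    (s : V3) : act (P.D * P.E t) (P.tauU t q s) = P.u t q s + act (P.H t) (P.u t q s) := by
  have h := isUnit_det_of_rank (fun i => (hP.ehat_mem t ht i).1) (hP.rank_Ehat t ht)
  rw [show Matrix.diagonal (P.ehat t) = P.Ehat t from rfl] at h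
  set M := P.D * P.Ehat t ^ 3 * P.D.transpose with hM
  have h1 : P.D * P.E t * (P.Ehat t ^ 2 * P.D.transpose * M⁻¹) = 1 + P.H t := by
    have h2 : P.D * (P.E t - P.Ehat t) * P.Ehat t ^ 2 * P.D.transpose
        = P.D * P.E t * P.Ehat t ^ 2 * P.D.transpose - M := by
      rw [hM, Matrix.mul_sub, Matrix.sub_mul, Matrix.sub_mul, pow_succ' (P.Ehat t) 2]
      simp only [Matrix.mul_assoc]
    rw [Data.H, ← hM, h2, Matrix.sub_mul, Matrix.mul_nonsing_inv M h, add_sub_cancel]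
    simp only [Matrix.mul_assoc]
  rw [Data.tauU, ← hM, ← act_mul, h1, act_add, act_one]

end AttitudeTracking

namespace AttitudeTracking

/-! ### Perturbation estimates for the model terms -/

theorem norm_cr_le_of_le {a b : V3} {α β : ℝ} (ha : ‖a‖ ≤ α) (hb : ‖b‖ ≤ β) :
    ‖cr a b‖ ≤ α * β :=
  (norm_cr_le a b).trans (mul_le_mul ha hb (norm_nonneg _) ((norm_nonneg _).trans ha))

theorem norm_act_le_of_le {A : M3} {x : V3} {α β : ℝ} (hA : matNorm A ≤ α) (hx : ‖x‖ ≤ β) :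
    ‖act A x‖ ≤ α * β :=
  (norm_act_le A x).trans (mul_le_mul hA hx (norm_nonneg _) ((matNorm_nonneg _).trans hA))

theorem norm_act_G_le_of_le {q : ℍ[ℝ]} {x : V3} {α β : ℝ} (hq : ‖q‖ ≤ α) (hx : ‖x‖ ≤ β) :
    ‖act (G q) x‖ ≤ α * β :=
  (norm_act_G_le q x).trans (mul_le_mul hq hx (norm_nonneg _) ((norm_nonneg _).trans hq))

theorem norm_act_Xi_zero_le {J : M3} {v x : V3} {j V r : ℝ} (hJ : matNorm J ≤ j) (hv : ‖v‖ ≤ V)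
    (hx : ‖x‖ ≤ r) : ‖act (Xi J 0 v) x‖ ≤ 3 * j * V * r := by
  rw [act_Xi, zero_add]
  refine (norm_sub_le_of_le (norm_sub_le_of_le
    (norm_cr_le_of_le (norm_act_le_of_le hJ hv) hx)
    (norm_cr_le_of_le hv (norm_act_le_of_le hJ hx)))
    (norm_act_le_of_le hJ (norm_cr_le_of_le hv hx))).trans (le_of_eq ?_)
  ring

section Model

variable {J Jh : M3} {rJ : ℝ}

theorem norm_quadratic_sub_le (hJ : matNorm (Jh - J) ≤ rJ) {a ah : V3} {r : ℝ}
    (hr : ‖ah - a‖ ≤ r) :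
    ‖cr ah (act Jh ah) - cr a (act J a)‖
      ≤ rJ * ‖a‖ ^ 2 + matNorm Jh * (2 * r * ‖a‖ + r ^ 2) := by
  have h : cr ah (act Jh ah) - cr a (act J a) = cr (ah - a) (act Jh (ah - a))
      + cr (ah - a) (act Jh a) + cr a (act Jh (ah - a)) + cr a (act (Jh - J) a) := by
    simp only [act_vec_sub, act_sub, map_sub, sub_apply]; abel
  rw [h]
  refine (norm_add_le_of_le (norm_add_le_of_le (norm_add_le_of_le
    (norm_cr_le_of_le hr (norm_act_le_of_le le_rfl hr))
    (norm_cr_le_of_le hr (norm_act_le_of_le le_rfl le_rfl)))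
    (norm_cr_le_of_le le_rfl (norm_act_le_of_le le_rfl hr)))
    (norm_cr_le_of_le le_rfl (norm_act_le_of_le hJ le_rfl))).trans (le_of_eq ?_)
  ring

theorem norm_act_G_act_sub_le (hJ : matNorm (Jh - J) ≤ rJ) {q qh : ℍ[ℝ]} (hq : ‖q‖ = 1)
    (hqh : ‖qh‖ = 1) {w wh : V3} {r dw : ℝ} (hr : ‖qh - q‖ ≤ r) (hw : ‖wh - w‖ ≤ dw) :
    ‖act (G q) (act J w) - act (G qh) (act Jh wh)‖
      ≤ (rJ + r * matNorm Jh) * ‖w‖ + matNorm Jh * dw := by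
  have h : act (G q) (act J w) - act (G qh) (act Jh wh) = -(act (G q) (act (Jh - J) w)
      + act (G (qh - q)) (act Jh w) + act (G qh) (act Jh (wh - w))) := by
    rw [← act_G_sub]
    simp only [act_vec_sub, act_sub]; abel
  rw [h, norm_neg]
  refine (norm_add_le_of_le (norm_add_le_of_le
    (norm_act_G_le_of_le hq.le (norm_act_le_of_le hJ le_rfl))
    (norm_act_G_le_of_le hr (norm_act_le_of_le le_rfl le_rfl)))
    (norm_act_G_le_of_le hqh.le (norm_act_le_of_le le_rfl hw))).trans (le_of_eq ?_)
  ring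

theorem norm_act_Xi_sub_le (hJ : matNorm (Jh - J) ≤ rJ) {a ah v vh : V3} {r V dv : ℝ}
    (hr : ‖ah - a‖ ≤ r) (hv : ‖v‖ ≤ V) (hvh : ‖vh‖ ≤ V) (hdv : ‖vh - v‖ ≤ dv) :
    ‖act (Xi J 0 v) a - act (Xi Jh 0 vh) ah‖
      ≤ 3 * (rJ * V + matNorm Jh * dv) * ‖a‖ + 3 * matNorm Jh * V * r := by
  have h : act (Xi J 0 v) a - act (Xi Jh 0 vh) ah = -(act (Xi (Jh - J) 0 v) a
      + act (Xi Jh 0 (vh - v)) a + act (Xi Jh 0 vh) (ah - a)) := by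
    simp only [act_Xi, zero_add, act_vec_sub, act_sub, map_sub, sub_apply]; abel
  rw [h, norm_neg]
  refine (norm_add_le_of_le (norm_add_le_of_le (norm_act_Xi_zero_le hJ hv le_rfl)
    (norm_act_Xi_zero_le le_rfl hdv le_rfl)) (norm_act_Xi_zero_le le_rfl hvh hr)).trans
    (le_of_eq ?_)
  ring

theorem norm_psi_sub_le {k : ℝ} (hk : 0 ≤ k) (hJ : matNorm (Jh - J) ≤ rJ) {q qh : ℍ[ℝ]}
    (hq : ‖q‖ = 1) (hqh : ‖qh‖ = 1) {w wh v vh : V3} {r dw V dv : ℝ} (hr : ‖qh - q‖ ≤ r)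
    (hw : ‖wh - w‖ ≤ dw) (hv : ‖v‖ ≤ V) (hvh : ‖vh‖ ≤ V) (hdv : ‖vh - v‖ ≤ dv) :
    ‖psi k J q w v - psi k Jh qh wh vh‖
      ≤ 1 / 2 * k ^ 2 * (rJ * ‖vec q‖ ^ 2 + matNorm Jh * (2 * r * ‖vec q‖ + r ^ 2))
        + 1 / 2 * k * ((rJ + r * matNorm Jh) * ‖w‖ + matNorm Jh * dw)
        + k * (3 * (rJ * V + matNorm Jh * dv) * ‖vec q‖ + 3 * matNorm Jh * V * r) := by
  have hra : ‖vec qh - vec q‖ ≤ r := (norm_sub_vec_le qh q).trans hr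
  have h : psi k J q w v - psi k Jh qh wh vh
      = (1 / 2 * k ^ 2) • (cr (vec qh) (act Jh (vec qh)) - cr (vec q) (act J (vec q)))
        + (1 / 2 * k) • (act (G q) (act J w) - act (G qh) (act Jh wh))
        + (-k) • (act (Xi J 0 v) (vec q) - act (Xi Jh 0 vh) (vec qh)) := by
    simp only [psi, act_skew_eq_cr, smul_sub, neg_smul]; abel
  rw [h]
  refine norm_add₃_le.trans ?_
  rw [norm_smul, norm_smul, norm_smul, norm_neg, Real.norm_of_nonneg (by positivity),
    Real.norm_of_nonneg (by positivity), Real.norm_of_nonneg hk]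
  have h1 := norm_quadratic_sub_le hJ hra
  have h2 := norm_act_G_act_sub_le hJ hq hqh hr hw
  have h3 := norm_act_Xi_sub_le hJ hra hv hvh hdv
  gcongr

theorem norm_psiD_sub_le (hJ : matNorm (Jh - J) ≤ rJ) {q qh : ℍ[ℝ]} (hq : ‖q‖ = 1)
    (hqh : ‖qh‖ = 1) {wd a : V3} {V A dv da : ℝ} (hv : ‖wd‖ ≤ V) (ha : ‖a‖ ≤ A)
    (hdv : ‖act (R qh) wd - act (R q) wd‖ ≤ dv) (hda : ‖act (R qh) a - act (R q) a‖ ≤ da) :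
    ‖psiD Jh qh wd a - psiD J q wd a‖
      ≤ matNorm Jh * (2 * V * dv + da) + rJ * V ^ 2 + rJ * A := by
  have hv1 : ‖act (R q) wd‖ ≤ V := by rwa [norm_act_R hq]
  have hv2 : ‖act (R qh) wd‖ ≤ V := by rwa [norm_act_R hqh]
  have ha1 : ‖act (R q) a‖ ≤ A := by rwa [norm_act_R hq]
  unfold psiD
  simp only [act_skew_eq_cr]
  generalize act (R q) wd = v at *
  generalize act (R qh) wd = vh at *
  generalize act (R q) a = b at *
  generalize act (R qh) a = bh at *
  have h : cr vh (act Jh vh) + act Jh bh - (cr v (act J v) + act J b)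
      = cr (vh - v) (act Jh vh) + cr v (act Jh (vh - v)) + cr v (act (Jh - J) v)
        + act Jh (bh - b) + act (Jh - J) b := by
    simp only [act_vec_sub, act_sub, map_sub, sub_apply]; abel
  rw [h]
  refine (norm_add_le_of_le (norm_add_le_of_le (norm_add_le_of_le (norm_add_le_of_le
    (norm_cr_le_of_le hdv (norm_act_le_of_le le_rfl hv2))
    (norm_cr_le_of_le hv1 (norm_act_le_of_le le_rfl hdv)))
    (norm_cr_le_of_le hv1 (norm_act_le_of_le hJ hv1))) (norm_act_le_of_le le_rfl hda))
    (norm_act_le_of_le hJ ha1)).trans (le_of_eq ?_)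
  ring

theorem norm_psi_le {k : ℝ} (hk : 0 ≤ k) {q : ℍ[ℝ]} (hq : ‖q‖ = 1) {w v : V3} {x W V : ℝ}
    (hx : ‖vec q‖ ≤ x) (hw : ‖w‖ ≤ W) (hv : ‖v‖ ≤ V) :
    ‖psi k J q w v‖ ≤ 1 / 2 * k ^ 2 * matNorm J * x ^ 2 + 1 / 2 * k * matNorm J * W
      + 3 * k * matNorm J * V * x := by
  rw [psi, sub_eq_add_neg]
  refine norm_add₃_le.trans ?_
  rw [norm_neg, norm_neg, norm_smul, norm_smul, norm_smul, Real.norm_of_nonneg (by positivity),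
    Real.norm_of_nonneg (by positivity), Real.norm_of_nonneg hk, act_skew_eq_cr]
  have h1 := norm_cr_le_of_le hx (norm_act_le_of_le (le_refl (matNorm J)) hx)
  have h2 := norm_act_G_le_of_le hq.le (norm_act_le_of_le (le_refl (matNorm J)) hw)
  have h3 := norm_act_Xi_zero_le (le_refl (matNorm J)) hv hx
  calc _ ≤ 1 / 2 * k ^ 2 * (x * (matNorm J * x)) + 1 / 2 * k * (1 * (matNorm J * W))
        + k * (3 * matNorm J * V * x) := by gcongr
    _ = _ := by ring

theorem norm_psiD_le {q : ℍ[ℝ]} (hq : ‖q‖ = 1) {wd a : V3} {V A : ℝ} (hv : ‖wd‖ ≤ V)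
    (ha : ‖a‖ ≤ A) : ‖psiD J q wd a‖ ≤ (V ^ 2 + A) * matNorm J := by
  have hv1 : ‖act (R q) wd‖ ≤ V := by rwa [norm_act_R hq]
  have ha1 : ‖act (R q) a‖ ≤ A := by rwa [norm_act_R hq]
  rw [psiD, act_skew_eq_cr]
  refine (norm_add_le_of_le (norm_cr_le_of_le hv1 (norm_act_le_of_le le_rfl hv1))
    (norm_act_le_of_le le_rfl ha1)).trans (le_of_eq ?_)
  ring

end Model

end AttitudeTracking

namespace AttitudeTracking
namespace Data

variable {m : ℕ} {P : Data m}

/-! ### Signs of the constants -/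

namespace Standing

theorem rhov_nonneg (hP : P.Standing) : 0 ≤ P.rhov := (norm_nonneg _).trans (hP.wd_le 0 le_rfl)

theorem rhoa_nonneg (hP : P.Standing) : 0 ≤ P.rhoa := (norm_nonneg _).trans (hP.wd'_le 0 le_rfl)

theorem rhoJ_nonneg (hP : P.Standing) : 0 ≤ P.rhoJ := (matNorm_nonneg _).trans hP.J_err

theorem rhod_nonneg (hP : P.Standing) : 0 ≤ P.rhod :=
  (norm_nonneg _).trans (hP.taud_err 0 le_rfl)

theorem rhodhat_nonneg (hP : P.Standing) : 0 ≤ P.rhodhat :=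
  (norm_nonneg _).trans (hP.taudhat_le 0 le_rfl)

end Standing

theorem rho0_nonneg (P : Data m) : 0 ≤ P.rho0 := Real.sqrt_nonneg _

/-! ### The design constants as functions of the observer errors -/

/-- The bound `ρ_s` on `‖ŝ - s‖` as a function of bounds `r0` on the distance of `Q̃` from the
identity, `rq` on `‖q̃‖` and `rw` on `‖ω̃‖`; the design value `ρ_s` uses the asymptotic bounds. -/
def rhosOf (P : Data m) (r0 rq rw : ℝ) : ℝ := rw + 2 * rq * P.rhov + P.k * r0

/-- The constant `a₃` for attitude estimation errors of size `r0`. -/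
def a3Of (P : Data m) (r0 : ℝ) : ℝ := 1 / 2 * P.k * (r0 * matNorm P.Jhat + P.rhoJ)

/-- The constant `a₁` for attitude estimation errors of sizes `r0` and `rq`. -/
def a1Of (P : Data m) (r0 rq : ℝ) : ℝ :=
  P.k ^ 2 * r0 * matNorm P.Jhat + P.k * P.a3Of r0
    + 3 * P.k * P.rhov * (P.rhoJ + 2 * rq * matNorm P.Jhat)

/-- The constant `a₀` for observer errors of sizes `r0`, `rq` and `rw`. -/
def a0Of (P : Data m) (r0 rq rw : ℝ) : ℝ :=
  1 / 2 * P.k ^ 2 * r0 ^ 2 * matNorm P.Jhat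
    + 1 / 2 * P.k * (rw + 2 * rq * P.rhov) * matNorm P.Jhat
    + 3 * P.k * P.rhov * r0 * matNorm P.Jhat
    + 4 * rq * P.rhov ^ 2 * matNorm P.Jhat
    + 2 * rq * P.rhoa * matNorm P.Jhat
    + P.rhoJ * P.rhov ^ 2 + P.rhoJ * P.rhoa + P.rhod

/-- The constant `b₁` for attitude estimation errors of size `r0`. The term `a₁`, a gain of the
controller, keeps its design value. -/
def b1Of (P : Data m) (r0 : ℝ) : ℝ :=
  2 * P.b2 * r0 + 1 / 2 * P.k ^ 2 * matNorm P.Jhat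
    + 3 * P.k * P.rhov * matNorm P.Jhat + P.a1

/-- The constant `b₀` for observer errors of sizes `r0`, `rq` and `rw`. The controller gains
`a₁` and `a₀` keep their design values. -/
def b0Of (P : Data m) (r0 rq rw : ℝ) : ℝ :=
  P.b2 * r0 ^ 2 + 1 / 2 * P.k * (rw + 2 * rq * P.rhov) * matNorm P.Jhat
    + 3 * P.k * P.rhov * r0 * matNorm P.Jhat
    + lamMax P.K * P.rhosOf r0 rq rw + P.a1 * (r0 + P.gam) + P.a0
    + (P.rhov ^ 2 + P.rhoa) * matNorm P.Jhat + P.rhodhat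

section Signs

variable (hP : P.Standing) (hk : 0 < P.k)
include hP hk

theorem a3_nonneg : 0 ≤ P.a3 := by
  have := hP.rhoJ_nonneg
  have := matNorm_nonneg P.Jhat
  have := P.rho0_nonneg
  unfold a3; positivity

theorem a2_nonneg : 0 ≤ P.a2 := by
  have := hP.rhoJ_nonneg
  unfold a2; positivity

theorem a1_nonneg : 0 ≤ P.a1 := by
  have := hP.rhoJ_nonneg
  have := hP.rhov_nonneg
  have := hP.rhoq_nonneg
  have := matNorm_nonneg P.Jhat
  have := P.rho0_nonneg
  have := a3_nonneg hP hk
  unfold a1; positivity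

theorem a0_nonneg : 0 ≤ P.a0 := by
  have := hP.rhoJ_nonneg
  have := hP.rhov_nonneg
  have := hP.rhoa_nonneg
  have := hP.rhod_nonneg
  have := hP.rhoq_nonneg
  have := hP.rhow_nonneg
  have := matNorm_nonneg P.Jhat
  have := P.rho0_nonneg
  unfold a0; positivity

theorem rhos_nonneg : 0 ≤ P.rhos := by
  have := hP.rhov_nonneg
  have := hP.rhoq_nonneg
  have := hP.rhow_nonneg
  have := P.rho0_nonneg
  unfold rhos; positivity

end Signs

/-! ### Size of the torques -/

/-- Bounds `r₀`, `r_q`, `r_w` on the observer errors at time `t`, for the attitude `q`. -/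
structure ErrorBound (P : Data m) (t : ℝ) (q : ℍ[ℝ]) (r0 rq rw : ℝ) : Prop where
  quat : ‖P.qeHat t q - q‖ ≤ r0
  rot : ‖vec (P.qtil t)‖ ≤ rq
  vel : ‖P.wtil t‖ ≤ rw

theorem qeHat_eq (hP : P.Standing) {t : ℝ} (ht : 0 ≤ t) (q : ℍ[ℝ]) :
    P.qeHat t q = q * (P.qtil t)⁻¹ := by
  have h : P.qd t ≠ 0 := by
    rw [← norm_ne_zero_iff, hP.qd_unit t ht]; exact one_ne_zero
  rw [qeHat, qHat, mul_assoc, inv_mul_cancel_left₀ h]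

/-- The part of the right-hand side of `J s' = …` that can do work on `s`. -/
def forcing (P : Data m) (t : ℝ) (q : ℍ[ℝ]) (s : V3) : V3 :=
  psi P.k P.J q (P.omegaE q s) (act (R q) (P.wd t)) - psiD P.J q (P.wd t) (P.wd' t)
    + act (P.D * P.E t) (P.tauU t q s) + P.taud t

/-- The mismatch between the model terms and their estimates used by the controller. -/
def mismatch (P : Data m) (t : ℝ) (q : ℍ[ℝ]) (s : V3) : V3 :=
  (psi P.k P.J q (P.omegaE q s) (act (R q) (P.wd t))
    - psi P.k P.Jhat (P.qeHat t q) (P.omegaEHat t q s) (act (R (P.qeHat t q)) (P.wd t)))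
  + (psiD P.Jhat (P.qeHat t q) (P.wd t) (P.wd' t) - psiD P.J q (P.wd t) (P.wd' t))
  + (P.taud t - P.taudhat t)

/-- The gyroscopic terms and the terms `q_e^× J + J q_e^×` do no work on `s`. -/
theorem inner_slidingRhs (hP : P.Standing) (t : ℝ) (q : ℍ[ℝ]) (s : V3) :
    inner ℝ s (P.slidingRhs t q s) = inner ℝ s (P.forcing t q s) := by
  have h : P.slidingRhs t q s = act (Xi P.J (P.omegaE q s) (act (R q) (P.wd t))) s
      + ((1 / 2 : ℝ) * P.k) • act (skew (vec q) * P.J + P.J * skew (vec q)) s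
      + P.forcing t q s := by
    unfold slidingRhs forcing; abel
  rw [h, inner_add_right, inner_add_right, inner_smul_right, inner_act_Xi_self hP.J_symm,
    inner_act_skew_anticomm hP.J_symm]
  ring

/-- The forcing under the controller: the model terms cancel up to the mismatch. -/
theorem forcing_eq (hP : P.Standing) {t : ℝ} (ht : 0 ≤ t) (q : ℍ[ℝ]) (s : V3) :
    P.forcing t q s = P.mismatch t q s - act P.K (P.sHat t q s) + P.uS t q s
      + act (P.H t) (P.u t q s) := by
  unfold forcing mismatch
  rw [act_E_tauU hP ht]
  nth_rewrite 1 [u]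
  abel

theorem norm_omegaE_le (hk : 0 ≤ P.k) (q : ℍ[ℝ]) (s : V3) :
    ‖P.omegaE q s‖ ≤ ‖s‖ + P.k * ‖vec q‖ := by
  unfold omegaE
  refine (norm_sub_le _ _).trans (le_of_eq ?_)
  rw [norm_smul, Real.norm_of_nonneg hk]

theorem omegaEHat_sub (t : ℝ) (q : ℍ[ℝ]) (s : V3) : P.omegaEHat t q s - P.omegaE q s
    = P.wtil t - (act (R (P.qeHat t q)) (P.wd t) - act (R q) (P.wd t)) := by
  unfold omegaEHat omegaHat; abel

theorem uS_eq (t : ℝ) (q : ℍ[ℝ]) (s : V3) : P.uS t q s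
    = -(((P.a1 * (‖vec (P.qeHat t q)‖ + P.gam) + P.a0) / max P.eps ‖P.sHat t q s‖)
      • P.sHat t q s) := by
  unfold uS
  split_ifs with h
  · rw [max_eq_right h]
  · rw [max_eq_left (not_le.mp h).le]

section Bounds

variable (hP : P.Standing) (hk : 0 < P.k) (hgam : 0 < P.gam) (heps : P.rhos < P.eps)
  (hK : P.K.PosDef) {t : ℝ} (ht : 0 ≤ t) {q : ℍ[ℝ]} (hq : ‖q‖ = 1) {s : V3} {r0 rq rw : ℝ}
  (he : P.ErrorBound t q r0 rq rw)

include hP hk heps in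
theorem eps_pos : 0 < P.eps := (rhos_nonneg hP hk).trans_lt heps

include he in
theorem ErrorBound.nonneg : 0 ≤ r0 ∧ 0 ≤ rq ∧ 0 ≤ rw :=
  ⟨(norm_nonneg _).trans he.quat, (norm_nonneg _).trans he.rot, (norm_nonneg _).trans he.vel⟩

include hP ht hq in
theorem norm_qeHat : ‖P.qeHat t q‖ = 1 := by
  rw [qeHat_eq hP ht, norm_mul, norm_inv, hq, hP.qtil_unit t ht]; norm_num

include hP ht hq he in
theorem norm_act_R_qeHat_sub_le {v : V3} {V : ℝ} (hv : ‖v‖ ≤ V) :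
    ‖act (R (P.qeHat t q)) v - act (R q) v‖ ≤ 2 * rq * V := by
  rw [qeHat_eq hP ht]
  refine (norm_act_R_sub_le (hP.qtil_unit t ht) hq v).trans ?_
  have := he.rot
  have := he.nonneg.2.1
  gcongr

include hP ht hq he in
theorem norm_omegaEHat_sub_le : ‖P.omegaEHat t q s - P.omegaE q s‖ ≤ rw + 2 * rq * P.rhov := by
  rw [omegaEHat_sub]
  exact norm_sub_le_of_le he.vel (norm_act_R_qeHat_sub_le hP ht hq he (hP.wd_le t ht))

include hP hk ht hq he in
theorem norm_sHat_sub_le : ‖P.sHat t q s - s‖ ≤ P.rhosOf r0 rq rw := by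
  have h : P.sHat t q s - s
      = (P.omegaEHat t q s - P.omegaE q s) + P.k • (vec (P.qeHat t q) - vec q) := by
    rw [smul_sub, show P.omegaE q s = s - P.k • vec q from rfl, sHat]
    abel
  rw [h]
  refine norm_add_le_of_le (norm_omegaEHat_sub_le hP ht hq he) ?_
  rw [norm_smul, Real.norm_of_nonneg hk.le]
  exact mul_le_mul_of_nonneg_left ((norm_sub_vec_le _ _).trans he.quat) hk.le

include hP hk ht hq he in
theorem norm_sHat_le : ‖P.sHat t q s‖ ≤ ‖s‖ + P.rhosOf r0 rq rw := by
  have h1 := norm_sub_norm_le (P.sHat t q s) s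
  have h2 := norm_sHat_sub_le hP hk ht hq he (s := s)
  linarith

include hP hk ht hq he in
/-- The estimate that the constants `a_i` are made for. -/
theorem norm_mismatch_le : ‖P.mismatch t q s‖
    ≤ P.a3Of r0 * ‖s‖ + P.a2 * ‖vec q‖ ^ 2 + P.a1Of r0 rq * ‖vec q‖ + P.a0Of r0 rq rw := by
  have hqh := norm_qeHat hP ht hq
  have hv : ‖act (R q) (P.wd t)‖ ≤ P.rhov := by rw [norm_act_R hq]; exact hP.wd_le t ht
  have hvh : ‖act (R (P.qeHat t q)) (P.wd t)‖ ≤ P.rhov := by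
    rw [norm_act_R hqh]; exact hP.wd_le t ht
  have hdv := norm_act_R_qeHat_sub_le hP ht hq he (hP.wd_le t ht)
  have hda := norm_act_R_qeHat_sub_le hP ht hq he (hP.wd'_le t ht)
  have h1 := norm_psi_sub_le hk.le hP.J_err hq hqh he.quat
    (norm_omegaEHat_sub_le hP ht hq he (s := s)) hv hvh hdv
  have h2 := norm_psiD_sub_le hP.J_err hq hqh (hP.wd_le t ht) (hP.wd'_le t ht) hdv hda
  have h3 : ‖P.taud t - P.taudhat t‖ ≤ P.rhod := by
    rw [norm_sub_rev]; exact hP.taud_err t ht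
  refine norm_add₃_le.trans ((add_le_add_three h1 h2 h3).trans ?_)
  have h4 : 1 / 2 * P.k * ((P.rhoJ + r0 * matNorm P.Jhat) * ‖P.omegaE q s‖)
      ≤ 1 / 2 * P.k * ((P.rhoJ + r0 * matNorm P.Jhat) * (‖s‖ + P.k * ‖vec q‖)) := by
    have := norm_omegaE_le hk.le q s
    have := hP.rhoJ_nonneg
    have := matNorm_nonneg P.Jhat
    have := he.nonneg.1
    gcongr
  unfold a3Of a2 a1Of a3Of a0Of
  linarith

include hP hk hgam heps in
theorem norm_uS_le : ‖P.uS t q s‖ ≤ P.a1 * (‖vec (P.qeHat t q)‖ + P.gam) + P.a0 := by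
  have heps0 := eps_pos hP hk heps
  have hN : 0 ≤ P.a1 * (‖vec (P.qeHat t q)‖ + P.gam) + P.a0 := by
    have := a1_nonneg hP hk
    have := a0_nonneg hP hk
    positivity
  have hm : 0 < max P.eps ‖P.sHat t q s‖ := lt_max_of_lt_left heps0
  rw [uS_eq, norm_neg, norm_smul, Real.norm_of_nonneg (by positivity), div_mul_eq_mul_div,
    div_le_iff₀ hm]
  exact mul_le_mul_of_nonneg_left (le_max_right _ _) hN

include he in
theorem norm_vec_qeHat_le : ‖vec (P.qeHat t q)‖ ≤ ‖vec q‖ + r0 := by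
  have h1 := norm_sub_norm_le (vec (P.qeHat t q)) (vec q)
  have h2 := (norm_sub_vec_le _ _).trans he.quat
  linarith

include he in
theorem le_norm_vec_qeHat : ‖vec q‖ - r0 ≤ ‖vec (P.qeHat t q)‖ := by
  have h1 := norm_sub_norm_le (vec q) (vec (P.qeHat t q))
  have h2 := (norm_sub_vec_le _ _).trans he.quat
  rw [norm_sub_rev] at h1
  linarith

include hP hk ht hq he hK hgam heps in
/-- The estimate that the constants `b_i` are made for. -/
theorem norm_u_le : ‖P.u t q s‖
    ≤ P.b3 * ‖s‖ + P.b2 * ‖vec q‖ ^ 2 + P.b1Of r0 * ‖vec q‖ + P.b0Of r0 rq rw := by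
  have hqh := norm_qeHat hP ht hq
  have hx := norm_vec_qeHat_le he
  have ha1 := a1_nonneg hP hk
  have hlam := lamMax_pos hK
  have hvh : ‖act (R (P.qeHat t q)) (P.wd t)‖ ≤ P.rhov := by
    rw [norm_act_R hqh]; exact hP.wd_le t ht
  have hs := norm_sHat_le hP hk ht hq he (s := s)
  have hw : ‖P.omegaEHat t q s‖ ≤ ‖s‖ + P.k * ‖vec q‖ + (rw + 2 * rq * P.rhov) := by
    have h1 := norm_sub_norm_le (P.omegaEHat t q s) (P.omegaE q s)
    have h2 := norm_omegaEHat_sub_le hP ht hq he (s := s)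
    have h3 := norm_omegaE_le hk.le q s
    linarith
  have e1 : ‖-act P.K (P.sHat t q s)‖ ≤ lamMax P.K * (‖s‖ + P.rhosOf r0 rq rw) := by
    rw [norm_neg]
    exact (norm_act_le_lamMax hK _).trans (mul_le_mul_of_nonneg_left hs hlam.le)
  have e2 : ‖P.uS t q s‖ ≤ P.a1 * (‖vec q‖ + r0 + P.gam) + P.a0 :=
    (norm_uS_le hP hk hgam heps).trans (by gcongr)
  have e3 := norm_psiD_le (J := P.Jhat) hqh (hP.wd_le t ht) (hP.wd'_le t ht)
  have e4 := norm_psi_le (J := P.Jhat) hk.le hqh hx hw hvh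
  have e5 := hP.taudhat_le t ht
  unfold u
  refine (norm_sub_le_of_le (norm_sub_le_of_le (norm_add_le_of_le (norm_add_le_of_le e1 e2) e3)
    e4) e5).trans (le_of_eq ?_)
  unfold b3 b1Of b0Of b2
  ring

include hP ht in
theorem norm_act_H_le {x : V3} {X : ℝ} (hx : ‖x‖ ≤ X) : ‖act (P.H t) x‖ ≤ P.rhoE * X :=
  norm_act_le_of_le (hP.H_le t ht) hx

include hP hk ht hq he hK hgam heps in
theorem norm_forcing_le_of_errorBound : ‖P.forcing t q s‖
    ≤ (P.a3Of r0 * ‖s‖ + P.a2 * ‖vec q‖ ^ 2 + P.a1Of r0 rq * ‖vec q‖ + P.a0Of r0 rq rw)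
      + lamMax P.K * (‖s‖ + P.rhosOf r0 rq rw) + (P.a1 * (‖vec q‖ + r0 + P.gam) + P.a0)
      + P.rhoE * (P.b3 * ‖s‖ + P.b2 * ‖vec q‖ ^ 2 + P.b1Of r0 * ‖vec q‖ + P.b0Of r0 rq rw) := by
  have ha1 := a1_nonneg hP hk
  have hx := norm_vec_qeHat_le he
  rw [forcing_eq hP ht]
  refine norm_add_le_of_le (norm_add_le_of_le (norm_sub_le_of_le
    (norm_mismatch_le hP hk ht hq he) ?_) ?_)
    (norm_act_H_le hP ht (norm_u_le hP hk hgam heps hK ht hq he))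
  · exact (norm_act_le_lamMax hK _).trans
      (mul_le_mul_of_nonneg_left (norm_sHat_le hP hk ht hq he) (lamMax_pos hK).le)
  · exact (norm_uS_le hP hk hgam heps).trans (by gcongr)

include hP hk hK hgam heps in
/-- The torque that does work on `s` grows at most linearly in `s`, uniformly in time. -/
theorem exists_norm_forcing_le : ∃ C : ℝ, 0 ≤ C ∧ ∀ t, 0 ≤ t → ∀ q : ℍ[ℝ], ‖q‖ = 1 → ∀ s,
    ‖P.forcing t q s‖ ≤ C * (1 + ‖s‖) := by
  obtain ⟨B, hB⟩ := hP.wtil_bdd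
  set X := |P.a3Of 2| + |lamMax P.K| + |P.rhoE * P.b3| with hX
  set Y := |P.a2| + |P.a1Of 2 1| + |P.a0Of 2 1 B| + |lamMax P.K * P.rhosOf 2 1 B| + |P.a1|
    + |P.a1 * (2 + P.gam) + P.a0| + |P.rhoE * P.b2| + |P.rhoE * P.b1Of 2|
    + |P.rhoE * P.b0Of 2 1 B| with hY
  have hX0 : 0 ≤ X := by positivity
  have hY0 : 0 ≤ Y := by positivity
  refine ⟨X + Y, by positivity, fun t ht q hq s => ?_⟩
  -- unit quaternions are at most `2` apart
  have he : P.ErrorBound t q 2 1 B := by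
    refine ⟨?_, ?_, hB t ht⟩
    · refine (norm_sub_le _ _).trans (le_of_eq ?_)
      rw [norm_qeHat hP ht hq, hq]; norm_num
    · exact (norm_vec_le _).trans (hP.qtil_unit t ht).le
  refine (norm_forcing_le_of_errorBound hP hk hgam heps hK ht hq he).trans ?_
  have hx0 : 0 ≤ ‖vec q‖ := norm_nonneg _
  have hx1 : ‖vec q‖ ≤ 1 := (norm_vec_le q).trans hq.le
  have hx2 : ‖vec q‖ ^ 2 ≤ 1 := pow_le_one₀ hx0 hx1
  have hs : 0 ≤ ‖s‖ := norm_nonneg _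
  have key : ∀ c z : ℝ, 0 ≤ z → z ≤ 1 → c * z ≤ |c| := fun c z h0 h1 =>
    (mul_le_mul_of_nonneg_right (le_abs_self c) h0).trans
      (mul_le_of_le_one_right (abs_nonneg c) h1)
  have hsq : 0 ≤ ‖vec q‖ ^ 2 := by positivity
  have e1 := key P.a2 _ hsq hx2
  have e2 := key (P.a1Of 2 1) _ hx0 hx1
  have e3 := key P.a1 _ hx0 hx1
  have e4 := key (P.rhoE * P.b2) _ hsq hx2
  have e5 := key (P.rhoE * P.b1Of 2) _ hx0 hx1
  have e6 := le_abs_self (P.a0Of 2 1 B)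
  have e7 := le_abs_self (lamMax P.K * P.rhosOf 2 1 B)
  have e8 := le_abs_self (P.a1 * (2 + P.gam) + P.a0)
  have e9 := le_abs_self (P.rhoE * P.b0Of 2 1 B)
  have f1 := mul_le_mul_of_nonneg_right (le_abs_self (P.a3Of 2)) hs
  have f2 := mul_le_mul_of_nonneg_right (le_abs_self (lamMax P.K)) hs
  have f3 := mul_le_mul_of_nonneg_right (le_abs_self (P.rhoE * P.b3)) hs
  have g : X + Y + X * ‖s‖ ≤ (X + Y) * (1 + ‖s‖) := by
    have := mul_nonneg hY0 hs
    linarith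
  refine le_trans ?_ g
  rw [hX, hY]
  linarith

/-! ### Dissipation inequality -/

/-- Outside the boundary layer the robust term is dissipative, up to a relative error
`2 ‖ŝ - s‖ / ε`. -/
theorem inner_neg_smul_le_of_le {s sh : V3} {N S ε : ℝ} (hε : 0 < ε) (hN : 0 ≤ N)
    (hS : ‖sh - s‖ ≤ S) (h : ε ≤ ‖sh‖) :
    inner ℝ s (-((N / ‖sh‖) • sh)) ≤ ‖s‖ * (2 * ε⁻¹ * S * N - N) := by
  have hsh : 0 < ‖sh‖ := hε.trans_le h
  have hS0 : 0 ≤ S := (norm_nonneg _).trans hS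
  have h1 : ‖s‖ ^ 2 - ‖s‖ * S ≤ inner ℝ s sh := by
    have h2 : inner ℝ s sh = ‖s‖ ^ 2 + inner ℝ s (sh - s) := by
      rw [inner_sub_right, real_inner_self_eq_norm_sq]; ring
    have h3 := neg_le_of_abs_le (abs_real_inner_le_norm s (sh - s))
    have h4 := mul_le_mul_of_nonneg_left hS (norm_nonneg s)
    linarith
  have h5 : ‖sh‖ ≤ ‖s‖ + S := by
    have := norm_sub_norm_le sh s; linarith
  have h6 : ‖s‖ * ‖sh‖ - inner ℝ s sh ≤ 2 * (‖s‖ * S) := by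
    have := mul_le_mul_of_nonneg_left h5 (norm_nonneg s)
    linarith
  have h7 : ‖sh‖⁻¹ ≤ ε⁻¹ := inv_anti₀ hε h
  have h8 : ‖s‖ - ‖sh‖⁻¹ * inner ℝ s sh ≤ 2 * ε⁻¹ * S * ‖s‖ := by
    calc ‖s‖ - ‖sh‖⁻¹ * inner ℝ s sh = ‖sh‖⁻¹ * (‖s‖ * ‖sh‖ - inner ℝ s sh) := by field_simp
      _ ≤ ‖sh‖⁻¹ * (2 * (‖s‖ * S)) := by gcongr
      _ ≤ ε⁻¹ * (2 * (‖s‖ * S)) := by gcongr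
      _ = _ := by ring
  rw [inner_neg_right, inner_smul_right]
  have h9 := mul_le_mul_of_nonneg_left h8 hN
  calc -(N / ‖sh‖ * inner ℝ s sh) = N * (‖s‖ - ‖sh‖⁻¹ * inner ℝ s sh) - N * ‖s‖ := by ring
    _ ≤ N * (2 * ε⁻¹ * S * ‖s‖) - N * ‖s‖ := by linarith
    _ = _ := by ring

/-- Inside the boundary layer, where the robust term is `-(N / ε) ŝ`, its power is controlled by the
error `ŝ - s` alone. -/
theorem inner_neg_smul_le {s sh : V3} {N S ε : ℝ} (hε : 0 < ε) (hN : 0 ≤ N)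
    (hS : ‖sh - s‖ ≤ S) :
    inner ℝ s (-((N / ε) • sh)) ≤ ‖s‖ * (ε⁻¹ * S * N) := by
  have h1 : -(‖s‖ * S) ≤ inner ℝ s sh := by
    have h2 : inner ℝ s sh = ‖s‖ ^ 2 + inner ℝ s (sh - s) := by
      rw [inner_sub_right, real_inner_self_eq_norm_sq]; ring
    have h3 := neg_le_of_abs_le (abs_real_inner_le_norm s (sh - s))
    have h4 := mul_le_mul_of_nonneg_left hS (norm_nonneg s)
    nlinarith [sq_nonneg ‖s‖]
  rw [inner_neg_right, inner_smul_right]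
  have h2 := mul_le_mul_of_nonneg_left h1 (div_nonneg hN hε.le)
  calc -(N / ε * inner ℝ s sh) ≤ N / ε * (‖s‖ * S) := by linarith
    _ = _ := by ring

/-- Bound on the power per unit of `‖s‖`, besides the quadratic dissipation, while `‖ŝ‖ ≥ ε`. -/
def power1 (P : Data m) (r0 rq rw x : ℝ) : ℝ :=
  (P.a2 + P.rhoE * P.b2) * x ^ 2
    + (P.a1Of r0 rq - P.a1 + 2 * P.eps⁻¹ * P.rhosOf r0 rq rw * P.a1 + P.rhoE * P.b1Of r0) * x
    + (P.a0Of r0 rq rw - P.a0 + lamMax P.K * P.rhosOf r0 rq rw + P.a1 * r0 - P.a1 * P.gam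
      + 2 * P.eps⁻¹ * P.rhosOf r0 rq rw * (P.a1 * (r0 + P.gam) + P.a0)
      + P.rhoE * P.b0Of r0 rq rw)

/-- Bound on the power per unit of `‖s‖`, besides the quadratic dissipation, while `‖ŝ‖ < ε`. -/
def power2 (P : Data m) (r0 rq rw x : ℝ) : ℝ :=
  (P.a2 + P.rhoE * P.b2) * x ^ 2
    + (P.a1Of r0 rq + P.eps⁻¹ * P.rhosOf r0 rq rw * P.a1 + P.rhoE * P.b1Of r0) * x
    + (P.a0Of r0 rq rw + lamMax P.K * P.rhosOf r0 rq rw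
      + P.eps⁻¹ * P.rhosOf r0 rq rw * (P.a1 * (r0 + P.gam) + P.a0)
      + P.rhoE * P.b0Of r0 rq rw)

include hP hk ht hq he hK hgam heps in
/-- The dissipation inequality for given sizes of the observer errors. -/
theorem inner_slidingRhs_le : inner ℝ s (P.slidingRhs t q s)
    ≤ -(lamMin P.K - P.a3Of r0 - P.rhoE * P.b3) * ‖s‖ ^ 2
      + ‖s‖ * max (P.power1 r0 rq rw ‖vec q‖) (P.power2 r0 rq rw ‖vec q‖) := by
  have heps0 := eps_pos hP hk heps
  have ha1 := a1_nonneg hP hk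
  have ha0 := a0_nonneg hP hk
  have hx := norm_vec_qeHat_le he
  have hx' := le_norm_vec_qeHat he
  have hs0 : 0 ≤ ‖s‖ := norm_nonneg s
  have hsh := norm_sHat_sub_le hP hk ht hq he (s := s)
  set N := P.a1 * (‖vec (P.qeHat t q)‖ + P.gam) + P.a0 with hN
  have hN0 : 0 ≤ N := by positivity
  set S := P.rhosOf r0 rq rw with hS
  have hS0 : 0 ≤ S := (norm_nonneg _).trans hsh
  have hNu : N ≤ P.a1 * ‖vec q‖ + (P.a1 * (r0 + P.gam) + P.a0) := by
    have := mul_le_mul_of_nonneg_left hx ha1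
    rw [hN]; linarith
  have hNl : P.a1 * ‖vec q‖ - P.a1 * r0 + P.a1 * P.gam + P.a0 ≤ N := by
    have := mul_le_mul_of_nonneg_left hx' ha1
    rw [hN]; linarith
  -- the three contributions that do not depend on the boundary layer
  have e1 : inner ℝ s (P.mismatch t q s) ≤ ‖s‖ * _ :=
    (real_inner_le_norm _ _).trans
      (mul_le_mul_of_nonneg_left (norm_mismatch_le hP hk ht hq he) hs0)
  have e2 : inner ℝ s (act (P.H t) (P.u t q s)) ≤ ‖s‖ * _ :=
    (real_inner_le_norm _ _).trans (mul_le_mul_of_nonneg_left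
      (norm_act_H_le hP ht (norm_u_le hP hk hgam heps hK ht hq he)) hs0)
  have e3 : lamMin P.K * ‖s‖ ^ 2 - ‖s‖ * (lamMax P.K * S)
      ≤ inner ℝ s (act P.K (P.sHat t q s)) := by
    have h1 : inner ℝ s (act P.K (P.sHat t q s))
        = inner ℝ s (act P.K s) + inner ℝ s (act P.K (P.sHat t q s - s)) := by
      rw [act_vec_sub, inner_sub_right]; ring
    have h2 := lamMin_mul_norm_sq_le (posDef_isSymm hK) s
    have h3 := neg_le_of_abs_le (abs_real_inner_le_norm s (act P.K (P.sHat t q s - s)))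
    have h4 : ‖act P.K (P.sHat t q s - s)‖ ≤ lamMax P.K * S :=
      (norm_act_le_lamMax hK _).trans (mul_le_mul_of_nonneg_left hsh (lamMax_pos hK).le)
    have h5 := mul_le_mul_of_nonneg_left h4 hs0
    linarith
  rw [inner_slidingRhs hP, forcing_eq hP ht, inner_add_right, inner_add_right, inner_sub_right]
  have hi : 0 ≤ P.eps⁻¹ := inv_nonneg.mpr heps0.le
  rcases le_or_gt P.eps ‖P.sHat t q s‖ with h | h
  · have e4 : inner ℝ s (P.uS t q s) ≤ ‖s‖ * (2 * P.eps⁻¹ * S * N - N) := by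
      rw [uS, if_pos h]
      exact inner_neg_smul_le_of_le heps0 hN0 hsh h
    have e5 : 2 * P.eps⁻¹ * S * N
        ≤ 2 * P.eps⁻¹ * S * (P.a1 * ‖vec q‖ + (P.a1 * (r0 + P.gam) + P.a0)) := by gcongr
    have e6 := mul_le_mul_of_nonneg_left (sub_le_sub e5 hNl) hs0
    have e7 := mul_le_mul_of_nonneg_left
      (le_max_left (P.power1 r0 rq rw ‖vec q‖) (P.power2 r0 rq rw ‖vec q‖)) hs0
    generalize max (P.power1 r0 rq rw ‖vec q‖) (P.power2 r0 rq rw ‖vec q‖) = X at e7 ⊢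
    rw [power1, ← hS] at e7
    linarith
  · have e4 : inner ℝ s (P.uS t q s) ≤ ‖s‖ * (P.eps⁻¹ * S * N) := by
      rw [uS, if_neg (not_le.mpr h)]
      exact inner_neg_smul_le heps0 hN0 hsh
    have e5 : P.eps⁻¹ * S * N
        ≤ P.eps⁻¹ * S * (P.a1 * ‖vec q‖ + (P.a1 * (r0 + P.gam) + P.a0)) := by gcongr
    have e6 := mul_le_mul_of_nonneg_left e5 hs0
    have e7 := mul_le_mul_of_nonneg_left
      (le_max_right (P.power1 r0 rq rw ‖vec q‖) (P.power2 r0 rq rw ‖vec q‖)) hs0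
    generalize max (P.power1 r0 rq rw ‖vec q‖) (P.power2 r0 rq rw ‖vec q‖) = X at e7 ⊢
    rw [power2, ← hS] at e7
    linarith

end Bounds

theorem continuous_phiBar (P : Data m) : Continuous fun x => P.phiBar x 0 := by
  unfold phiBar phi1 phi2; fun_prop

theorem max_power_eq_phiBar (P : Data m) (x : ℝ) :
    max (P.power1 P.rho0 P.rhoq P.rhow x) (P.power2 P.rho0 P.rhoq P.rhow x) = P.phiBar x 0 := by
  have h1 : P.rhosOf P.rho0 P.rhoq P.rhow = P.rhos := rfl
  have h2 : P.a1Of P.rho0 P.rhoq = P.a1 := rfl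
  have h3 : P.a0Of P.rho0 P.rhoq P.rhow = P.a0 := rfl
  have h4 : P.b1Of P.rho0 = P.b1 := rfl
  have h5 : P.b0Of P.rho0 P.rhoq P.rhow = P.b0 := rfl
  unfold phiBar power1 power2 phi1 phi2
  rw [h1, h2, h3, h4, h5]
  congr 1 <;> ring

/-- As the observer errors approach their ultimate bounds, the dissipation inequality holds with
`κ` and `φ̄(‖q_e‖, 0)`, up to an arbitrarily small error. -/
theorem eventually_inner_slidingRhs_le (hP : P.Standing) (hk : 0 < P.k) (hgam : 0 < P.gam)
    (heps : P.rhos < P.eps) (hK : P.K.PosDef) {η : ℝ} (hη : 0 < η) :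
    ∀ᶠ t in atTop, ∀ q : ℍ[ℝ], ‖q‖ = 1 → ∀ s, inner ℝ s (P.slidingRhs t q s)
      ≤ -(P.kappa - η) * ‖s‖ ^ 2 + ‖s‖ * (P.phiBar ‖vec q‖ 0 + η) := by
  -- the error bounds used at tolerance `δ`
  let r : ℝ → ℝ := fun δ => Real.sqrt (2 * (1 - Real.sqrt (1 - (P.rhoq + δ) ^ 2)))
  have hr : Continuous r := by fun_prop
  have hr0 : r 0 = P.rho0 := by simp [r, rho0]
  let f : ℝ × ℝ → ℝ := fun p =>
    max (P.power1 (r p.1) (P.rhoq + p.1) (P.rhow + p.1) p.2)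
      (P.power2 (r p.1) (P.rhoq + p.1) (P.rhow + p.1) p.2)
  have hf : Continuous f := by
    simp only [f, power1, power2, rhosOf, a1Of, a0Of, a3Of, b1Of, b0Of]
    fun_prop
  have hf0 : ∀ x, f (0, x) = P.phiBar x 0 := fun x => by
    rw [← max_power_eq_phiBar]
    simp only [f, hr0, add_zero]
  have hphi := continuous_phiBar P
  have hev1 : ∀ᶠ δ in 𝓝 (0 : ℝ), ∀ x ∈ Icc (0 : ℝ) 1, f (δ, x) < P.phiBar x 0 + η := by
    refine isCompact_Icc.eventually_forall_of_forall_eventually fun x _ => ?_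
    have hc : Continuous fun p : ℝ × ℝ => P.phiBar p.2 0 + η := by fun_prop
    refine (hf.tendsto _).eventually_lt (hc.tendsto _) ?_
    rw [hf0]; linarith
  have hev2 : ∀ᶠ δ in 𝓝 (0 : ℝ), P.a3Of (r δ) < P.a3 + η := by
    have hc : Continuous fun δ => P.a3Of (r δ) := by unfold a3Of; fun_prop
    refine (hc.tendsto 0).eventually_lt tendsto_const_nhds ?_
    have : P.a3Of (r 0) = P.a3 := by rw [hr0]; rfl
    rw [this]; linarith
  obtain ⟨δ, hδ, hδ1, hδ2⟩ : ∃ δ : ℝ, 0 < δ ∧ (∀ x ∈ Icc (0 : ℝ) 1, f (δ, x) < P.phiBar x 0 + η)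
      ∧ P.a3Of (r δ) < P.a3 + η := by
    have h := (hev1.and hev2).filter_mono (nhdsWithin_le_nhds (s := Ioi 0))
    obtain ⟨δ, ⟨h1, h2⟩, h3⟩ := (h.and self_mem_nhdsWithin).exists
    exact ⟨δ, h3, h1, h2⟩
  have hq : ∀ᶠ t in atTop, ((‖vec (P.qtil t)‖ : ℝ) : EReal) < ((P.rhoq + δ : ℝ) : EReal) :=
    eventually_lt_of_limsup_lt (hP.qtil_limsup.trans_lt
      (EReal.coe_lt_coe_iff.mpr (by linarith)))
  have hw : ∀ᶠ t in atTop, ((‖P.wtil t‖ : ℝ) : EReal) < ((P.rhow + δ : ℝ) : EReal) :=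
    eventually_lt_of_limsup_lt (hP.wtil_limsup.trans_lt
      (EReal.coe_lt_coe_iff.mpr (by linarith)))
  filter_upwards [hq, hw, hP.qtil_re, eventually_ge_atTop 0] with t h1 h2 h3 ht q hqu s
  rw [EReal.coe_lt_coe_iff] at h1 h2
  have he : P.ErrorBound t q (r δ) (P.rhoq + δ) (P.rhow + δ) := by
    refine ⟨?_, h1.le, h2.le⟩
    have hu := hP.qtil_unit t ht
    rw [qeHat_eq hP ht, norm_mul_inv_sub_self hu hqu]
    refine Real.sqrt_le_sqrt ?_
    have h4 : Real.sqrt (1 - (P.rhoq + δ) ^ 2) ≤ (P.qtil t).re := by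
      refine Real.sqrt_le_iff.mpr ⟨h3, ?_⟩
      have h5 := norm_sq_quaternion (P.qtil t)
      have h6 := pow_le_pow_left₀ (norm_nonneg _) h1.le 2
      rw [hu] at h5
      linarith
    linarith
  refine (inner_slidingRhs_le hP hk hgam heps hK ht hqu he).trans ?_
  have hx : ‖vec q‖ ∈ Icc (0 : ℝ) 1 := ⟨norm_nonneg _, (norm_vec_le q).trans hqu.le⟩
  have h7 := mul_le_mul_of_nonneg_left (hδ1 _ hx).le (norm_nonneg s)
  have h8 := mul_le_mul_of_nonneg_right hδ2.le (sq_nonneg ‖s‖)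
  simp only [f] at h7
  unfold kappa
  linarith

end Data
end AttitudeTracking

namespace AttitudeTracking

/-! ### Regularity of the closed-loop vector field -/

section Smooth

variable {F : Type*} [NormedAddCommGroup F] [NormedSpace ℝ F]

theorem contDiff_smul_left {Y : Type*} [NormedAddCommGroup Y] [NormedSpace ℝ Y] {f : F → Y}
    (c : ℝ) (hf : ContDiff ℝ 1 f) : ContDiff ℝ 1 fun x => c • f x := by fun_prop

theorem contDiff_act {A : M3} {v : F → V3} (hv : ContDiff ℝ 1 v) :
    ContDiff ℝ 1 fun x => act A (v x) := (toCLM A).contDiff.comp hv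

theorem contDiff_cr {v w : F → V3} (hv : ContDiff ℝ 1 v) (hw : ContDiff ℝ 1 w) :
    ContDiff ℝ 1 fun x => cr (v x) (w x) := (cr.contDiff.comp hv).clm_apply hw

theorem contDiff_vec {q : F → ℍ[ℝ]} (hq : ContDiff ℝ 1 q) : ContDiff ℝ 1 fun x => vec (q x) :=
  vecL.contDiff.comp hq

theorem contDiff_re {q : F → ℍ[ℝ]} (hq : ContDiff ℝ 1 q) : ContDiff ℝ 1 fun x => (q x).re :=
  reL.contDiff.comp hq

theorem contDiff_act_G {q : F → ℍ[ℝ]} {v : F → V3} (hq : ContDiff ℝ 1 q)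
    (hv : ContDiff ℝ 1 v) : ContDiff ℝ 1 fun x => act (G (q x)) (v x) := by
  simp only [act_G]
  exact ((contDiff_re hq).smul hv).add (contDiff_cr (contDiff_vec hq) hv)

theorem contDiff_act_R {q : F → ℍ[ℝ]} {v : F → V3} (hq : ContDiff ℝ 1 q)
    (hv : ContDiff ℝ 1 v) : ContDiff ℝ 1 fun x => act (R (q x)) (v x) := by
  simp only [act_R]
  have h := contDiff_vec hq
  exact (hv.sub ((contDiff_const.mul (contDiff_re hq)).smul (contDiff_cr h hv))).add
    (contDiff_smul_left _ (contDiff_cr h (contDiff_cr h hv)))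

theorem contDiff_act_Xi {J : M3} {w v x : F → V3} (hw : ContDiff ℝ 1 w) (hv : ContDiff ℝ 1 v)
    (hx : ContDiff ℝ 1 x) : ContDiff ℝ 1 fun y => act (Xi J (w y) (v y)) (x y) := by
  simp only [act_Xi]
  exact ((contDiff_cr (contDiff_act (hw.add hv)) hx).sub (contDiff_cr hv (contDiff_act hx))).sub
    (contDiff_act (contDiff_cr hv hx))

theorem contDiff_psi {k : ℝ} {J : M3} {q : F → ℍ[ℝ]} {w v : F → V3} (hq : ContDiff ℝ 1 q)
    (hw : ContDiff ℝ 1 w) (hv : ContDiff ℝ 1 v) :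
    ContDiff ℝ 1 fun x => psi k J (q x) (w x) (v x) := by
  have h := contDiff_vec hq
  simp only [psi, act_skew_eq_cr]
  exact ((contDiff_smul_left _ (contDiff_cr h (contDiff_act h))).neg.add
    (contDiff_smul_left _ (contDiff_act_G hq (contDiff_act hw)))).sub
    (contDiff_smul_left _ (contDiff_act_Xi contDiff_const hv h))

theorem contDiff_psiD {J : M3} {q : F → ℍ[ℝ]} {w a : F → V3} (hq : ContDiff ℝ 1 q)
    (hw : ContDiff ℝ 1 w) (ha : ContDiff ℝ 1 a) :
    ContDiff ℝ 1 fun x => psiD J (q x) (w x) (a x) := by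
  have h := contDiff_act_R hq hw
  simp only [psiD, act_skew_eq_cr]
  exact (contDiff_cr h (contDiff_act h)).add (contDiff_act (contDiff_act_R hq ha))

theorem contDiff_kinematics {q : F → ℍ[ℝ]} {w : F → V3} (hq : ContDiff ℝ 1 q)
    (hw : ContDiff ℝ 1 w) : ContDiff ℝ 1 fun x => kinematics (q x) (w x) := by
  have h : ContDiff ℝ 1 fun x => (-(inner ℝ (vec (q x)) (w x)), act (G (q x)) (w x)) :=
    ((contDiff_vec hq).inner ℝ hw).neg.prodMk (contDiff_act_G hq hw)
  exact contDiff_smul_left _ (ofPartsL.contDiff.comp h)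

end Smooth

namespace Data

variable {m : ℕ} {P : Data m}

/-- The exogenous signals entering the closed loop at one time: `ω_d`, its derivative, `q̃⁻¹`, `ω̃`,
the fault error `H`, the disturbance and its estimate. A plain product, so that the vector field is
a function on a finite-dimensional normed space. -/
abbrev Signals : Type := V3 × V3 × ℍ[ℝ] × V3 × (V3 →L[ℝ] V3) × V3 × V3

/-- The state space of the closed loop. -/
abbrev State : Type := ℍ[ℝ] × V3

/-- The signals at time `t`, frozen at their initial values for `t < 0`. -/
def signals (P : Data m) (t : ℝ) : Signals :=
  (P.wd (max t 0), P.wd' (max t 0), (P.qtil (max t 0))⁻¹, P.wtil (max t 0), toCLM (P.H (max t 0)),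
    P.taud (max t 0), P.taudhat (max t 0))

/-- `ŝ` as a function of the signals and the state. -/
def sHatFn (P : Data m) (z : Signals × State) : V3 :=
  P.omegaE z.2.1 z.2.2 + act (R z.2.1) z.1.1 + z.1.2.2.2.1
    - act (R (z.2.1 * z.1.2.2.1)) z.1.1 + P.k • vec (z.2.1 * z.1.2.2.1)

/-- The virtual torque as a function of the signals, the state, and the two nonsmooth quantities:
the truncation `σ` of `ŝ` at `ε`, and `ν = ‖q̂_e‖`. -/
def uFn (P : Data m) (y : (Signals × State) × V3 × ℝ) : V3 :=
  -(act P.K (P.sHatFn y.1)) + -(((P.a1 * (y.2.2 + P.gam) + P.a0) / P.eps) • y.2.1)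
    + psiD P.Jhat (y.1.2.1 * y.1.1.2.2.1) y.1.1.1 y.1.1.2.1
    - psi P.k P.Jhat (y.1.2.1 * y.1.1.2.2.1)
      (P.omegaE y.1.2.1 y.1.2.2 + act (R y.1.2.1) y.1.1.1 + y.1.1.2.2.2.1
        - act (R (y.1.2.1 * y.1.1.2.2.1)) y.1.1.1)
      (act (R (y.1.2.1 * y.1.1.2.2.1)) y.1.1.1)
    - y.1.1.2.2.2.2.2.2

/-- The closed-loop vector field in terms of the same data as `uFn`. -/
def fieldFn (P : Data m) (y : (Signals × State) × V3 × ℝ) : State :=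
  (kinematics y.1.2.1 (P.omegaE y.1.2.1 y.1.2.2),
    act P.J⁻¹
      (act (Xi P.J (P.omegaE y.1.2.1 y.1.2.2) (act (R y.1.2.1) y.1.1.1)) y.1.2.2
        + ((1 / 2 : ℝ) * P.k) •
          (cr (vec y.1.2.1) (act P.J y.1.2.2) + act P.J (cr (vec y.1.2.1) y.1.2.2))
        + psi P.k P.J y.1.2.1 (P.omegaE y.1.2.1 y.1.2.2) (act (R y.1.2.1) y.1.1.1)
        - psiD P.J y.1.2.1 y.1.1.1 y.1.1.2.1
        + (P.uFn y + y.1.1.2.2.2.2.1 (P.uFn y))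
        + y.1.1.2.2.2.2.2.1))

/-- The closed-loop vector field as a function of signals and state. -/
def field (P : Data m) (z : Signals × State) : State :=
  P.fieldFn (z, radial P.eps (P.sHatFn z), ‖vec (z.2.1 * z.1.2.2.1)‖)

theorem contDiff_omegaE {F : Type*} [NormedAddCommGroup F] [NormedSpace ℝ F] {q : F → ℍ[ℝ]}
    {s : F → V3} (hq : ContDiff ℝ 1 q) (hs : ContDiff ℝ 1 s) :
    ContDiff ℝ 1 fun x => P.omegaE (q x) (s x) :=
  hs.sub (contDiff_smul_left _ (contDiff_vec hq))

theorem contDiff_sHatFn : ContDiff ℝ 1 P.sHatFn := by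
  have h1 : ContDiff ℝ 1 fun z : Signals × State => z.2.1 := by fun_prop
  have h2 : ContDiff ℝ 1 fun z : Signals × State => z.2.2 := by fun_prop
  have h3 : ContDiff ℝ 1 fun z : Signals × State => z.1.1 := by fun_prop
  have h4 : ContDiff ℝ 1 fun z : Signals × State => z.1.2.2.2.1 := by fun_prop
  have h5 : ContDiff ℝ 1 fun z : Signals × State => z.2.1 * z.1.2.2.1 := by fun_prop
  exact ((((contDiff_omegaE h1 h2).add (contDiff_act_R h1 h3)).add h4).sub
    (contDiff_act_R h5 h3)).add (contDiff_smul_left _ (contDiff_vec h5))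

theorem contDiff_uFn : ContDiff ℝ 1 P.uFn := by
  have h1 : ContDiff ℝ 1 fun y : (Signals × State) × V3 × ℝ => y.1.2.1 := by fun_prop
  have h2 : ContDiff ℝ 1 fun y : (Signals × State) × V3 × ℝ => y.1.2.2 := by fun_prop
  have h3 : ContDiff ℝ 1 fun y : (Signals × State) × V3 × ℝ => y.1.1.1 := by fun_prop
  have h4 : ContDiff ℝ 1 fun y : (Signals × State) × V3 × ℝ => y.1.1.2.1 := by fun_prop
  have h5 : ContDiff ℝ 1 fun y : (Signals × State) × V3 × ℝ => y.1.2.1 * y.1.1.2.2.1 := by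
    fun_prop
  have h6 : ContDiff ℝ 1 fun y : (Signals × State) × V3 × ℝ => y.1.1.2.2.2.1 := by fun_prop
  have h7 : ContDiff ℝ 1 fun y : (Signals × State) × V3 × ℝ => y.1.1.2.2.2.2.2.2 := by fun_prop
  have h8 : ContDiff ℝ 1 fun y : (Signals × State) × V3 × ℝ => P.sHatFn y.1 :=
    contDiff_sHatFn.comp contDiff_fst
  have h9 : ContDiff ℝ 1 fun y : (Signals × State) × V3 × ℝ =>
      ((P.a1 * (y.2.2 + P.gam) + P.a0) / P.eps) • y.2.1 := by fun_prop
  exact ((((contDiff_act h8).neg.add h9.neg).add (contDiff_psiD h5 h3 h4)).sub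
    (contDiff_psi h5 ((((contDiff_omegaE h1 h2).add (contDiff_act_R h1 h3)).add h6).sub
      (contDiff_act_R h5 h3)) (contDiff_act_R h5 h3))).sub h7

theorem contDiff_fieldFn : ContDiff ℝ 1 P.fieldFn := by
  have h1 : ContDiff ℝ 1 fun y : (Signals × State) × V3 × ℝ => y.1.2.1 := by fun_prop
  have h2 : ContDiff ℝ 1 fun y : (Signals × State) × V3 × ℝ => y.1.2.2 := by fun_prop
  have h3 : ContDiff ℝ 1 fun y : (Signals × State) × V3 × ℝ => y.1.1.1 := by fun_prop
  have h4 : ContDiff ℝ 1 fun y : (Signals × State) × V3 × ℝ => y.1.1.2.1 := by fun_prop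
  have h5 : ContDiff ℝ 1 fun y : (Signals × State) × V3 × ℝ => y.1.1.2.2.2.2.1 := by fun_prop
  have h6 : ContDiff ℝ 1 fun y : (Signals × State) × V3 × ℝ => y.1.1.2.2.2.2.2.1 := by fun_prop
  have hw := contDiff_omegaE (P := P) h1 h2
  have hR := contDiff_act_R h1 h3
  have hv := contDiff_vec h1
  have hu := contDiff_uFn (P := P)
  have e1 := contDiff_act_Xi (J := P.J) hw hR h2
  have e2 := contDiff_smul_left ((1 / 2 : ℝ) * P.k)
    ((contDiff_cr hv (contDiff_act (A := P.J) h2)).add (contDiff_act (A := P.J) (contDiff_cr hv h2)))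
  have e3 := contDiff_psi (k := P.k) (J := P.J) h1 hw hR
  have e4 := contDiff_psiD (J := P.J) h1 h3 h4
  have e5 := hu.add (h5.clm_apply hu)
  have e6 := contDiff_act (A := P.J⁻¹) (((((e1.add e2).add e3).sub e4).add e5).add h6)
  exact (contDiff_kinematics h1 hw).prodMk e6

theorem locallyLipschitz_field (heps : 0 < P.eps) : LocallyLipschitz P.field := by
  have h1 : LocallyLipschitz fun z => radial P.eps (P.sHatFn z) :=
    (lipschitzWith_radial heps).locallyLipschitz.comp contDiff_sHatFn.locallyLipschitz
  have h2 : LocallyLipschitz fun z : Signals × State => ‖vec (z.2.1 * z.1.2.2.1)‖ := by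
    have h5 : ContDiff ℝ 1 fun z : Signals × State => z.2.1 * z.1.2.2.1 := by fun_prop
    exact lipschitzWith_one_norm.locallyLipschitz.comp (contDiff_vec h5).locallyLipschitz
  exact contDiff_fieldFn.locallyLipschitz.comp (LocallyLipschitz.id.prodMk (h1.prodMk h2))

/-- The vector field `field`, evaluated at the signals, is the closed loop. -/
theorem field_signals (hP : P.Standing) (heps : 0 < P.eps) {t : ℝ} (ht : 0 ≤ t) (q : ℍ[ℝ])
    (s : V3) : P.field (P.signals t, (q, s))
      = (kinematics q (P.omegaE q s), act P.J⁻¹ (P.slidingRhs t q s)) := by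
  have hq : q * (P.qtil t)⁻¹ = P.qeHat t q := (qeHat_eq hP ht q).symm
  have hs : P.sHatFn (P.signals t, (q, s)) = P.sHat t q s := by
    simp only [sHatFn, signals, max_eq_left ht, hq]
    rfl
  have hu : P.uFn ((P.signals t, (q, s)), radial P.eps (P.sHat t q s), ‖vec (P.qeHat t q)‖)
      = P.u t q s := by
    unfold uFn u
    rw [hs, uS_eq]
    simp only [signals, max_eq_left ht, hq]
    rw [radial, smul_smul]
    have e : (P.a1 * (‖vec (P.qeHat t q)‖ + P.gam) + P.a0) / P.eps
        * (P.eps / max P.eps ‖P.sHat t q s‖)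
        = (P.a1 * (‖vec (P.qeHat t q)‖ + P.gam) + P.a0) / max P.eps ‖P.sHat t q s‖ := by
      field_simp
    rw [e]
    rfl
  have hq' : q * (P.signals t).2.2.1 = P.qeHat t q := by
    simp only [signals, max_eq_left ht, hq]
  unfold field
  rw [hs]
  simp only [hq']
  unfold fieldFn
  rw [hu]
  simp only [signals, max_eq_left ht]
  unfold slidingRhs
  rw [act_E_tauU hP ht, act_add (skew (vec q) * P.J), act_mul, act_mul]
  rfl

theorem exists_norm_signals_le (hP : P.Standing) : ∃ r : ℝ, ∀ t, ‖P.signals t‖ ≤ r := by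
  obtain ⟨B, hB⟩ := hP.wtil_bdd
  refine ⟨P.rhov + P.rhoa + 1 + |B| + P.rhoE + (P.rhodhat + P.rhod) + P.rhodhat, fun t => ?_⟩
  have ht : 0 ≤ max t 0 := le_max_right _ _
  have h1 := hP.wd_le _ ht
  have h2 := hP.wd'_le _ ht
  have h3 : ‖(P.qtil (max t 0))⁻¹‖ ≤ 1 := by rw [norm_inv, hP.qtil_unit _ ht, inv_one]
  have h4 := (hB _ ht).trans (le_abs_self B)
  have h5 : ‖toCLM (P.H (max t 0))‖ ≤ P.rhoE := hP.H_le _ ht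
  have h7 := hP.taudhat_le _ ht
  have h6 : ‖P.taud (max t 0)‖ ≤ P.rhodhat + P.rhod := by
    have h8 := hP.taud_err _ ht
    have h9 := norm_sub_norm_le (P.taud (max t 0)) (P.taudhat (max t 0))
    rw [norm_sub_rev] at h9
    linarith
  have := hP.rhov_nonneg
  have := hP.rhoa_nonneg
  have := hP.rhoE_nonneg
  have := hP.rhodhat_nonneg
  have := hP.rhod_nonneg
  have := abs_nonneg B
  unfold signals
  simp only [norm_prod_le_iff]
  refine ⟨?_, ?_, ?_, ?_, ?_, ?_, ?_⟩ <;> linarith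

/-- The nonsingular inverse is not continuous, but it is a measurable function of the matrix. -/
theorem stronglyMeasurable_matrix_inv {M : ℝ → M3} (hM : StronglyMeasurable M) :
    StronglyMeasurable fun t => (M t)⁻¹ := by
  simp only [Matrix.inv_def, Ring.inverse_eq_inv']
  have hdet : Continuous fun X : M3 => X.det := by fun_prop
  have hadj : Continuous fun X : M3 => X.adjugate := by fun_prop
  exact ((hdet.comp_stronglyMeasurable hM).measurable.inv.stronglyMeasurable).smul
    (hadj.comp_stronglyMeasurable hM)

theorem stronglyMeasurable_H (hP : P.Standing) : StronglyMeasurable fun t => toCLM (P.H t) := by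
  have hdiag : Continuous fun v : Fin m → ℝ => Matrix.diagonal v := by fun_prop
  have hE : StronglyMeasurable fun t => Matrix.diagonal (P.e t) :=
    hdiag.comp_stronglyMeasurable hP.e_meas.stronglyMeasurable
  have hEh : StronglyMeasurable fun t => Matrix.diagonal (P.ehat t) :=
    hdiag.comp_stronglyMeasurable hP.ehat_meas.stronglyMeasurable
  have hcube : Continuous fun X : Matrix (Fin m) (Fin m) ℝ => P.D * X ^ 3 * P.D.transpose := by
    fun_prop
  have hMinv := stronglyMeasurable_matrix_inv (hcube.comp_stronglyMeasurable hEh)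
  have hcont : Continuous fun X : (Matrix (Fin m) (Fin m) ℝ × Matrix (Fin m) (Fin m) ℝ) × M3 =>
      P.D * (X.1.1 - X.1.2) * X.1.2 ^ 2 * P.D.transpose * X.2 := by fun_prop
  have hH := hcont.comp_stronglyMeasurable ((hE.prodMk hEh).prodMk hMinv)
  have hlin : Continuous fun X : M3 => toCLM X :=
    LinearMap.continuous_of_finiteDimensional
      ((Matrix.toEuclideanCLM (n := Fin 3) (𝕜 := ℝ)).toAlgEquiv.toLinearMap)
  exact hlin.comp_stronglyMeasurable hH

theorem stronglyMeasurable_signals (hP : P.Standing) : StronglyMeasurable P.signals := by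
  have hmax : Continuous fun t : ℝ => max t 0 := by fun_prop
  have hext : ∀ {Y : Type} [TopologicalSpace Y] {f : ℝ → Y}, ContinuousOn f (Ici 0) →
      Continuous fun t => f (max t 0) := fun hf =>
    hf.comp_continuous hmax fun t => le_max_right t 0
  have h1 : ContinuousOn P.wd (Ici 0) := fun t ht => (hP.wd_deriv t ht).continuousWithinAt
  have h3 : ContinuousOn (fun t => (P.qtil t)⁻¹) (Ici 0) := hP.qtil_cont.inv₀ fun t ht => by
    rw [← norm_ne_zero_iff, hP.qtil_unit t ht]; exact one_ne_zero
  refine (hext h1).stronglyMeasurable.prodMk ((hext hP.wd'_cont).stronglyMeasurable.prodMk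
    ((hext h3).stronglyMeasurable.prodMk ((hext hP.wtil_cont).stronglyMeasurable.prodMk
    (((stronglyMeasurable_H hP).comp_measurable hmax.measurable).prodMk ?_))))
  exact (hP.taud_meas.comp hmax.measurable).stronglyMeasurable.prodMk
    (hP.taudhat_meas.comp hmax.measurable).stronglyMeasurable

/-! ### The truncated closed loop -/

/-- The closed-loop vector field with `q_e` retracted to the unit ball and `s` to the ball of radius
`N`. It is bounded and globally Lipschitz, and it agrees with the closed loop where `‖q_e‖ = 1` and
`‖s‖ ≤ N`. -/
def truncated (P : Data m) (N t : ℝ) (x : State) : State :=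
  P.field (P.signals t, (radial 1 x.1, radial N x.2))

theorem exists_lipschitz_bound_truncated (hP : P.Standing) (heps : 0 < P.eps) {N : ℝ}
    (hN : 0 < N) : ∃ L M : NNReal, (∀ t, LipschitzWith L (P.truncated N t)) ∧
      ∀ t x, ‖P.truncated N t x‖ ≤ M := by
  obtain ⟨r, hr⟩ := exists_norm_signals_le hP
  set S : Set (Signals × State) := Metric.closedBall 0 r ×ˢ
    (Metric.closedBall (0 : ℍ[ℝ]) 1 ×ˢ Metric.closedBall (0 : V3) N) with hS
  have : ProperSpace Signals := FiniteDimensional.proper ℝ Signals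
  have hSc : IsCompact S := (isCompact_closedBall _ _).prod
    ((isCompact_closedBall _ _).prod (isCompact_closedBall _ _))
  have hmem : ∀ t (x : State), (P.signals t, (radial 1 x.1, radial N x.2)) ∈ S := fun t x => by
    simp only [hS, mem_prod, mem_closedBall_zero_iff]
    exact ⟨hr t, norm_radial_le one_pos _, norm_radial_le hN _⟩
  have hl := locallyLipschitz_field (P := P) heps
  obtain ⟨C, hC⟩ := hl.locallyLipschitzOn.exists_lipschitzOnWith_of_compact hSc
  obtain ⟨M, hM⟩ := hSc.exists_bound_of_continuousOn hl.continuous.continuousOn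
  refine ⟨C * 2, M.toNNReal, fun t => ?_, fun t x =>
    (hM _ (hmem t x)).trans (Real.le_coe_toNNReal M)⟩
  refine LipschitzWith.of_dist_le_mul fun x y => ?_
  refine (hC.dist_le_mul _ (hmem t x) _ (hmem t y)).trans ?_
  rw [NNReal.coe_mul, mul_assoc]
  refine mul_le_mul_of_nonneg_left ?_ C.2
  rw [Prod.dist_eq, dist_self, Prod.dist_eq, Prod.dist_eq]
  have h1 := (lipschitzWith_radial (E := ℍ[ℝ]) one_pos).dist_le_mul x.1 y.1
  have h2 := (lipschitzWith_radial (E := V3) hN).dist_le_mul x.2 y.2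
  refine max_le (by positivity) (max_le (h1.trans ?_) (h2.trans ?_))
  · exact mul_le_mul_of_nonneg_left (le_max_left _ _) (by norm_num)
  · exact mul_le_mul_of_nonneg_left (le_max_right _ _) (by norm_num)

theorem truncated_eq (hP : P.Standing) (heps : 0 < P.eps) {N t : ℝ} (hN : 0 < N) (ht : 0 ≤ t)
    {q : ℍ[ℝ]} (hq : ‖q‖ = 1) {s : V3} (hs : ‖s‖ ≤ N) : P.truncated N t (q, s)
      = (kinematics q (P.omegaE q s), act P.J⁻¹ (P.slidingRhs t q s)) := by
  rw [truncated, radial_eq_self one_pos hq.le, radial_eq_self hN hs, field_signals hP heps ht]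

theorem aestronglyMeasurable_truncated (hP : P.Standing) (heps : 0 < P.eps) {N : ℝ} (hN : 0 < N)
    {x : ℝ → State} (hx : Continuous x) :
    AEStronglyMeasurable (fun t => P.truncated N t (x t)) volume := by
  have h1 : Continuous fun t => (radial 1 (x t).1, radial N (x t).2) :=
    ((lipschitzWith_radial one_pos).continuous.comp (continuous_fst.comp hx)).prodMk
      ((lipschitzWith_radial hN).continuous.comp (continuous_snd.comp hx))
  exact ((locallyLipschitz_field heps).continuous.comp_stronglyMeasurable
    ((stronglyMeasurable_signals hP).prodMk h1.stronglyMeasurable)).aestronglyMeasurable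

end Data
end AttitudeTracking

namespace AttitudeTracking
namespace Data

variable {m : ℕ} {P : Data m}

/-! ### Existence and uniqueness of solutions -/

theorem isUnit_det_J (hP : P.Standing) : IsUnit P.J.det :=
  isUnit_det_of_lamMin_pos hP.J_symm (hP.lamL_pos.trans_le hP.lamL_le)

theorem act_J_act_inv (hP : P.Standing) (x : V3) : act P.J (act P.J⁻¹ x) = x := by
  rw [← act_mul, Matrix.mul_nonsing_inv _ (isUnit_det_J hP), act_one]

theorem act_inv_act_J (hP : P.Standing) (x : V3) : act P.J⁻¹ (act P.J x) = x := by
  rw [← act_mul, Matrix.nonsing_inv_mul _ (isUnit_det_J hP), act_one]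

theorem lamL_mul_le_inner_J (hP : P.Standing) (s : V3) :
    P.lamL * ‖s‖ ^ 2 ≤ inner ℝ s (act P.J s) :=
  (mul_le_mul_of_nonneg_right hP.lamL_le (sq_nonneg _)).trans (lamMin_mul_norm_sq_le hP.J_symm s)

theorem inner_J_le_lamR_mul (hP : P.Standing) (s : V3) :
    inner ℝ s (act P.J s) ≤ P.lamR * ‖s‖ ^ 2 :=
  (inner_act_le_lamMax hP.J_symm s).trans (mul_le_mul_of_nonneg_right hP.le_lamR (sq_nonneg _))

theorem hasDerivAt_inner_J (hP : P.Standing) {s : ℝ → V3} {s' : V3} {t : ℝ}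
    (hs : HasDerivAt s s' t) :
    HasDerivAt (fun t => inner ℝ (s t) (act P.J (s t))) (2 * inner ℝ (s t) (act P.J s')) t := by
  have h1 : HasDerivAt (fun t => act P.J (s t)) (act P.J s') t :=
    (toCLM P.J).hasFDerivAt.comp_hasDerivAt t hs
  have h2 := hs.inner ℝ h1
  have h3 : inner ℝ s' (act P.J (s t)) = inner ℝ (s t) (act P.J s') := by
    rw [← inner_act_comm hP.J_symm, real_inner_comm]
  rw [h3, ← two_mul] at h2
  exact h2

theorem absolutelyContinuousOnInterval_inner_J {s : ℝ → V3} {a b : ℝ}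
    (hs : AbsolutelyContinuousOnInterval s a b) :
    AbsolutelyContinuousOnInterval (fun t => inner ℝ (s t) (act P.J (s t))) a b := by
  have h : ContDiff ℝ 1 fun x : V3 => inner ℝ x (act P.J x) :=
    contDiff_id.inner ℝ (contDiff_act contDiff_id)
  exact AbsolutelyContinuousOnInterval.locallyLipschitz_comp
    (g := fun x : V3 => inner ℝ x (act P.J x)) h.locallyLipschitz hs

theorem IsSolutionOn.mono {T T' : EReal} {qe : ℝ → ℍ[ℝ]} {s : ℝ → V3}
    (h : P.IsSolutionOn T qe s) (hT : T' ≤ T) : P.IsSolutionOn T' qe s where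
  unit t h0 h1 := h.unit t h0 (h1.trans_le hT)
  qe_ac b h0 h1 := h.qe_ac b h0 (h1.trans_le hT)
  s_ac b h0 h1 := h.s_ac b h0 (h1.trans_le hT)
  ode := h.ode.mono fun _ ht h0 h1 => ht h0 (h1.trans_le hT)

/-- The retraction onto the unit ball keeps the kinematics tangent to the spheres. -/
theorem inner_kinematics_radial (q : ℍ[ℝ]) (w : V3) : inner ℝ q (kinematics (radial 1 q) w) = 0 := by
  have hm : (0 : ℝ) < max 1 ‖q‖ := lt_max_of_lt_left one_pos
  have h := inner_kinematics (radial 1 q) w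
  nth_rewrite 1 [radial] at h
  rw [inner_smul_left] at h
  rcases mul_eq_zero.mp h with h | h
  · simp only [one_div, map_inv₀, inv_eq_zero] at h
    exact absurd h hm.ne'
  · exact h

/-- The retraction in `s` keeps the power of the gyroscopic terms equal to zero. -/
theorem inner_slidingRhs_radial (hP : P.Standing) {N : ℝ} (hN : 0 < N) (t : ℝ) (q : ℍ[ℝ]) (s : V3) :
    inner ℝ s (P.slidingRhs t q (radial N s)) = inner ℝ s (P.forcing t q (radial N s)) := by
  have hm : (0 : ℝ) < max N ‖s‖ := lt_max_of_lt_left hN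
  have h := inner_slidingRhs hP t q (radial N s)
  nth_rewrite 1 3 [radial] at h
  rw [inner_smul_left, inner_smul_left] at h
  refine mul_left_cancel₀ ?_ h
  simpa using ⟨hN.ne', hm.ne'⟩

section WellPosed

variable (hP : P.Standing) (hk : 0 < P.k) (hgam : 0 < P.gam) (heps : P.rhos < P.eps)
  (hK : P.K.PosDef)
include hP hk heps

include hgam hK in
/-- Existence on `[0, T)`. On `[0, T]` the solutions of the truncated equation stay in a ball whose
radius does not depend on the truncation radius `N`, so with `N` taken to be that radius the
truncated solution solves the closed loop. -/
theorem exists_solution_bounded (q₀ : ℍ[ℝ]) (s₀ : V3) (hq₀ : ‖q₀‖ = 1) (T : ℝ) :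
    ∃ (qe : ℝ → ℍ[ℝ]) (s : ℝ → V3), P.IsSolutionOn (T : EReal) qe s ∧ qe 0 = q₀ ∧ s 0 = s₀ := by
  have heps0 := eps_pos hP hk heps
  obtain ⟨C, hC0, hC⟩ := exists_norm_forcing_le hP hk hgam heps hK
  have hlam := hP.lamL_pos
  set C' := 2 * C * (1 + 2 / P.lamL) with hC'
  have hC'0 : 0 ≤ C' := by positivity
  set W₀ := inner ℝ s₀ (act P.J s₀) + 1 with hW₀
  have hW₀0 : 0 ≤ W₀ := by
    have h1 := lamL_mul_le_inner_J hP s₀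
    have : 0 ≤ P.lamL * ‖s₀‖ ^ 2 := by positivity
    linarith
  set N := 1 + W₀ * Real.exp (C' * |T|) / P.lamL with hN
  have hN1 : 1 ≤ N := by
    have : 0 ≤ W₀ * Real.exp (C' * |T|) / P.lamL := by positivity
    linarith
  have hN0 : 0 < N := one_pos.trans_le hN1
  obtain ⟨L, M, hL, hM⟩ := exists_lipschitz_bound_truncated hP heps0 hN0
  obtain ⟨x, hx0, hxl, hxd⟩ := exists_caratheodory_solution hL hM
    (fun x hx => aestronglyMeasurable_truncated hP heps0 hN0 hx) (q₀, s₀)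
  have hql : LipschitzWith (1 * M) fun t => (x t).1 := LipschitzWith.prod_fst.comp hxl
  have hsl : LipschitzWith (1 * M) fun t => (x t).2 := LipschitzWith.prod_snd.comp hxl
  have hqac : ∀ a b, AbsolutelyContinuousOnInterval (fun t => (x t).1) a b := fun a b =>
    (hql.lipschitzOnWith).absolutelyContinuousOnInterval
  have hsac : ∀ a b, AbsolutelyContinuousOnInterval (fun t => (x t).2) a b := fun a b =>
    (hsl.lipschitzOnWith).absolutelyContinuousOnInterval
  have hqd : ∀ᵐ t, 0 < t → HasDerivAt (fun t => (x t).1) (P.truncated N t (x t)).1 t := by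
    filter_upwards [hxd] with t ht h0
    exact (ContinuousLinearMap.fst ℝ ℍ[ℝ] V3).hasFDerivAt.comp_hasDerivAt t (ht h0)
  have hsd : ∀ᵐ t, 0 < t → HasDerivAt (fun t => (x t).2) (P.truncated N t (x t)).2 t := by
    filter_upwards [hxd] with t ht h0
    exact (ContinuousLinearMap.snd ℝ ℍ[ℝ] V3).hasFDerivAt.comp_hasDerivAt t (ht h0)
  -- the quaternion stays on the unit sphere
  have hunit : ∀ t, 0 ≤ t → ‖(x t).1‖ = 1 := fun b hb => by
    have hnac : AbsolutelyContinuousOnInterval (fun t => ‖(x t).1‖ ^ 2) 0 b :=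
      (hqac 0 b).norm_sq
    have hd : ∀ᵐ t, 0 < t → t < b → HasDerivAt (fun t => ‖(x t).1‖ ^ 2) 0 t := by
      filter_upwards [hqd] with t ht h0 _
      have h1 := (ht h0).norm_sq
      have h2 : inner ℝ (x t).1 (P.truncated N t (x t)).1 = 0 := by
        unfold truncated
        rw [field_signals hP heps0 h0.le]
        exact inner_kinematics_radial _ _
      rwa [h2, mul_zero] at h1
    have h1 := hnac.mul_le_sub_of_ae_hasDerivAt (μ := 0) hb
      (hd.mono fun t ht h0 h1 => ⟨0, ht h0 h1, le_rfl⟩)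
    have h2 := hnac.fun_neg.mul_le_sub_of_ae_hasDerivAt (μ := 0) hb
      (hd.mono fun t ht h0 h1 => ⟨-0, (ht h0 h1).neg, by simp⟩)
    rw [hx0, hq₀] at h1 h2
    have h3 : ‖(x b).1‖ ^ 2 = 1 := by linarith
    exact (pow_eq_one_iff_of_nonneg (norm_nonneg _) two_ne_zero).mp h3
  have htr : ∀ t, 0 ≤ t → P.truncated N t (x t) = (kinematics (x t).1
      (P.omegaE (x t).1 (radial N (x t).2)),
      act P.J⁻¹ (P.slidingRhs t (x t).1 (radial N (x t).2))) := fun t ht => by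
    rw [truncated, radial_eq_self one_pos (hunit t ht).le, field_signals hP heps0 ht]
  -- growth of the energy `sᵀ J s`; adding `1` absorbs the constant term of its growth rate
  have hbound : ∀ b, 0 ≤ b → b < T → ‖(x b).2‖ ≤ N := fun b hb hbT => by
    have hac : AbsolutelyContinuousOnInterval
        (fun t => inner ℝ (x t).2 (act P.J (x t).2) + 1) 0 b :=
      (absolutelyContinuousOnInterval_inner_J (hsac 0 b)).fun_add
        (LipschitzWith.const (1 : ℝ)).lipschitzOnWith.absolutelyContinuousOnInterval
    have hg := hac.le_mul_exp_of_ae_hasDerivAt (C := C') hb (by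
      filter_upwards [hsd] with t ht h0 _
      refine ⟨_, (hasDerivAt_inner_J hP (ht h0)).add_const 1, ?_⟩
      rw [htr t h0.le, act_J_act_inv hP, inner_slidingRhs_radial hP hN0]
      have h1 : inner ℝ (x t).2 (P.forcing t (x t).1 (radial N (x t).2))
          ≤ ‖(x t).2‖ * (C * (1 + ‖(x t).2‖)) := by
        refine (real_inner_le_norm _ _).trans (mul_le_mul_of_nonneg_left
          ((hC t h0.le _ (hunit t h0.le) _).trans ?_) (norm_nonneg _))
        have h2 : ‖radial N (x t).2‖ ≤ ‖(x t).2‖ := by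
          have hm : 0 < max N ‖(x t).2‖ := lt_max_of_lt_left hN0
          rw [radial, norm_smul, Real.norm_of_nonneg (by positivity)]
          exact mul_le_of_le_one_left (norm_nonneg _) ((div_le_one hm).mpr (le_max_left _ _))
        gcongr
      have h3 := lamL_mul_le_inner_J hP (x t).2
      have h4 : ‖(x t).2‖ ^ 2 ≤ inner ℝ (x t).2 (act P.J (x t).2) / P.lamL := by
        rw [le_div_iff₀ hlam]; linarith
      have h5 : 0 ≤ inner ℝ (x t).2 (act P.J (x t).2) := le_trans (by positivity) h3
      calc 2 * inner ℝ (x t).2 (P.forcing t (x t).1 (radial N (x t).2))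
          ≤ 2 * (‖(x t).2‖ * (C * (1 + ‖(x t).2‖))) := by linarith
        _ = 2 * C * (‖(x t).2‖ + ‖(x t).2‖ ^ 2) := by ring
        _ ≤ 2 * C * (1 + 2 * ‖(x t).2‖ ^ 2) := by
            refine mul_le_mul_of_nonneg_left ?_ (by positivity)
            nlinarith [sq_nonneg (‖(x t).2‖ - 1)]
        _ ≤ 2 * C * (1 + 2 * (inner ℝ (x t).2 (act P.J (x t).2) / P.lamL)) := by gcongr
        _ ≤ 2 * C * ((1 + 2 / P.lamL) * (inner ℝ (x t).2 (act P.J (x t).2) + 1)) := by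
            have h6 : 0 ≤ 2 / P.lamL := by positivity
            refine mul_le_mul_of_nonneg_left ?_ (by positivity)
            have : 2 * (inner ℝ (x t).2 (act P.J (x t).2) / P.lamL)
              = 2 / P.lamL * inner ℝ (x t).2 (act P.J (x t).2) := by ring
            rw [this]; linarith
        _ = _ := by rw [hC']; ring)
    rw [hx0, sub_zero] at hg
    have h1 := lamL_mul_le_inner_J hP (x b).2
    have h2 : Real.exp (C' * b) ≤ Real.exp (C' * |T|) := by
      refine Real.exp_le_exp.mpr (mul_le_mul_of_nonneg_left (hbT.le.trans (le_abs_self T)) hC'0)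
    have h3 := mul_le_mul_of_nonneg_left h2 hW₀0
    have h4 : ‖(x b).2‖ ^ 2 ≤ W₀ * Real.exp (C' * |T|) / P.lamL := by
      rw [le_div_iff₀ hlam]
      change _ ≤ W₀ * _ at hg
      linarith
    have h5 : ‖(x b).2‖ ^ 2 ≤ N ^ 2 := by nlinarith
    exact le_of_sq_le_sq h5 hN0.le
  refine ⟨fun t => (x t).1, fun t => (x t).2, ⟨fun t h0 _ => hunit t h0, fun b _ _ => hqac 0 b,
    fun b _ _ => hsac 0 b, ?_⟩, by simp [hx0], by simp [hx0]⟩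
  filter_upwards [hqd, hsd] with t hq hs h0 hT
  have hs' := hbound t h0.le (EReal.coe_lt_coe_iff.mp hT)
  have h1 := htr t h0.le
  rw [radial_eq_self hN0 hs'] at h1
  have h2 := hq h0
  have h3 := hs h0
  rw [h1] at h2 h3
  exact ⟨h2, _, h3, act_J_act_inv hP _⟩

/-- Uniqueness, by Grönwall's inequality for the squared distance of two solutions. -/
theorem IsSolutionOn.eq_of_initial {T : EReal} {q₁ q₂ : ℝ → ℍ[ℝ]} {s₁ s₂ : ℝ → V3}
    (h₁ : P.IsSolutionOn T q₁ s₁) (h₂ : P.IsSolutionOn T q₂ s₂) (hq : q₁ 0 = q₂ 0)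
    (hs : s₁ 0 = s₂ 0) {b : ℝ} (hb : 0 ≤ b) (hbT : (b : EReal) < T) :
    q₁ b = q₂ b ∧ s₁ b = s₂ b := by
  have heps0 := eps_pos hP hk heps
  obtain ⟨N₁, hN₁⟩ := (h₁.s_ac b hb hbT).exists_bound
  obtain ⟨N₂, hN₂⟩ := (h₂.s_ac b hb hbT).exists_bound
  rw [uIcc_of_le hb] at hN₁ hN₂
  set N := 1 + |N₁| + |N₂| with hN
  have hN0 : 0 < N := by positivity
  obtain ⟨L, _, hL, -⟩ := exists_lipschitz_bound_truncated hP heps0 hN0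
  have hqac := (h₁.qe_ac b hb hbT).fun_sub (h₂.qe_ac b hb hbT)
  have hsac := (h₁.s_ac b hb hbT).fun_sub (h₂.s_ac b hb hbT)
  have hac : AbsolutelyContinuousOnInterval
      (fun t => ‖q₁ t - q₂ t‖ ^ 2 + ‖s₁ t - s₂ t‖ ^ 2) 0 b :=
    hqac.norm_sq.fun_add hsac.norm_sq
  have hg := hac.le_mul_exp_of_ae_hasDerivAt (C := 4 * L) hb (by
    filter_upwards [h₁.ode, h₂.ode] with t ht₁ ht₂ h0 htb
    have htT : (t : EReal) < T := (EReal.coe_lt_coe_iff.mpr htb).trans hbT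
    obtain ⟨dq₁, s₁', ds₁, e₁⟩ := ht₁ h0 htT
    obtain ⟨dq₂, s₂', ds₂, e₂⟩ := ht₂ h0 htT
    refine ⟨_, (dq₁.fun_sub dq₂).norm_sq.fun_add (ds₁.fun_sub ds₂).norm_sq, ?_⟩
    have hb₁ : ‖s₁ t‖ ≤ N := by
      have := hN₁ t ⟨h0.le, htb.le⟩
      have := le_abs_self N₁
      have := abs_nonneg N₂
      linarith
    have hb₂ : ‖s₂ t‖ ≤ N := by
      have := hN₂ t ⟨h0.le, htb.le⟩
      have := le_abs_self N₂
      have := abs_nonneg N₁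
      linarith
    have f₁ := truncated_eq hP heps0 hN0 h0.le (h₁.unit t h0.le htT) hb₁
    have f₂ := truncated_eq hP heps0 hN0 h0.le (h₂.unit t h0.le htT) hb₂
    rw [← e₁, act_inv_act_J hP] at f₁
    rw [← e₂, act_inv_act_J hP] at f₂
    have hl := (hL t).dist_le_mul (q₁ t, s₁ t) (q₂ t, s₂ t)
    rw [f₁, f₂, Prod.dist_eq, Prod.dist_eq] at hl
    simp only [dist_eq_norm] at hl
    set dq := q₁ t - q₂ t
    set ds := s₁ t - s₂ t
    have g₁ := (le_max_left _ _).trans hl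
    have g₂ := (le_max_right _ _).trans hl
    have i₁ := (real_inner_le_norm dq _).trans (mul_le_mul_of_nonneg_left g₁ (norm_nonneg dq))
    have i₂ := (real_inner_le_norm ds _).trans (mul_le_mul_of_nonneg_left g₂ (norm_nonneg ds))
    have hmax : max ‖dq‖ ‖ds‖ ≤ ‖dq‖ + ‖ds‖ :=
      max_le (by linarith [norm_nonneg ds]) (by linarith [norm_nonneg dq])
    have hLm : (L : ℝ) * max ‖dq‖ ‖ds‖ ≤ L * (‖dq‖ + ‖ds‖) :=
      mul_le_mul_of_nonneg_left hmax L.2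
    have j₁ := mul_le_mul_of_nonneg_left hLm (norm_nonneg dq)
    have j₂ := mul_le_mul_of_nonneg_left hLm (norm_nonneg ds)
    have hsq : 0 ≤ (L : ℝ) * (‖dq‖ - ‖ds‖) ^ 2 := mul_nonneg L.2 (sq_nonneg _)
    linarith)
  rw [hq, hs, sub_self, sub_self] at hg
  simp only [norm_zero, ne_eq, OfNat.ofNat_ne_zero, not_false_eq_true, zero_pow, add_zero,
    zero_mul] at hg
  have h1 := sq_nonneg ‖q₁ b - q₂ b‖
  have h2 := sq_nonneg ‖s₁ b - s₂ b‖
  constructor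
  · exact sub_eq_zero.mp (norm_eq_zero.mp (pow_eq_zero_iff two_ne_zero |>.mp (by linarith)))
  · exact sub_eq_zero.mp (norm_eq_zero.mp (pow_eq_zero_iff two_ne_zero |>.mp (by linarith)))

include hgam hK in
/-- Global existence, by gluing the solutions on `[0, n + 1)`: at time `t` the solution with
`n = ⌊t⌋` is used. -/
theorem exists_global_solution (q₀ : ℍ[ℝ]) (s₀ : V3) (hq₀ : ‖q₀‖ = 1) :
    ∃ (qe : ℝ → ℍ[ℝ]) (s : ℝ → V3), P.IsSolutionOn ⊤ qe s ∧ qe 0 = q₀ ∧ s 0 = s₀ := by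
  choose q s hsol hq hs using fun n : ℕ =>
    exists_solution_bounded hP hk hgam heps hK q₀ s₀ hq₀ ((n : ℝ) + 1)
  have hcons : ∀ (n : ℕ) (t : ℝ), 0 ≤ t → t < n + 1 → q ⌊t⌋₊ t = q n t ∧ s ⌊t⌋₊ t = s n t :=
    fun n t h0 hn => by
      have h1 : ((⌊t⌋₊ : ℕ) : ℝ) + 1 ≤ (n : ℝ) + 1 := by
        have : ⌊t⌋₊ ≤ n := Nat.lt_succ_iff.mp ((Nat.floor_lt h0).mpr (by push_cast; exact hn))
        exact_mod_cast Nat.succ_le_succ this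
      refine IsSolutionOn.eq_of_initial hP hk heps (hsol _)
        ((hsol n).mono (EReal.coe_le_coe_iff.mpr h1)) (by rw [hq, hq]) (by rw [hs, hs]) h0 ?_
      exact EReal.coe_lt_coe_iff.mpr (Nat.lt_floor_add_one t)
  refine ⟨fun t => q ⌊t⌋₊ t, fun t => s ⌊t⌋₊ t, ⟨fun t h0 _ => ?_, fun b h0 _ => ?_,
    fun b h0 _ => ?_, ?_⟩, by simp [hq], by simp [hs]⟩
  · exact (hsol _).unit t h0 (EReal.coe_lt_coe_iff.mpr (Nat.lt_floor_add_one t))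
  · refine ((hsol ⌊b⌋₊).qe_ac b h0
      (EReal.coe_lt_coe_iff.mpr (Nat.lt_floor_add_one b))).congr_of_eqOn fun t ht => ?_
    rw [uIcc_of_le h0] at ht
    exact (hcons _ t ht.1 (ht.2.trans_lt (Nat.lt_floor_add_one b))).1.symm
  · refine ((hsol ⌊b⌋₊).s_ac b h0
      (EReal.coe_lt_coe_iff.mpr (Nat.lt_floor_add_one b))).congr_of_eqOn fun t ht => ?_
    rw [uIcc_of_le h0] at ht
    exact (hcons _ t ht.1 (ht.2.trans_lt (Nat.lt_floor_add_one b))).2.symm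
  · filter_upwards [ae_all_iff.mpr fun n => (hsol n).ode] with t ht h0 _
    obtain ⟨dq, s', ds, e⟩ := ht ⌊t⌋₊ h0 (EReal.coe_lt_coe_iff.mpr (Nat.lt_floor_add_one t))
    have hnear : ∀ᶠ r in 𝓝 t, q ⌊r⌋₊ r = q ⌊t⌋₊ r ∧ s ⌊r⌋₊ r = s ⌊t⌋₊ r := by
      filter_upwards [Ioo_mem_nhds h0 (Nat.lt_floor_add_one t)] with r hr
      exact hcons _ r hr.1.le hr.2
    exact ⟨dq.congr_of_eventuallyEq (hnear.mono fun r hr => hr.1), s',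
      ds.congr_of_eventuallyEq (hnear.mono fun r hr => hr.2), e⟩

include hgam hK in
theorem IsSolutionOn.exists_extension {T : ℝ} (hT : 0 < T) {qe : ℝ → ℍ[ℝ]} {s : ℝ → V3}
    (h : P.IsSolutionOn (T : EReal) qe s) : ∃ (qe' : ℝ → ℍ[ℝ]) (s' : ℝ → V3),
      P.IsSolutionOn ⊤ qe' s' ∧ ∀ t ∈ Ico 0 T, qe' t = qe t ∧ s' t = s t := by
  obtain ⟨qe', s', h', hq, hs⟩ := exists_global_solution hP hk hgam heps hK (qe 0) (s 0)
    (h.unit 0 le_rfl (EReal.coe_lt_coe_iff.mpr hT))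
  exact ⟨qe', s', h', fun t ht => IsSolutionOn.eq_of_initial hP hk heps (h'.mono le_top) h hq hs
    ht.1 (EReal.coe_lt_coe_iff.mpr ht.2)⟩

end WellPosed
end Data
end AttitudeTracking

/-! ### Upper limits of real functions in `EReal` -/

theorem limsup_coe_le_iff {f : ℝ → ℝ} {a : ℝ} :
    limsup (fun t => ((f t : ℝ) : EReal)) atTop ≤ (a : EReal)
      ↔ ∀ ε : ℝ, 0 < ε → ∀ᶠ t in atTop, f t ≤ a + ε := by
  constructor
  · intro h ε hε
    have : ∀ᶠ t in atTop, ((f t : ℝ) : EReal) < ((a + ε : ℝ) : EReal) :=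
      eventually_lt_of_limsup_lt (h.trans_lt (EReal.coe_lt_coe_iff.mpr (by linarith)))
    exact this.mono fun t ht => (EReal.coe_lt_coe_iff.mp ht).le
  · intro h
    refine EReal.le_of_forall_lt_iff_le.mp fun z hz => ?_
    have hz' := EReal.coe_lt_coe_iff.mp hz
    refine limsup_le_of_le (by isBoundedDefault) ((h (z - a) (by linarith)).mono fun t ht => ?_)
    exact EReal.coe_le_coe_iff.mpr (by linarith)

namespace AttitudeTracking
namespace Data

variable {m : ℕ} {P : Data m}

/-! ### The comparison function `φ̄` -/

theorem b2_nonneg (P : Data m) : 0 ≤ P.b2 := by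
  have := matNorm_nonneg P.Jhat
  unfold b2; positivity

theorem rhoJ_pos_of_matNorm_Jhat_eq_zero (hP : P.Standing)
    (h : matNorm P.Jhat = 0) : 0 < P.rhoJ := by
  have hJ : P.Jhat = 0 := by
    have h1 : toCLM P.Jhat = 0 := norm_eq_zero.mp h
    exact (map_eq_zero_iff _ (Matrix.toEuclideanCLM (n := Fin 3) (𝕜 := ℝ)).injective).mp h1
  refine lt_of_lt_of_le ?_ hP.J_err
  rw [hJ, zero_sub]
  refine lt_of_le_of_ne (matNorm_nonneg _) fun h0 => ?_
  have h1 : toCLM (-P.J) = 0 := norm_eq_zero.mp h0.symm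
  have h2 : P.J = 0 := neg_eq_zero.mp
    ((map_eq_zero_iff _ (Matrix.toEuclideanCLM (n := Fin 3) (𝕜 := ℝ)).injective).mp h1)
  have h3 := isUnit_det_J hP
  rw [h2] at h3
  simp at h3

section Phi

variable (hP : P.Standing) (hk : 0 < P.k) (hgam : 0 < P.gam) (heps : P.rhos < P.eps)
  (hK : P.K.PosDef)
include hP hk

theorem b1_nonneg : 0 ≤ P.b1 := by
  have := matNorm_nonneg P.Jhat
  have := P.b2_nonneg
  have := a1_nonneg hP hk
  have := P.rho0_nonneg
  have := hP.rhov_nonneg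
  unfold b1; positivity

include hgam hK in
theorem b0_nonneg : 0 ≤ P.b0 := by
  have := matNorm_nonneg P.Jhat
  have := P.b2_nonneg
  have := a1_nonneg hP hk
  have := a0_nonneg hP hk
  have := rhos_nonneg hP hk
  have := P.rho0_nonneg
  have := hP.rhov_nonneg
  have := hP.rhoa_nonneg
  have := hP.rhoq_nonneg
  have := hP.rhow_nonneg
  have := hP.rhodhat_nonneg
  have := lamMax_pos hK
  unfold b0; positivity

include heps hgam hK in
theorem phiBar_nonneg {x : ℝ} (hx : 0 ≤ x) : 0 ≤ P.phiBar x 0 := by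
  refine le_trans ?_ (le_max_right _ _)
  have := P.b2_nonneg
  have := b1_nonneg hP hk
  have := b0_nonneg hP hk hgam hK
  have := a2_nonneg hP hk
  have := a1_nonneg hP hk
  have := a0_nonneg hP hk
  have := rhos_nonneg hP hk
  have := P.rho0_nonneg
  have := hP.rhoE_nonneg
  have := lamMax_pos hK
  have := eps_pos hP hk heps
  unfold phi2
  simp only [add_zero, mul_zero]
  positivity

include heps in
theorem phiBar_mono {x y : ℝ} (hx : 0 ≤ x) (hxy : x ≤ y) : P.phiBar x 0 ≤ P.phiBar y 0 := by
  have := P.b2_nonneg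
  have := b1_nonneg hP hk
  have := a2_nonneg hP hk
  have := a1_nonneg hP hk
  have := rhos_nonneg hP hk
  have := hP.rhoE_nonneg
  have := eps_pos hP hk heps
  unfold phiBar phi1 phi2
  simp only [add_zero]
  gcongr

include heps in
/-- With some uncertainty present, either the quadratic coefficient of `φ̄` or the part `a₁ ρ_s / ε`
of the linear one is positive; a vanishing inertia estimate counts as inertia uncertainty. -/
theorem phiBar_strictMono (hρ : 0 < P.rhoq ∨ 0 < P.rhoJ ∨ 0 < P.rhoE) {x y : ℝ} (hx : 0 ≤ x)
    (hxy : x < y) : P.phiBar x 0 < P.phiBar y 0 := by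
  have hb2 := P.b2_nonneg
  have hb1 := b1_nonneg hP hk
  have ha2 := a2_nonneg hP hk
  have ha1 := a1_nonneg hP hk
  have hs := rhos_nonneg hP hk
  have hE := hP.rhoE_nonneg
  have heps0 := eps_pos hP hk heps
  have hi : 0 < P.eps⁻¹ := inv_pos.mpr heps0
  have hcoef : 0 < P.a2 + P.rhoE * P.b2 ∨ 0 < P.a1 * P.rhos := by
    have hJpos : 0 < P.rhoJ → 0 < P.a2 + P.rhoE * P.b2 := fun h => by
      have : 0 < P.a2 := by unfold a2; positivity
      positivity
    rcases (matNorm_nonneg P.Jhat).eq_or_lt with h0 | h0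
    · exact Or.inl (hJpos (rhoJ_pos_of_matNorm_Jhat_eq_zero hP h0.symm))
    rcases hρ with h | h | h
    · right
      have h1 : 0 < P.rho0 := by
        refine Real.sqrt_pos.mpr ?_
        have h2 : Real.sqrt (1 - P.rhoq ^ 2) < 1 := by
          rw [Real.sqrt_lt' one_pos]
          have := pow_pos h 2
          linarith
        linarith
      have h2 : 0 < P.rhos := by
        have := hP.rhow_nonneg
        have := hP.rhov_nonneg
        unfold rhos; positivity
      have h3 : 0 < P.a1 := by
        have := a3_nonneg hP hk
        have := hP.rhov_nonneg
        have := hP.rhoJ_nonneg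
        unfold a1; positivity
      positivity
    · exact Or.inl (hJpos h)
    · left
      have : 0 < P.b2 := by unfold b2; positivity
      positivity
  have hsq : x ^ 2 < y ^ 2 := pow_lt_pow_left₀ hxy hx two_ne_zero
  have hquad : ∀ {d : ℝ}, 0 ≤ d → (0 < P.a2 + P.rhoE * P.b2 ∨ 0 < d) →
      (P.a2 + P.rhoE * P.b2) * x ^ 2 + d * x < (P.a2 + P.rhoE * P.b2) * y ^ 2 + d * y := by
    intro d hd h
    have hc : 0 ≤ P.a2 + P.rhoE * P.b2 := by positivity
    rcases h with h | h
    · have h1 := mul_lt_mul_of_pos_left hsq h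
      have h2 := mul_le_mul_of_nonneg_left hxy.le hd
      linarith
    · have h1 := mul_le_mul_of_nonneg_left hsq.le hc
      have h2 := mul_lt_mul_of_pos_left hxy h
      linarith
  have hpos : 0 ≤ P.eps⁻¹ * P.a1 * P.rhos := by positivity
  have e1 := hquad (d := 2 * P.eps⁻¹ * P.a1 * (P.rhos + 0) + P.rhoE * P.b1) (by positivity)
    (hcoef.imp_right fun h => by
      have h1 := mul_pos hi h
      have h2 : 0 ≤ P.rhoE * P.b1 := by positivity
      linarith)
  have e2 := hquad (d := P.eps⁻¹ * P.a1 * (P.rhos + 0) + P.a1 + P.rhoE * P.b1) (by positivity)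
    (hcoef.imp_right fun h => by
      have h1 := mul_pos hi h
      have h2 : 0 ≤ P.rhoE * P.b1 := by positivity
      linarith)
  unfold phiBar phi1 phi2
  refine max_lt_max ?_ ?_ <;> linarith

end Phi

/-! ### Ultimate bounds -/

theorem kappa_pos (hK : P.a3 + P.rhoE * (P.k * matNorm P.Jhat / 2 + lamMax P.K) < lamMin P.K) :
    0 < P.kappa := by
  unfold kappa b3
  linarith

/-- An ultimate bound on `q_e` gives one on `s`: the kinetic energy decreases at a positive rate
while it exceeds `λ_r L²`, for any `L > φ̄(X, 0) / κ`. -/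
theorem limsup_s_le (hP : P.Standing) (hk : 0 < P.k) (hgam : 0 < P.gam)
    (heps : P.rhos < P.eps) (hK : P.K.PosDef) (hκ : 0 < P.kappa) {qe : ℝ → ℍ[ℝ]} {s : ℝ → V3}
    (h : P.IsSolutionOn ⊤ qe s) {X : ℝ} (hX : 0 ≤ X)
    (hq : limsup (fun t => ((‖vec (qe t)‖ : ℝ) : EReal)) atTop ≤ (X : EReal)) :
    limsup (fun t => ((‖s t‖ : ℝ) : EReal)) atTop
      ≤ ((Real.sqrt (P.lamR / P.lamL) * (P.phiBar X 0 / P.kappa) : ℝ) : EReal) := by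
  rw [limsup_coe_le_iff] at hq ⊢
  intro ε hε
  set c := P.phiBar X 0 with hc
  have hc0 : 0 ≤ c := phiBar_nonneg hP hk hgam heps hK hX
  set S := Real.sqrt (P.lamR / P.lamL) with hS
  have hS0 : 0 ≤ S := Real.sqrt_nonneg _
  set L := c / P.kappa + ε / (S + 1) with hL
  have hεS : 0 < ε / (S + 1) := by positivity
  have hL0 : 0 < L := by positivity
  have hlamL := hP.lamL_pos
  have hlamR : 0 < P.lamR := hlamL.trans_le
    ((hP.lamL_le.trans (lamMin_le_lamMax hP.J_symm)).trans hP.le_lamR)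
  obtain ⟨η, hη, hη1, hη2⟩ : ∃ η : ℝ, 0 < η ∧ 0 < P.kappa - η ∧
      0 < (P.kappa - η) * L - (c + 2 * η) := by
    have h0 : 0 < (P.kappa - 0) * L - (c + 2 * 0) := by
      have : P.kappa * L = c + P.kappa * (ε / (S + 1)) := by
        rw [hL, mul_add, mul_div_cancel₀ _ hκ.ne']
      have := mul_pos hκ hεS
      linarith
    have c1 : Continuous fun η : ℝ => (P.kappa - η) * L - (c + 2 * η) := by fun_prop
    have c2 : Continuous fun η : ℝ => P.kappa - η := by fun_prop
    have e1 := (c1.tendsto 0).eventually_const_lt h0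
    have e2 := (c2.tendsto 0).eventually_const_lt (u := 0) (by simpa using hκ)
    obtain ⟨η, ⟨h1, h2⟩, h3⟩ := (((e1.and e2).filter_mono
      (nhdsWithin_le_nhds (s := Ioi 0))).and self_mem_nhdsWithin).exists
    exact ⟨η, h3, h2, h1⟩
  obtain ⟨δ, hδ, hδ1⟩ : ∃ δ : ℝ, 0 < δ ∧ P.phiBar (X + δ) 0 < c + η := by
    have c1 : Continuous fun δ : ℝ => P.phiBar (X + δ) 0 :=
      (continuous_phiBar P).comp (continuous_const.add continuous_id)
    have e1 := (c1.tendsto 0).eventually_lt_const (u := c + η) (by rw [add_zero]; linarith)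
    obtain ⟨δ, h1, h2⟩ := ((e1.filter_mono
      (nhdsWithin_le_nhds (s := Ioi 0))).and self_mem_nhdsWithin).exists
    exact ⟨δ, h2, h1⟩
  obtain ⟨T₀, hT₀⟩ := eventually_atTop.mp ((hq δ hδ).and
    ((eventually_inner_slidingRhs_le hP hk hgam heps hK hη).and (eventually_ge_atTop 0)))
  have hT0 : 0 ≤ T₀ := (hT₀ T₀ le_rfl).2.2
  set W : ℝ → ℝ := fun t => inner ℝ (s t) (act P.J (s t)) with hW
  have hev : ∀ᶠ t in atTop, -(P.lamR * L ^ 2) ≤ -W t := by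
    refine eventually_le_of_ae_deriv_ge (a := T₀)
      (μ := 2 * (L * ((P.kappa - η) * L - (c + 2 * η)))) (by positivity) (fun b hb => ?_) ?_
    · refine ((absolutelyContinuousOnInterval_inner_J
        (h.s_ac b (hT0.trans hb) (EReal.coe_lt_top b))).mono ?_).fun_neg
      rw [uIcc_of_le hb, uIcc_of_le (hT0.trans hb)]
      exact Icc_subset_Icc_left hT0
    · filter_upwards [h.ode] with t ht h1 h2
      have ht0 : 0 < t := hT0.trans_lt h1
      obtain ⟨-, s', ds, e⟩ := ht ht0 (EReal.coe_lt_top t)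
      obtain ⟨hqt, hrhs, -⟩ := hT₀ t h1.le
      refine ⟨_, (hasDerivAt_inner_J hP ds).fun_neg, ?_⟩
      have h3 := hrhs (qe t) (h.unit t ht0.le (EReal.coe_lt_top t)) (s t)
      have h4 : P.phiBar ‖vec (qe t)‖ 0 ≤ c + η :=
        (phiBar_mono hP hk heps (norm_nonneg _) hqt).trans hδ1.le
      have h5 : L < ‖s t‖ := by
        have h6 := inner_J_le_lamR_mul hP (s t)
        have h7 : P.lamR * L ^ 2 < P.lamR * ‖s t‖ ^ 2 := by
          have : P.lamR * L ^ 2 < W t := by linarith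
          linarith
        exact lt_of_pow_lt_pow_left₀ 2 (norm_nonneg _) (lt_of_mul_lt_mul_left h7 hlamR.le)
      have h8 := mul_le_mul_of_nonneg_left (add_le_add_left h4 η) (norm_nonneg (s t))
      have h9 : (P.kappa - η) * L - (c + 2 * η) ≤ (P.kappa - η) * ‖s t‖ - (c + 2 * η) := by
        have := mul_le_mul_of_nonneg_left h5.le hη1.le
        linarith
      have h10 := mul_le_mul h5.le h9 hη2.le (norm_nonneg (s t))
      rw [e]
      linarith
  filter_upwards [hev] with t ht
  have h1 := lamL_mul_le_inner_J hP (s t)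
  have h2 : ‖s t‖ ^ 2 ≤ (S * L) ^ 2 := by
    rw [mul_pow, hS, Real.sq_sqrt (by positivity), div_mul_eq_mul_div, le_div_iff₀ hlamL]
    simp only [hW] at ht
    linarith
  have h3 := le_of_sq_le_sq h2 (by positivity)
  have h4 : S * (ε / (S + 1)) ≤ ε := by
    rw [mul_div_assoc', div_le_iff₀ (by positivity)]
    linarith
  rw [hL, mul_add] at h3
  linarith

/-- An ultimate bound on `s` gives one on `q_e`: with `x = ‖q_e‖`, the scalar part of `q_e` grows at
least at the rate `x (k x - ‖s‖) / 2`. Hence either it stays close to `-1`, or it leaves the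
interval of values for which `x` is above the bound, upwards and for ever. -/
theorem limsup_vec_le (hk : 0 < P.k) {qe : ℝ → ℍ[ℝ]} {s : ℝ → V3}
    (h : P.IsSolutionOn ⊤ qe s) {σ : ℝ} (hσ : 0 ≤ σ)
    (hs : limsup (fun t => ((‖s t‖ : ℝ) : EReal)) atTop ≤ (σ : EReal)) :
    limsup (fun t => ((‖vec (qe t)‖ : ℝ) : EReal)) atTop ≤ ((P.k⁻¹ * σ : ℝ) : EReal) := by
  rw [limsup_coe_le_iff] at hs ⊢
  intro ε hε
  set β := P.k⁻¹ * σ + ε with hβ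
  set β' := P.k⁻¹ * σ + ε / 2 with hβ'
  have hβ'0 : 0 < β' := by positivity
  have hββ : β' < β := by linarith
  obtain ⟨T₀, hT₀⟩ := eventually_atTop.mp
    ((hs (P.k * (ε / 2)) (by positivity)).and (eventually_ge_atTop 0))
  have hT0 : 0 ≤ T₀ := (hT₀ T₀ le_rfl).2
  have hsb : ∀ t, T₀ ≤ t → ‖s t‖ ≤ P.k * β' := fun t ht => by
    have := (hT₀ t ht).1
    rw [hβ', mul_add, mul_inv_cancel_left₀ hk.ne']
    exact this
  have hunit : ∀ t, T₀ ≤ t → (qe t).re ^ 2 + ‖vec (qe t)‖ ^ 2 = 1 := fun t ht => by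
    rw [← norm_sq_quaternion, h.unit t (hT0.trans ht) (EReal.coe_lt_top t), one_pow]
  -- for `β ≥ 1` there is nothing to prove, and `√(1 - β²)` would be a junk value
  rcases le_or_gt 1 β with h1 | h1
  · filter_upwards [eventually_ge_atTop T₀] with t ht
    refine le_trans ?_ h1
    exact (norm_vec_le _).trans (h.unit t (hT0.trans ht) (EReal.coe_lt_top t)).le
  set c := Real.sqrt (1 - β ^ 2) with hc
  set c' := Real.sqrt (1 - β' ^ 2) with hc'
  have hβ2 : β ^ 2 < 1 := pow_lt_one₀ (hβ'0.trans hββ).le h1 two_ne_zero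
  have hββ2 : β' ^ 2 < β ^ 2 := pow_lt_pow_left₀ hββ hβ'0.le two_ne_zero
  have hcsq : c ^ 2 = 1 - β ^ 2 := Real.sq_sqrt (by linarith)
  have hcsq' : c' ^ 2 = 1 - β' ^ 2 := Real.sq_sqrt (by linarith)
  have hc0 : 0 < c := Real.sqrt_pos.mpr (by linarith)
  have hcc : c < c' := Real.sqrt_lt_sqrt (by linarith) (by linarith)
  -- `‖q_e‖ ≤ β` means that `|q₀| ≥ c`
  have hfin : ∀ t, T₀ ≤ t → c ^ 2 ≤ (qe t).re ^ 2 → ‖vec (qe t)‖ ≤ β := fun t ht hre => by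
    have := hunit t ht
    exact le_of_sq_le_sq (by linarith) (hβ'0.trans hββ).le
  have hac : ∀ a b, 0 ≤ a → a ≤ b → AbsolutelyContinuousOnInterval (fun t => (qe t).re) a b :=
    fun a b ha hab => by
      have h2 := (h.qe_ac b (ha.trans hab) (EReal.coe_lt_top b)).mono (c := a) (d := b) (by
        rw [uIcc_of_le hab, uIcc_of_le (ha.trans hab)]
        exact Icc_subset_Icc_left ha)
      exact AbsolutelyContinuousOnInterval.locallyLipschitz_comp (g := fun q : ℍ[ℝ] => q.re)
        reL.lipschitz.locallyLipschitz h2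
  have hd : ∀ᵐ t, T₀ < t → ∃ d, HasDerivAt (fun t => (qe t).re) d t ∧
      1 / 2 * P.k * (‖vec (qe t)‖ * (‖vec (qe t)‖ - β')) ≤ d := by
    filter_upwards [h.ode] with t ht h2
    obtain ⟨dq, -⟩ := ht (hT0.trans_lt h2) (EReal.coe_lt_top t)
    refine ⟨_, reL.hasFDerivAt.comp_hasDerivAt t dq, ?_⟩
    rw [reL_apply, kinematics_re, omegaE, inner_sub_right, inner_smul_right,
      real_inner_self_eq_norm_sq]
    have h3 := real_inner_le_norm (vec (qe t)) (s t)
    have h4 := mul_le_mul_of_nonneg_left (hsb t h2.le) (norm_nonneg (vec (qe t)))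
    linarith
  -- either the scalar part never leaves the neighbourhood of `-1`, or it passes `-c` once
  by_cases hlow : ∀ t, T₀ ≤ t → (qe t).re ≤ -c
  · filter_upwards [eventually_ge_atTop T₀] with t ht
    refine hfin t ht ?_
    have := hlow t ht
    rw [← neg_sq (qe t).re]
    exact pow_le_pow_left₀ hc0.le (by linarith) 2
  push Not at hlow
  obtain ⟨t₁, ht₁, hre₁⟩ := hlow
  have hstay : ∀ t, t₁ ≤ t → -c ≤ (qe t).re := fun b hb => by
    refine le_of_ae_deriv_nonneg_of_band (c' := -c') hb (by linarith)
      (hac t₁ b (hT0.trans ht₁) hb) hre₁.le ?_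
    filter_upwards [hd] with t ht h2 _ h4 h5
    obtain ⟨d, hd, hle⟩ := ht (ht₁.trans_lt h2)
    refine ⟨d, hd, le_trans ?_ hle⟩
    have h6 : (qe t).re ^ 2 < c' ^ 2 := sq_lt_sq' h4 (by linarith)
    have h7 := hunit t (ht₁.trans h2.le)
    have h8 : β' < ‖vec (qe t)‖ :=
      lt_of_pow_lt_pow_left₀ 2 (norm_nonneg _) (by linarith)
    have h9 : 0 ≤ ‖vec (qe t)‖ - β' := by linarith
    positivity
  have hup : ∀ᶠ t in atTop, c ≤ (qe t).re := by
    refine eventually_le_of_ae_deriv_ge (a := t₁) (μ := 1 / 2 * P.k * (β * (β - β')))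
      (by have : 0 < β - β' := by linarith
          positivity) (fun b hb => hac t₁ b (hT0.trans ht₁) hb) ?_
    filter_upwards [hd] with t ht h2 h3
    obtain ⟨d, hd, hle⟩ := ht (ht₁.trans_lt h2)
    refine ⟨d, hd, le_trans ?_ hle⟩
    have h6 : (qe t).re ^ 2 ≤ c ^ 2 := sq_le_sq' (hstay t h2.le) h3.le
    have h7 := hunit t (ht₁.trans h2.le)
    have h8 : β ≤ ‖vec (qe t)‖ := le_of_sq_le_sq (by linarith) (norm_nonneg _)
    have h9 : 0 ≤ β - β' := by linarith
    gcongr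
  filter_upwards [hup, eventually_ge_atTop T₀] with t h2 h3
  exact hfin t h3 (pow_le_pow_left₀ hc0.le h2 2)

theorem qbar_eq (P : Data m) {i : ℕ} (hi : 1 ≤ i) : P.qbar i = P.k⁻¹ * P.sbar i := by
  obtain ⟨j, rfl⟩ := Nat.exists_eq_add_of_le' hi
  rfl

section Bounds

variable (hP : P.Standing) (hk : 0 < P.k) (hgam : 0 < P.gam) (heps : P.rhos < P.eps)
  (hK : P.K.PosDef) (hκ : 0 < P.kappa)
include hP hk hgam heps hK hκ

theorem qbar_nonneg (i : ℕ) : 0 ≤ P.qbar i := by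
  induction i with
  | zero => exact zero_le_one
  | succ i ih =>
    have := phiBar_nonneg hP hk hgam heps hK ih
    rw [qbar]; positivity

theorem sbar_nonneg (i : ℕ) : 0 ≤ P.sbar i := by
  have := phiBar_nonneg hP hk hgam heps hK
    (qbar_nonneg hP hk hgam heps hK hκ (i - 1))
  rw [sbar]; positivity

theorem limsup_le_qbar {qe : ℝ → ℍ[ℝ]} {s : ℝ → V3} (h : P.IsSolutionOn ⊤ qe s) (i : ℕ) :
    limsup (fun t => ((‖vec (qe t)‖ : ℝ) : EReal)) atTop ≤ (P.qbar i : EReal) := by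
  induction i with
  | zero =>
    rw [limsup_coe_le_iff]
    intro ε hε
    filter_upwards [eventually_ge_atTop 0] with t ht
    have h1 := (norm_vec_le _).trans (h.unit t ht (EReal.coe_lt_top t)).le
    change _ ≤ 1 + ε
    linarith
  | succ i ih =>
    exact limsup_vec_le hk h (sbar_nonneg hP hk hgam heps hK hκ (i + 1))
      (limsup_s_le hP hk hgam heps hK hκ h (qbar_nonneg hP hk hgam heps hK hκ i) ih)

theorem limsup_le_sbar {qe : ℝ → ℍ[ℝ]} {s : ℝ → V3} (h : P.IsSolutionOn ⊤ qe s) (i : ℕ) :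
    limsup (fun t => ((‖s t‖ : ℝ) : EReal)) atTop ≤ (P.sbar i : EReal) :=
  limsup_s_le hP hk hgam heps hK hκ h (qbar_nonneg hP hk hgam heps hK hκ (i - 1))
    (limsup_le_qbar hP hk hgam heps hK hκ h (i - 1))

theorem limsup_omegaE_le {qe : ℝ → ℍ[ℝ]} {s : ℝ → V3} (h : P.IsSolutionOn ⊤ qe s) {i : ℕ}
    (hi : 1 ≤ i) : limsup (fun t => ((‖P.omegaE (qe t) (s t)‖ : ℝ) : EReal)) atTop
      ≤ ((2 * P.sbar i : ℝ) : EReal) := by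
  have h1 := limsup_le_sbar hP hk hgam heps hK hκ h i
  have h2 := limsup_le_qbar hP hk hgam heps hK hκ h i
  rw [limsup_coe_le_iff] at h1 h2 ⊢
  intro ε hε
  filter_upwards [h1 (ε / 2) (by positivity), h2 (P.k⁻¹ * (ε / 2)) (by positivity)] with t ht1 ht2
  refine (norm_omegaE_le hk.le _ _).trans ?_
  have h3 := mul_le_mul_of_nonneg_left ht2 hk.le
  rw [qbar_eq P hi, ← mul_add, mul_inv_cancel_left₀ hk.ne'] at h3
  linarith

/-! ### Monotonicity and convergence of the bounds -/

theorem antitone_qbar (h1 : P.qbar 1 < 1) : Antitone P.qbar := by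
  refine antitone_nat_of_succ_le fun i => ?_
  induction i with
  | zero => exact h1.le
  | succ i ih =>
    have := phiBar_mono hP hk heps (qbar_nonneg hP hk hgam heps hK hκ (i + 1)) ih
    rw [qbar.eq_def P (i + 1 + 1), qbar.eq_def P (i + 1)]
    simp only
    gcongr

theorem strictAnti_qbar (h1 : P.qbar 1 < 1) (hρ : 0 < P.rhoq ∨ 0 < P.rhoJ ∨ 0 < P.rhoE) :
    StrictAnti P.qbar := by
  have hlamL := hP.lamL_pos
  have hlamR : 0 < P.lamR := hlamL.trans_le
    ((hP.lamL_le.trans (lamMin_le_lamMax hP.J_symm)).trans hP.le_lamR)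
  have hS : 0 < Real.sqrt (P.lamR / P.lamL) := Real.sqrt_pos.mpr (by positivity)
  refine strictAnti_nat_of_succ_lt fun i => ?_
  induction i with
  | zero => exact h1
  | succ i ih =>
    have := phiBar_strictMono hP hk heps hρ (qbar_nonneg hP hk hgam heps hK hκ (i + 1)) ih
    rw [qbar.eq_def P (i + 1 + 1), qbar.eq_def P (i + 1)]
    simp only
    gcongr

theorem exists_tendsto_qbar (h1 : P.qbar 1 < 1) : ∃ l : ℝ, Tendsto P.qbar atTop (𝓝 l) :=
  ⟨_, tendsto_atTop_ciInf (antitone_qbar hP hk hgam heps hK hκ h1)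
    ⟨0, by rintro _ ⟨i, rfl⟩; exact qbar_nonneg hP hk hgam heps hK hκ i⟩⟩

end Bounds

theorem sbar_eq (hk : 0 < P.k) {i : ℕ} (hi : 1 ≤ i) : P.sbar i = P.k * P.qbar i := by
  rw [qbar_eq P hi, mul_inv_cancel_left₀ hk.ne']

end Data
end AttitudeTracking
end

theorem theorem1 {m : ℕ} (P : AttitudeTracking.Data m) (hP : P.Standing)
    (hk : 0 < P.k)
    (hKpd : P.K.PosDef)
    (hK : P.a3 + P.rhoE * (P.k * AttitudeTracking.matNorm P.Jhat / 2
      + AttitudeTracking.lamMax P.K) < AttitudeTracking.lamMin P.K)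
    (hgam : 0 < P.gam)
    (heps : P.rhos < P.eps) :
    -- no finite escape time: all initial states give solutions on `[0, ∞)`, and
    -- every solution on a bounded interval `[0, T)` continues to `[0, ∞)`
    (∀ (q₀ : Quaternion ℝ) (s₀ : AttitudeTracking.V3), ‖q₀‖ = 1 →
      ∃ (qe : ℝ → Quaternion ℝ) (s : ℝ → AttitudeTracking.V3),
        P.IsSolutionOn ⊤ qe s ∧ qe 0 = q₀ ∧ s 0 = s₀) ∧
    (∀ (T : ℝ), 0 < T → ∀ (qe : ℝ → Quaternion ℝ) (s : ℝ → AttitudeTracking.V3),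
      P.IsSolutionOn (T : EReal) qe s →
      ∃ (qe' : ℝ → Quaternion ℝ) (s' : ℝ → AttitudeTracking.V3),
        P.IsSolutionOn ⊤ qe' s' ∧ ∀ t ∈ Set.Ico 0 T, qe' t = qe t ∧ s' t = s t) ∧
    -- ultimate bounds
    0 < P.kappa ∧
    (∀ (qe : ℝ → Quaternion ℝ) (s : ℝ → AttitudeTracking.V3), P.IsSolutionOn ⊤ qe s →
      ∀ i : ℕ, 1 ≤ i →
        Filter.limsup (fun t => ((‖s t‖ : ℝ) : EReal)) Filter.atTop ≤ (P.sbar i : EReal) ∧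
        Filter.limsup (fun t => ((‖AttitudeTracking.vec (qe t)‖ : ℝ) : EReal)) Filter.atTop
          ≤ (P.qbar i : EReal) ∧
        Filter.limsup (fun t => ((‖P.omegaE (qe t) (s t)‖ : ℝ) : EReal)) Filter.atTop
          ≤ ((2 * P.sbar i : ℝ) : EReal)) ∧
    (∀ i : ℕ, 1 ≤ i → P.qbar i = P.k⁻¹ * P.sbar i) ∧
    -- monotonicity and convergence of the bounds
    (P.qbar 1 < 1 →
      ((∃ l : ℝ, Filter.Tendsto P.sbar Filter.atTop (nhds l)) ∧
        ∃ l : ℝ, Filter.Tendsto P.qbar Filter.atTop (nhds l)) ∧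
      ((0 < P.rhoq ∨ 0 < P.rhoJ ∨ 0 < P.rhoE) →
        StrictAntiOn P.sbar (Set.Ici 1) ∧ StrictAnti P.qbar)) := by
  have hκ := AttitudeTracking.Data.kappa_pos hK
  refine ⟨fun q₀ s₀ hq₀ => AttitudeTracking.Data.exists_global_solution hP hk hgam heps hKpd
      q₀ s₀ hq₀,
    fun T hT qe s h => AttitudeTracking.Data.IsSolutionOn.exists_extension hP hk hgam heps hKpd
      hT h, hκ,
    fun qe s h i hi => ⟨AttitudeTracking.Data.limsup_le_sbar hP hk hgam heps hKpd hκ h i,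
      AttitudeTracking.Data.limsup_le_qbar hP hk hgam heps hKpd hκ h i,
      AttitudeTracking.Data.limsup_omegaE_le hP hk hgam heps hKpd hκ h hi⟩,
    fun i hi => AttitudeTracking.Data.qbar_eq P hi, fun h1 => ⟨?_, fun hρ => ?_⟩⟩
  · obtain ⟨l, hl⟩ := AttitudeTracking.Data.exists_tendsto_qbar hP hk hgam heps hKpd hκ h1
    refine ⟨⟨P.k * l, (hl.const_mul P.k).congr' ?_⟩, l, hl⟩
    filter_upwards [Filter.eventually_ge_atTop 1] with i hi
    exact (AttitudeTracking.Data.sbar_eq hk hi).symm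
  · have hanti := AttitudeTracking.Data.strictAnti_qbar hP hk hgam heps hKpd hκ h1 hρ
    refine ⟨fun i hi j hj hij => ?_, hanti⟩
    rw [AttitudeTracking.Data.sbar_eq hk hi, AttitudeTracking.Data.sbar_eq hk hj]
    exact mul_lt_mul_of_pos_left (hanti hij) hk
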